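/- Let $\Omega\subset\mathbb R^3$ be a bounded open set whose boundary $\Gamma=\partial\Omega$ is a smooth ($C^\infty$) closed surface, let $\bar n_{p}$ be the unit normal of $\Gamma$ at $p\in\Gamma$ pointing out of $\Omega$, let $d_\Gamma$ be the signed distance to $\Gamma$ (negative in $\Omega$), and let $P_\Gamma:\mathbb R^3\to\Gamma$ map every point to a closest point on $\Gamma$. Let $0<\varepsilon<\tau_\Gamma$, where the reach $\tau_\Gamma$ is the distance between $\Gamma$ and the set of points with more than one closest point on $\Gamma$. Let $\bar x^*=(x^*,y^*,z^*)\in\Gamma$, write $\bar n=\bar n_{\bar x^*}=(n_1,n_2,n_3)$ and suppose that $n_3=\bar n^T\bar e_z\ne0$. Let $z\in\mathbb R$, let $\bar y_0(z)=(\mathbf y_0(z),z)=\bar x^*+\frac{z-z^*}{n_3}\bar n$ be the point at height $z$ on the normal line at $\bar x^*$, and suppose that $|\bar y_0(z)-\bar x^*|\le\varepsilon$. For $\mathbf y\in\mathbb R^2$ put $\bar q=P_\Gamma(\mathbf y+\mathbf y_0(z),z)$ and $$s^{SL}(\mathbf y;z)=\frac1{4\pi}\frac1{|\bar q-\bar x^*|},\quad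 s^{DL}(\mathbf y;z)=-\frac1{4\pi}\frac{\bar n_{\bar q}^T(\bar q-\bar x^*)}{|\bar q-\bar x^*|^3},\quad s^{DLC}(\mathbf y;z)=\frac1{4\pi}\frac{\bar n^T(\bar q-\bar x^*)}{|\bar q-\bar x^*|^3}.$$ Then there are $r>0$ (depending on $z$) and functions $\ell^X\in C^\infty((-r,r)\times\mathbb S^1)$, $X\in\{SL,DL,DLC\}$, such that $$s^X(\mathbf y;z)=\frac1{|\mathbf y|}\,\ell^X\Big(|\mathbf y|,\frac{\mathbf y}{|\mathbf y|}\Big),\qquad 0<|\mathbf y|<r .$$ Moreover, let $\bar\tau_1,\bar\tau_2$ be orthonormal principal directions of $\Gamma$ at $\bar x^*$ with principal curvatures $\kappa_1,\kappa_2$ (with the sign convention $d\bar n(\bar\tau_i)=-\kappa_i\bar\tau_i$), let $f$ be the smooth function whose graph in the coordinate system with origin $\bar x^*$ and axes $\bar\tau_1,\bar\tau_2,\bar n$ is $\Gamma$ near $\bar x^*$, and let $f_{xxx},f_{xxy},f_{xyy},f_{yyy}$ be its third derivatives at the origin. Let $Q$ be the matrix with columns $\bar\tau_1,\bar\tau_2,\bar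 n$, write $Q^T=\begin{pmatrix}A&\mathbf c\\ \mathbf d^T&\alpha\end{pmatrix}$ with $A\in\mathbb R^{2\times2}$, and put $M=\mathrm{diag}(\kappa_1,\kappa_2)$, $\eta=d_\Gamma(\bar y_0(z))$. Then $I-\eta M$ is invertible; put $D_0=(I-\eta M)^{-1}$. For $\mathbf v=(v_1,v_2)$ let $$B(\mathbf v)=\tfrac12\big[\tfrac13f_{xxx}v_1^3+\tfrac13f_{yyy}v_2^3+f_{xxy}v_1^2v_2+f_{xyy}v_1v_2^2\big],\qquad C(\mathbf v)=\tfrac12\begin{pmatrix}f_{xxx}v_1^2+2f_{xxy}v_1v_2+f_{xyy}v_2^2\\ f_{yyy}v_2^2+2f_{xyy}v_1v_2+f_{xxy}v_1^2\end{pmatrix},$$ and, with $\chi_0=\chi_0(\mathbf y)=D_0A\mathbf y$ and $C=C(\chi_0)$, $B=B(\chi_0)$, $$\chi_1(\mathbf y)=(\mathbf d^T\mathbf y)D_0D_0MA\mathbf y+\eta D_0C,\qquad \psi_0(\mathbf y)=|\chi_0|,\qquad \psi_1(\mathbf y)=\frac{\chi_0^T\chi_1}{|\chi_0|},\qquad \xi_0(\mathbf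 y)=\tfrac12\mathbf y^TA^TD_0^TMD_0A\mathbf y,$$ $$\xi_1(\mathbf y)=\tfrac12\eta(D_0C)^TM\chi_0+\tfrac12\eta\chi_0^TMD_0C+B+(\mathbf d^T\mathbf y)\,\mathbf y^TA^TM^TD_0^TD_0^TMD_0A\mathbf y,$$ $$\tilde\xi_1(\mathbf y)=\tfrac12\eta\big[(D_0C)^TM\chi_0-\chi_0^TMD_0C\big]-B+\mathbf y^TA^TD_0^T(I+\eta MD_0)C+(\mathbf d^T\mathbf y)\,\mathbf y^TA^TD_0MD_0D_0MA\mathbf y .$$ Then $\psi_0(\mathbf y)\ne0$ for $\mathbf y\neq0$, and with $\hat{\mathbf y}=\mathbf y/|\mathbf y|$ the first two expansion terms $s_k^X(\mathbf y)=|\mathbf y|^{k-1}\frac1{k!}\partial_r^k\ell^X(0,\hat{\mathbf y})$, $k=0,1$, are $$s_0^{SL}=\frac1{4\pi}\frac1{|\mathbf y|}\frac1{\psi_0(\hat{\mathbf y})},\qquad s_1^{SL}=-\frac1{4\pi}\frac{\psi_1(\hat{\mathbf y})}{\psi_0(\hat{\mathbf y})^2},$$ $$s_0^{DLC}=s_0^{DL}=\frac1{4\pi}\frac1{|\mathbf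 y|}\frac{\xi_0(\hat{\mathbf y})}{\psi_0(\hat{\mathbf y})^3},$$ $$s_1^{DLC}=\frac1{4\pi}\Big(-3\frac{\xi_0(\hat{\mathbf y})\psi_1(\hat{\mathbf y})}{\psi_0(\hat{\mathbf y})^4}+\frac{\xi_1(\hat{\mathbf y})}{\psi_0(\hat{\mathbf y})^3}\Big),\qquad s_1^{DL}=\frac1{4\pi}\Big(-3\frac{\xi_0(\hat{\mathbf y})\psi_1(\hat{\mathbf y})}{\psi_0(\hat{\mathbf y})^4}+\frac{\tilde\xi_1(\hat{\mathbf y})}{\psi_0(\hat{\mathbf y})^3}\Big),$$ and $s^X(\mathbf y;z)=s_0^X(\mathbf y)+s_1^X(\mathbf y)+\mathcal O(|\mathbf y|)$ as $\mathbf y\to0$, $\mathbf y\ne 0$. -/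

import Mathlib

open Set Filter Topology Asymptotics
open scoped ContDiff Manifold Matrix RealInnerProductSpace

noncomputable section

/-- The plane `ℝ²` with its Euclidean norm. -/
abbrev E2 : Type := EuclideanSpace ℝ (Fin 2)

/-- The space `ℝ³` with its Euclidean norm. -/
abbrev E3 : Type := EuclideanSpace ℝ (Fin 3)

instance finrankE2 : Fact (Module.finrank ℝ E2 = 1 + 1) := ⟨by simp⟩

/-! ### Smooth closed surfaces in `ℝ³` -/

/-- `φ` is a smooth local defining function of the open set `Ω` at `x`: near `x` the set `Ω` is
`{φ < 0}`, its boundary is `{φ = 0}`, and the gradient of `φ` does not vanish at `x`. -/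
def IsLocalDefiningFunction (Ω : Set E3) (x : E3) (φ : E3 → ℝ) : Prop :=
  gradient φ x ≠ 0 ∧ ∃ U : Set E3, IsOpen U ∧ x ∈ U ∧ ContDiffOn ℝ ∞ φ U ∧
    ∀ p ∈ U, (p ∈ Ω ↔ φ p < 0) ∧ (p ∈ frontier Ω ↔ φ p = 0)

/-- `Γ` is a smooth, closed and bounded surface, and `Ω` is the bounded region enclosed by it. -/
structure IsSmoothClosedSurface (Γ Ω : Set E3) : Prop where
  isOpen : IsOpen Ω
  isBounded : Bornology.IsBounded Ω
  frontier_eq : frontier Ω = Γ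
  smooth : ∀ x ∈ Γ, ∃ φ : E3 → ℝ, IsLocalDefiningFunction Ω x φ

/-- `n` is the unit normal at the boundary point `x` of `Ω`, pointing out of `Ω`. -/
def IsOutwardUnitNormal (Ω : Set E3) (x n : E3) : Prop :=
  ∃ φ : E3 → ℝ, IsLocalDefiningFunction Ω x φ ∧ n = ‖gradient φ x‖⁻¹ • gradient φ x

/-- The signed distance to `Γ`, negative in `Ω`. -/
def surfaceSignedDist (Γ Ω : Set E3) (p : E3) : ℝ :=
  open Classical in if p ∈ Ω then -Metric.infDist p Γ else Metric.infDist p Γ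

/-- `q` is a closest point to `p` on `Γ`. -/
def IsClosestPoint (Γ : Set E3) (p q : E3) : Prop :=
  q ∈ Γ ∧ ∀ q' ∈ Γ, dist p q ≤ dist p q'

/-- `P` is a closest point mapping of `Γ`: it sends every point to one of its closest points. -/
def IsClosestPointMap (Γ : Set E3) (P : E3 → E3) : Prop :=
  ∀ p, IsClosestPoint Γ p (P p)

/-- The set of all points that have non-unique closest points on `Γ`. -/
def nonuniqueSet (Γ : Set E3) : Set E3 :=
  {p | ∃ q q', q ≠ q' ∧ IsClosestPoint Γ p q ∧ IsClosestPoint Γ p q'}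

/-- The reach of `Γ`. -/
def reach (Γ : Set E3) : ENNReal :=
  ⨅ x ∈ Γ, ⨅ y ∈ nonuniqueSet Γ, edist x y

/-! ### The layer kernels on the planes `z = const` -/

/-- Single-layer, double-layer and double-layer conjugate. -/
inductive LayerKernel : Type where
  | SL : LayerKernel
  | DL : LayerKernel
  | DLC : LayerKernel

/-- The Laplace kernels `K(x, y)`, with `nx`, `ny` the normals at `x` and `y`. -/
def layerKernel (X : LayerKernel) (nx ny x y : E3) : ℝ :=
  match X with
  | .SL => 1 / (4 * Real.pi) * (1 / ‖x - y‖)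
  | .DL => 1 / (4 * Real.pi) * (⟪x - y, ny⟫ / ‖x - y‖ ^ 3)
  | .DLC => -(1 / (4 * Real.pi)) * (⟪x - y, nx⟫ / ‖x - y‖ ^ 3)

/-- The point `(y, z)` of `ℝ³`, for `y ∈ ℝ²` and `z ∈ ℝ`. -/
def planePoint (y : E2) (z : ℝ) : E3 := !₂[y 0, y 1, z]

/-- The point at height `z` on the line through `x` in direction `n` (with `n₃ ≠ 0`). -/
def normalLinePoint (x n : E3) (z : ℝ) : E3 := x + ((z - x 2) / n 2) • n

/-- The first two coordinates of the point at height `z` on the normal line. -/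
def normalLinePlanar (x n : E3) (z : ℝ) : E2 :=
  !₂[normalLinePoint x n z 0, normalLinePoint x n z 1]

/-- `s(y; z) = K(x, P(y + y₀(z), z))`, for target point `x`, normal field `ν` and closest point
mapping `P`. -/
def singularFunction (X : LayerKernel) (ν P : E3 → E3) (x : E3) (z : ℝ) (y : E2) : ℝ :=
  let q : E3 := P (planePoint (y + normalLinePlanar x (ν x) z) z)
  layerKernel X (ν x) (ν q) x q

/-- The direction `y / |y|` of a nonzero vector, as a point of the unit circle. -/
def unitDir (y : E2) (hy : y ≠ 0) : Metric.sphere (0 : E2) 1 :=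
  ⟨‖y‖⁻¹ • y, by simp [norm_smul, norm_ne_zero_iff.mpr hy]⟩

/-- `s_k(y) = |y|^(k-1) φ_k(y/|y|)` with `φ_k(u) = (1/k!) ∂_r^k ℓ(0, u)`: the `k`-th term of the
expansion of `s(y) = |y|⁻¹ ℓ(|y|, y/|y|)`. -/
def expansionTerm (ℓ : ℝ → Metric.sphere (0 : E2) 1 → ℝ) (k : ℕ) (y : E2) (hy : y ≠ 0) : ℝ :=
  ‖y‖ ^ ((k : ℤ) - 1) *
    (1 / (k.factorial : ℝ) * iteratedDeriv k (fun t => ℓ t (unitDir y hy)) 0)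

/-! ### Local geometry at the target point -/

/-- `τ 0, τ 1` are (unit, mutually orthogonal) principal directions of `Γ` at `x` and `κ 0, κ 1`
are the corresponding principal curvatures, with respect to the unit normal field `ν`: the
differential of `ν` along `Γ` maps `τ i` to `-κ i • τ i`. With the outward normal, the curvatures
of a round sphere are negative. -/
def IsPrincipalFrame (Γ : Set E3) (ν : E3 → E3) (x : E3) (τ : Fin 2 → E3) (κ : Fin 2 → ℝ) : Prop :=
  Orthonormal ℝ ![τ 0, τ 1, ν x] ∧
    ∃ S : E3 →L[ℝ] E3, HasFDerivWithinAt ν S Γ x ∧ ∀ i, S (τ i) = -κ i • τ i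

/-- `f` is a smooth function near `0` whose graph, in the coordinates with origin `x` and
orthonormal basis `(τ 0, τ 1, n)`, is `Γ` near `x`. -/
def IsLocalGraph (Γ : Set E3) (x : E3) (τ : Fin 2 → E3) (n : E3) (f : E2 → ℝ) : Prop :=
  (∃ L : ℝ, 0 < L ∧ ContDiffOn ℝ ∞ f (Metric.ball 0 L)) ∧
    ∀ᶠ p in 𝓝 x, (p ∈ Γ ↔ ⟪n, p - x⟫ = f !₂[⟪τ 0, p - x⟫, ⟪τ 1, p - x⟫])

/-- The third order partial derivative `∂_i ∂_j ∂_k f` at the origin. -/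
def thirdPartial (f : E2 → ℝ) (i j k : Fin 2) : ℝ :=
  iteratedFDeriv ℝ 3 f 0
    ![EuclideanSpace.single i 1, EuclideanSpace.single j 1, EuclideanSpace.single k 1]

/-- The numbers that enter the expansion formulas. -/
structure LocalData where
  A : Matrix (Fin 2) (Fin 2) ℝ
  d : Fin 2 → ℝ
  M : Matrix (Fin 2) (Fin 2) ℝ
  η : ℝ
  fxxx : ℝ
  fxxy : ℝ
  fxyy : ℝ
  fyyy : ℝ

/-- The data of the surface at a target point: for the orthogonal matrix `Q` with columns
`τ 0, τ 1, n`, the matrix `A` is the upper left `2 × 2` block of `Qᵀ` and `dᵀ` is the lower left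
`1 × 2` block of `Qᵀ`; `M = diag(κ 0, κ 1)`. -/
def localData (τ : Fin 2 → E3) (n : E3) (κ : Fin 2 → ℝ) (η : ℝ) (f : E2 → ℝ) : LocalData where
  A := !![τ 0 0, τ 0 1; τ 1 0, τ 1 1]
  d := ![n 0, n 1]
  M := Matrix.diagonal κ
  η := η
  fxxx := thirdPartial f 0 0 0
  fxxy := thirdPartial f 0 0 1
  fxyy := thirdPartial f 0 1 1
  fyyy := thirdPartial f 1 1 1

namespace LocalData

variable (g : LocalData)

/-- The cubic form `B(y, y, y)`. -/
def B (y : Fin 2 → ℝ) : ℝ :=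
  1 / 2 * (g.fxxx * (y 0 ^ 3 / 3) + g.fyyy * (y 1 ^ 3 / 3) + g.fxxy * y 0 ^ 2 * y 1
    + g.fxyy * y 0 * y 1 ^ 2)

/-- The gradient `C(y, y)` of the cubic form `B`. -/
def C (y : Fin 2 → ℝ) : Fin 2 → ℝ :=
  (1 / 2 : ℝ) • ![g.fxxx * y 0 ^ 2 + 2 * g.fxxy * y 0 * y 1 + g.fxyy * y 1 ^ 2,
    g.fyyy * y 1 ^ 2 + 2 * g.fxyy * y 0 * y 1 + g.fxxy * y 0 ^ 2]

/-- `D₀ = (I - η M)⁻¹`. -/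
def D₀ : Matrix (Fin 2) (Fin 2) ℝ := (1 - g.η • g.M)⁻¹

def χ₀ (y : Fin 2 → ℝ) : Fin 2 → ℝ := (g.D₀ * g.A) *ᵥ y

def χ₁ (y : Fin 2 → ℝ) : Fin 2 → ℝ :=
  (g.d ⬝ᵥ y) • ((g.D₀ * g.D₀ * g.M * g.A) *ᵥ y) + g.η • (g.D₀ *ᵥ g.C (g.χ₀ y))

def ξ₀ (y : Fin 2 → ℝ) : ℝ :=
  1 / 2 * (y ⬝ᵥ ((g.Aᵀ * g.D₀ᵀ * g.M * g.D₀ * g.A) *ᵥ y))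

def ξ₁ (y : Fin 2 → ℝ) : ℝ :=
  1 / 2 * g.η * ((g.D₀ *ᵥ g.C (g.χ₀ y)) ⬝ᵥ (g.M *ᵥ g.χ₀ y))
    + 1 / 2 * g.η * (g.χ₀ y ⬝ᵥ ((g.M * g.D₀) *ᵥ g.C (g.χ₀ y)))
    + g.B (g.χ₀ y)
    + (g.d ⬝ᵥ y) * (y ⬝ᵥ ((g.Aᵀ * (g.Mᵀ * g.D₀ᵀ * g.D₀ᵀ * g.M * g.D₀) * g.A) *ᵥ y))

/-- The Euclidean norm of `χ₀`. -/
def ψ₀ (y : Fin 2 → ℝ) : ℝ := ‖(WithLp.toLp 2 (g.χ₀ y) : E2)‖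

def ψ₁ (y : Fin 2 → ℝ) : ℝ := (g.χ₀ y ⬝ᵥ g.χ₁ y) / g.ψ₀ y

/-- The coefficient `ξ̃₁` for the double-layer kernel. -/
def ξt₁ (y : Fin 2 → ℝ) : ℝ :=
  1 / 2 * g.η * ((g.D₀ *ᵥ g.C (g.χ₀ y)) ⬝ᵥ (g.M *ᵥ g.χ₀ y)
      - g.χ₀ y ⬝ᵥ ((g.M * g.D₀) *ᵥ g.C (g.χ₀ y)))
    - g.B (g.χ₀ y)
    + y ⬝ᵥ ((g.Aᵀ * g.D₀ᵀ * (1 + g.η • (g.M * g.D₀))) *ᵥ g.C (g.χ₀ y))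
    + (g.d ⬝ᵥ y) * (y ⬝ᵥ ((g.Aᵀ * g.D₀ * g.M * g.D₀ * g.D₀ * g.M * g.A) *ᵥ y))

/-- The leading term of the expansion of the layer kernels; `u` is the direction `y / |y|`. -/
def s₀ (X : LayerKernel) (y : E2) : ℝ :=
  let u : Fin 2 → ℝ := WithLp.ofLp (‖y‖⁻¹ • y)
  match X with
  | .SL => 1 / (4 * Real.pi) * (1 / ‖y‖ * (1 / g.ψ₀ u))
  | .DLC => 1 / (4 * Real.pi) * (1 / ‖y‖ * (g.ξ₀ u / g.ψ₀ u ^ 3))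
  | .DL => 1 / (4 * Real.pi) * (1 / ‖y‖ * (g.ξ₀ u / g.ψ₀ u ^ 3))

/-- The second term of the expansion of the layer kernels; `u` is the direction `y / |y|`. -/
def s₁ (X : LayerKernel) (y : E2) : ℝ :=
  let u : Fin 2 → ℝ := WithLp.ofLp (‖y‖⁻¹ • y)
  match X with
  | .SL => 1 / (4 * Real.pi) * (-(g.ψ₁ u / g.ψ₀ u ^ 2))
  | .DLC => 1 / (4 * Real.pi) *
      (-3 * (g.ξ₀ u * g.ψ₁ u / g.ψ₀ u ^ 4) + g.ξ₁ u / g.ψ₀ u ^ 3)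
  | .DL => 1 / (4 * Real.pi) *
      (-3 * (g.ξ₀ u * g.ψ₁ u / g.ψ₀ u ^ 4) + g.ξt₁ u / g.ψ₀ u ^ 3)

end LocalData

end

/-! Below the reach the closest point mapping is smooth, so each kernel becomes a smooth function of
radius and direction once the right powers of the radius are divided out. Its first coefficients are
then found by comparing powers along rays.

Smoothness of `P`. A surface point x stays closest to x + t ν(x) for all |t| below the reach
(`isClosestPoint_add_smul_of_lt_reach`). The two balls of radius R touching at x therefore bound the
normal curvatures by 1/R (`IsDefiningOn.abs_fderiv_fderiv_le`). With a local defining function φ,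
this makes (q, s) ↦ (q + s ∇φ(q), φ(q)) a local diffeomorphism, and P(w) is the first component of
its inverse at (w, 0) (`IsDefiningOn.contDiffAt_closestPoint`).

Division by the radius. Put Q(y) = P(y₀ + (y, 0)) - x. Then Q(0) = 0, and the derivative of Q at 0
takes values in the tangent plane and is injective because n₃ ≠ 0. Hadamard's lemma gives Q(tu) = t
w(t, u) with w(0, u) ≠ 0 on the circle. The numerators of the double-layer kernel and its conjugate
vanish to second order, hence equal t² b(t, u) and t² b'(t, u) (`exists_polar_representation`). So
|y| s(y) is a smooth expression in w, b, b', and the order of the remainder follows from Hadamard's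
lemma and compactness of the circle.

Coefficients. In the principal frame Γ is the graph of f = ½(κ₀v₀² + κ₁v₁²) + B(v) + O(|v|⁴).
Orthogonality of w - P(w) to the surface determines w(0, u) and ∂ₜw(0, u) in the tangent plane
(`HasGraphTaylor.curve_coefficients`). The conjugate numerator is the height f, whereas the
double-layer numerator is v·∇f - f up to a factor 1 + O(t²); by Euler's identity the cubic term is B
in the first case and 2B in the second. Since M is diagonal, the matrix formulas reduce to these
scalar ones. -/

/-! ### Smooth dependence of integrals over [0, 1] on a parameter. -/

section ParametricIntegral

variable {H : Type} [NormedAddCommGroup H]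

/-- The tube lemma around the compact fibre {p} × [0, 1] yields the locally uniform bound that
dominated convergence and differentiation under the integral require. -/
theorem exists_nhds_bound_of_continuousOn {E : Type*} [NormedAddCommGroup E] {F : H × ℝ → E}
    {T : Set (H × ℝ)} (hT : IsOpen T) (hF : ContinuousOn F T) {p : H}
    (hp : ∀ s ∈ Icc (0 : ℝ) 1, (p, s) ∈ T) :
    ∃ C : ℝ, ∃ u ∈ 𝓝 p, ∀ q ∈ u, ∀ s ∈ Icc (0 : ℝ) 1, (q, s) ∈ T ∧ ‖F (q, s)‖ ≤ C := by
  have hK : IsCompact ({p} ×ˢ Icc (0 : ℝ) 1) := isCompact_singleton.prod isCompact_Icc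
  have hKT : {p} ×ˢ Icc (0 : ℝ) 1 ⊆ T := by
    rintro ⟨a, s⟩ ⟨ha, hs⟩
    simp only [mem_singleton_iff] at ha
    subst ha
    exact hp s hs
  obtain ⟨C, hC⟩ := hK.exists_bound_of_continuousOn (hF.mono hKT)
  have hO : IsOpen (T ∩ F ⁻¹' Metric.ball 0 (C + 1)) :=
    hF.isOpen_inter_preimage hT Metric.isOpen_ball
  obtain ⟨u, v, hu, hv, hpu, hIv, huv⟩ := generalized_tube_lemma isCompact_singleton
    isCompact_Icc hO (s := {p}) (t := Icc (0 : ℝ) 1) (by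
      intro q hq
      refine ⟨hKT hq, ?_⟩
      have := hC q hq
      simp only [mem_preimage, mem_ball_zero_iff]
      linarith)
  refine ⟨C + 1, u, hu.mem_nhds (hpu rfl), fun q hq s hs => ?_⟩
  have := huv (mk_mem_prod hq (hIv hs))
  refine ⟨this.1, ?_⟩
  have h2 := this.2
  simp only [mem_preimage, mem_ball_zero_iff] at h2
  exact h2.le

theorem continuousOn_slice {E : Type*} [NormedAddCommGroup E] {F : H × ℝ → E}
    {T : Set (H × ℝ)} (hF : ContinuousOn F T) {p : H}
    (hp : ∀ s ∈ Icc (0 : ℝ) 1, (p, s) ∈ T) :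
    ContinuousOn (fun s => F (p, s)) (Icc (0 : ℝ) 1) :=
  hF.comp (by fun_prop) hp

theorem aestronglyMeasurable_slice {E : Type*} [NormedAddCommGroup E] {F : H × ℝ → E}
    {T : Set (H × ℝ)} (hF : ContinuousOn F T) {p : H}
    (hp : ∀ s ∈ Icc (0 : ℝ) 1, (p, s) ∈ T) :
    MeasureTheory.AEStronglyMeasurable (fun s => F (p, s))
      (MeasureTheory.volume.restrict (uIoc (0 : ℝ) 1)) := by
  rw [uIoc_of_le zero_le_one]
  exact ((continuousOn_slice hF hp).mono Ioc_subset_Icc_self).aestronglyMeasurable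
    measurableSet_Ioc

variable [NormedSpace ℝ H]

/-- Differentiation under the integral sign, by induction on the order. The target space is
quantified inside the induction, because the derivative in the parameter takes values in `H →L[ℝ]
E`. -/
theorem contDiffOn_integral_nat (n : ℕ) : ∀ {E : Type} [NormedAddCommGroup E] [NormedSpace ℝ E]
    [CompleteSpace E] {F : H × ℝ → E} {T : Set (H × ℝ)} {S : Set H}, IsOpen T → IsOpen S →
    (∀ p ∈ S, ∀ s ∈ Icc (0 : ℝ) 1, (p, s) ∈ T) → ContDiffOn ℝ n F T →
    ContDiffOn ℝ n (fun p => ∫ s in (0 : ℝ)..1, F (p, s)) S := by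
  induction n with
  | zero =>
    intro E _ _ _ F T S hT hS hST hF
    simp only [CharP.cast_eq_zero, contDiffOn_zero] at hF ⊢
    intro p hp
    refine ContinuousAt.continuousWithinAt ?_
    obtain ⟨C, u, hu, hC⟩ := exists_nhds_bound_of_continuousOn hT hF (hST p hp)
    refine intervalIntegral.continuousAt_of_dominated_interval (bound := fun _ => C) ?_ ?_
      intervalIntegrable_const ?_
    · filter_upwards [hu] with q hq
      exact aestronglyMeasurable_slice hF fun s hs => (hC q hq s hs).1
    · filter_upwards [hu] with q hq
      refine Eventually.of_forall fun s hs => (hC q hq s ?_).2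
      rw [uIoc_of_le zero_le_one] at hs
      exact Ioc_subset_Icc_self hs
    · refine Eventually.of_forall fun s hs => ?_
      rw [uIoc_of_le zero_le_one] at hs
      have h1 : ContinuousAt F (p, s) :=
        hF.continuousAt (hT.mem_nhds (hST p hp s (Ioc_subset_Icc_self hs)))
      exact h1.comp (f := fun q : H => (q, s)) (by fun_prop)
  | succ n ih =>
    intro E _ _ _ F T S hT hS hST hF
    have hF' : ContDiffOn ℝ n (fun q => (fderiv ℝ F q).comp (ContinuousLinearMap.inl ℝ H ℝ)) T :=
      (((contDiffOn_succ_iff_fderiv_of_isOpen hT).1 (by exact_mod_cast hF)).2.2).clm_comp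
        contDiffOn_const
    have key : ∀ p ∈ S, HasFDerivAt (fun p => ∫ s in (0 : ℝ)..1, F (p, s))
        (∫ s in (0 : ℝ)..1, (fderiv ℝ F (p, s)).comp (ContinuousLinearMap.inl ℝ H ℝ)) p := by
      intro p hp
      obtain ⟨C, u, hu, hC⟩ := exists_nhds_bound_of_continuousOn hT hF'.continuousOn (hST p hp)
      refine intervalIntegral.hasFDerivAt_integral_of_dominated_of_fderiv_le
        (F := fun p s => F (p, s))
        (F' := fun p s => (fderiv ℝ F (p, s)).comp (ContinuousLinearMap.inl ℝ H ℝ))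
        (bound := fun _ => C) hu ?_ ?_ ?_ ?_
        intervalIntegrable_const ?_
      · filter_upwards [hu] with q hq
        exact aestronglyMeasurable_slice hF.continuousOn fun s hs => (hC q hq s hs).1
      · refine ContinuousOn.intervalIntegrable ?_
        rw [uIcc_of_le zero_le_one]
        exact continuousOn_slice hF.continuousOn (hST p hp)
      · exact aestronglyMeasurable_slice hF'.continuousOn (hST p hp)
      · refine Eventually.of_forall fun s hs q hq => (hC q hq s ?_).2
        rw [uIoc_of_le zero_le_one] at hs
        exact Ioc_subset_Icc_self hs
      · refine Eventually.of_forall fun s hs q hq => ?_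
        rw [uIoc_of_le zero_le_one] at hs
        have h1 : DifferentiableAt ℝ F (q, s) :=
          (hF.differentiableOn (by simp)).differentiableAt
            (hT.mem_nhds (hC q hq s (Ioc_subset_Icc_self hs)).1)
        exact h1.hasFDerivAt.comp q (hasFDerivAt_prodMk_left q s)
    have := (contDiffOn_succ_iff_fderiv_of_isOpen (n := (n : ℕ∞ω)) hS
      (f := fun p => ∫ s in (0 : ℝ)..1, F (p, s))).2
      ⟨fun p hp => (key p hp).differentiableAt.differentiableWithinAt, by simp,
        (ih hT hS hST hF').congr fun p hp => (key p hp).fderiv⟩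
    exact_mod_cast this

theorem contDiffOn_integral {E : Type} [NormedAddCommGroup E] [NormedSpace ℝ E]
    [CompleteSpace E] {F : H × ℝ → E} {T : Set (H × ℝ)} {S : Set H} (hT : IsOpen T)
    (hS : IsOpen S) (hST : ∀ p ∈ S, ∀ s ∈ Icc (0 : ℝ) 1, (p, s) ∈ T)
    (hF : ContDiffOn ℝ ∞ F T) :
    ContDiffOn ℝ ∞ (fun p => ∫ s in (0 : ℝ)..1, F (p, s)) S :=
  contDiffOn_infty.2 fun n => contDiffOn_integral_nat n hT hS hST (contDiffOn_infty.1 hF n)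

end ParametricIntegral

/-! ### Hadamard's lemma. -/

section Hadamard

variable {V E : Type} [NormedAddCommGroup V] [NormedSpace ℝ V] [NormedAddCommGroup E]
  [NormedSpace ℝ E] [CompleteSpace E]

/-- **Hadamard's lemma** in the first variable. -/
theorem exists_contDiffOn_smul_of_contDiffOn {S : Set (ℝ × V)} (hS : IsOpen S)
    (hstar : ∀ p ∈ S, ∀ s ∈ Icc (0 : ℝ) 1, (s * p.1, p.2) ∈ S) {F : ℝ × V → E}
    (hF : ContDiffOn ℝ ∞ F S) :
    ∃ G : ℝ × V → E, ContDiffOn ℝ ∞ G S ∧ ∀ p ∈ S, F p = F (0, p.2) + p.1 • G p := by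
  -- Since d/ds F(st, v) = t ∂₁F(st, v), integration over [0, 1] exhibits the quotient as the mean
  -- of ∂₁F along the segment, which `hstar` keeps inside S.
  let Φ : (ℝ × V) × ℝ → ℝ × V := fun q => (q.2 * q.1.1, q.1.2)
  have hΦ : ContDiff ℝ ∞ Φ := by fun_prop
  have hT : IsOpen (Φ ⁻¹' S) := hS.preimage hΦ.continuous
  have hF' : ContDiffOn ℝ ∞ (fun q => fderiv ℝ F q (1, 0)) S :=
    ((contDiffOn_infty_iff_fderiv_of_isOpen hS).1 hF).2.clm_apply contDiffOn_const
  refine ⟨fun p => ∫ s in (0 : ℝ)..1, fderiv ℝ F (Φ (p, s)) (1, 0),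
    contDiffOn_integral (F := fun q => fderiv ℝ F (Φ q) (1, 0)) hT hS
      (fun p hp s hs => hstar p hp s hs) (hF'.comp hΦ.contDiffOn fun q hq => hq), ?_⟩
  rintro ⟨t, v⟩ hp
  have hderiv : ∀ s ∈ uIcc (0 : ℝ) 1,
      HasDerivAt (fun s => F (s * t, v)) (t • fderiv ℝ F (Φ ((t, v), s)) (1, 0)) s := by
    intro s hs
    rw [uIcc_of_le zero_le_one] at hs
    have h1 : DifferentiableAt ℝ F (s * t, v) :=
      (hF.differentiableOn (by simp)).differentiableAt (hS.mem_nhds (hstar _ hp s hs))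
    have h2 : HasDerivAt (fun s : ℝ => (s * t, v)) (t, 0) s :=
      (by simpa using (hasDerivAt_id s).mul_const t : HasDerivAt (fun s : ℝ => s * t) t s).prodMk
        (hasDerivAt_const s v)
    have h3 := h1.hasFDerivAt.comp_hasDerivAt s h2
    have h4 : ((t, 0) : ℝ × V) = t • (1, 0) := by simp
    rw [h4, map_smul] at h3
    exact h3
  have hint : IntervalIntegrable (fun s => t • fderiv ℝ F (Φ ((t, v), s)) (1, 0))
      MeasureTheory.volume 0 1 := by
    refine ContinuousOn.intervalIntegrable ?_
    rw [uIcc_of_le zero_le_one]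
    exact (hF'.continuousOn.comp (f := fun s => Φ ((t, v), s)) (hΦ.continuous.comp
      (by fun_prop)).continuousOn fun s hs => hstar _ hp s hs).const_smul t
  have h5 := intervalIntegral.integral_eq_sub_of_hasDerivAt hderiv hint
  rw [intervalIntegral.integral_smul] at h5
  simp only [one_mul, zero_mul] at h5
  rw [h5]
  simp

end Hadamard

/-! ### Closest points and the reach. -/

section ClosestPoint

variable {Γ : Set E3} {P : E3 → E3}

theorem IsSmoothClosedSurface.isCompact {Ω : Set E3} (h : IsSmoothClosedSurface Γ Ω) :
    IsCompact Γ := by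
  rw [← h.frontier_eq]
  exact Metric.isCompact_of_isClosed_isBounded isClosed_frontier
    (h.isBounded.closure.subset frontier_subset_closure)

theorem IsClosestPoint.eq_of_lt_reach {p q q' y : E3} (hq : IsClosestPoint Γ p q)
    (hq' : IsClosestPoint Γ p q') (hy : y ∈ Γ) (h : edist y p < reach Γ) : q = q' := by
  by_contra hne
  exact absurd h (not_lt.2 (iInf₂_le_of_le y hy (iInf₂_le p ⟨q, q', hne, hq, hq'⟩)))

theorem IsClosestPoint.eq_of_dist_lt_reach {p q q' y : E3} (hq : IsClosestPoint Γ p q)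
    (hq' : IsClosestPoint Γ p q') (hy : y ∈ Γ) (h : ENNReal.ofReal (dist p y) < reach Γ) :
    q = q' :=
  hq.eq_of_lt_reach hq' hy (by rwa [edist_comm, edist_dist])

theorem IsClosestPoint.infDist_eq {p q : E3} (hq : IsClosestPoint Γ p q) :
    Metric.infDist p Γ = dist p q :=
  le_antisymm (Metric.infDist_le_dist_of_mem hq.1)
    ((Metric.le_infDist ⟨q, hq.1⟩).2 fun {y} hy => hq.2 y hy)

theorem isClosestPoint_add_smul_iff {x n : E3} (hx : x ∈ Γ) (hn : ‖n‖ = 1) {T : ℝ} (hT : 0 ≤ T) :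
    IsClosestPoint Γ (x + T • n) x ↔ ∀ q ∈ Γ, T ≤ dist (x + T • n) q := by
  have : dist (x + T • n) x = T := by simp [dist_eq_norm, norm_smul, hn, abs_of_nonneg hT]
  simp [IsClosestPoint, hx, this]

/-- `P` is an arbitrary selection of closest points. Every cluster point of `P` at p is a closest
point to p, by passing to the limit in the distance inequalities; compactness of Γ and uniqueness at
p then force convergence. -/
theorem IsClosestPointMap.tendsto (hΓ : IsCompact Γ) (hP : IsClosestPointMap Γ P) {p q : E3}
    (huniq : ∀ q', IsClosestPoint Γ p q' → q' = q) : Tendsto P (𝓝 p) (𝓝 q) := by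
  refine hΓ.tendsto_nhds_of_unique_mapClusterPt (Eventually.of_forall fun w => (hP w).1) ?_
  intro y hy hcl
  obtain ⟨U, hU, hUy⟩ := mapClusterPt_iff_ultrafilter.1 hcl
  refine huniq y ⟨hy, fun q' hq' => ?_⟩
  have hid : Tendsto (fun w : E3 => w) U (𝓝 p) := hU
  exact le_of_tendsto_of_tendsto' (hid.dist hUy) (hid.dist tendsto_const_nhds)
    fun w => (hP w).2 q' hq'

/-- The distance to a closest point grows at unit speed away from the surface. -/
theorem IsClosestPointMap.eventually_le_dist (hP : IsClosestPointMap Γ P) {w : E3}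
    (hc : Tendsto P (𝓝 w) (𝓝 (P w))) (hw : w ≠ P w) {a : ℝ} (ha : a < 1) :
    ∀ᶠ h in 𝓝[>] (0 : ℝ), dist w (P w) + a * h ≤
      dist (w + h • (‖w - P w‖⁻¹ • (w - P w))) (P (w + h • (‖w - P w‖⁻¹ • (w - P w)))) := by
  set u := ‖w - P w‖⁻¹ • (w - P w) with hu
  have hne : w - P w ≠ 0 := sub_ne_zero.2 hw
  have hu1 : ‖u‖ = 1 := by simp [hu, norm_smul, norm_ne_zero_iff.2 hne]
  have hlim : Tendsto (fun h : ℝ => w + h • u) (𝓝[>] 0) (𝓝 w) := by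
    have : Tendsto (fun h : ℝ => w + h • u) (𝓝 0) (𝓝 (w + (0 : ℝ) • u)) :=
      (Continuous.tendsto (by fun_prop) 0)
    rw [zero_smul, add_zero] at this
    exact this.mono_left nhdsWithin_le_nhds
  have hq := (tendsto_const_nhds (x := w)).sub (hc.comp hlim)
  have hv : Tendsto (fun h : ℝ => ⟪‖w - P (w + h • u)‖⁻¹ • (w - P (w + h • u)), u⟫)
      (𝓝[>] 0) (𝓝 ⟪u, u⟫) :=
    ((hq.norm.inv₀ (norm_ne_zero_iff.2 hne)).smul hq).inner tendsto_const_nhds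
  rw [real_inner_self_eq_norm_sq, hu1, one_pow] at hv
  have hne' : ∀ᶠ h in 𝓝[>] (0 : ℝ), w - P (w + h • u) ≠ 0 := hq.eventually_ne hne
  filter_upwards [hv.eventually_const_lt ha, hne', self_mem_nhdsWithin] with h h1 h2 (h3 : 0 < h)
  -- Here |b| is at least the distance from w to Γ. Projecting b + h u onto b/|b| gives length |b| +
  -- h⟨b/|b|, u⟩, and this inner product tends to 1 by continuity of `P` at w.
  set b := w - P (w + h • u) with hb
  have hbn : 0 < ‖b‖ := norm_pos_iff.2 h2
  have e1 : dist w (P w) ≤ ‖b‖ := by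
    rw [hb, ← dist_eq_norm]
    exact (hP w).2 _ (hP _).1
  have e2 : ⟪‖b‖⁻¹ • b, b + h • u⟫ ≤ dist (w + h • u) (P (w + h • u)) := by
    have : w + h • u - P (w + h • u) = b + h • u := by rw [hb]; abel
    rw [dist_eq_norm, this]
    refine (real_inner_le_norm _ _).trans ?_
    simp [norm_smul, hbn.ne']
  have e3 : ⟪‖b‖⁻¹ • b, b + h • u⟫ = ‖b‖ + h * ⟪‖b‖⁻¹ • b, u⟫ := by
    rw [inner_add_right, inner_smul_right, real_inner_smul_left, real_inner_self_eq_norm_sq]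
    field_simp
  nlinarith

/-- If `x` is the closest point to `x + T • n` and `T` is less than the reach, then `x` remains the
closest point slightly beyond `x + T • n`. -/
theorem IsClosestPoint.exists_extend (hΓ : IsCompact Γ) (hP : IsClosestPointMap Γ P) {x n : E3}
    (hn : ‖n‖ = 1) {T R : ℝ} (hT : 0 < T) (hTR : T < R) (hR : ENNReal.ofReal R < reach Γ)
    (h : IsClosestPoint Γ (x + T • n) x) :
    ∃ T', T < T' ∧ T' ≤ R ∧ IsClosestPoint Γ (x + T' • n) x := by
  set y := x + T • n with hy
  -- The condition s < T keeps the ball of radius s around y away from Γ, and T + s ≤ R keeps it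
  -- where closest points are unique, so that `P` is continuous on it.
  obtain ⟨s, hs0, hsT, hsR⟩ : ∃ s, 0 < s ∧ s < T ∧ T + s ≤ R :=
    ⟨min (T / 2) (R - T), lt_min (by linarith) (by linarith),
      (min_le_left _ _).trans_lt (by linarith), by linarith [min_le_right (T / 2) (R - T)]⟩
  have hyx : dist y x = T := by simp [hy, dist_eq_norm, norm_smul, hn, abs_of_pos hT]
  have hdy : Metric.infDist y Γ = T := h.infDist_eq.trans hyx
  have hd : ∀ w, Metric.infDist w Γ = dist w (P w) := fun w => (hP w).infDist_eq
  have hne : ∀ w ∈ Metric.closedBall y s, w ≠ P w := by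
    intro w hw heq
    have h1 : dist w (P w) = 0 := by rw [← heq, dist_self]
    have h2 := Metric.infDist_le_infDist_add_dist (s := Γ) (x := y) (y := w)
    rw [hdy, hd, h1, dist_comm] at h2
    linarith [Metric.mem_closedBall.1 hw]
  have hcont : ∀ w ∈ Metric.closedBall y s, Tendsto P (𝓝 w) (𝓝 (P w)) := by
    intro w hw
    refine hP.tendsto hΓ fun q' hq' => hq'.eq_of_dist_lt_reach (hP w) h.1 (lt_of_le_of_lt ?_ hR)
    refine ENNReal.ofReal_le_ofReal ?_
    linarith [dist_triangle w y x, Metric.mem_closedBall.1 hw]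
  have hcb : IsCompact (Metric.closedBall y s) := isCompact_closedBall y s
  have hbne : (Metric.closedBall y s).Nonempty := ⟨y, Metric.mem_closedBall_self hs0.le⟩
  obtain ⟨w, hw, hwmax⟩ := hcb.exists_isMaxOn hbne
    (Metric.continuous_infDist_pt Γ).continuousOn
  -- The distance to Γ, penalized by a · dist(·, y), cannot be maximal in the open ball: moving away
  -- from the closest point gains at a rate above a and costs at most a. A maximizer lies on the
  -- sphere, and comparison with the centre y gives the bound.
  have key : ∀ a < (1 : ℝ), 0 < a → T + a * s ≤ Metric.infDist w Γ := by
    intro a ha ha0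
    obtain ⟨v, hv, hvmax⟩ := hcb.exists_isMaxOn hbne
      (f := fun w => Metric.infDist w Γ - a * dist w y)
      ((Metric.continuous_infDist_pt Γ).sub (by fun_prop)).continuousOn
    have hvs : dist v y = s := by
      refine le_antisymm (Metric.mem_closedBall.1 hv) (not_lt.1 fun hlt => ?_)
      obtain ⟨b, hab, hb1⟩ := exists_between ha
      have e1 := hP.eventually_le_dist (hcont v hv) (hne v hv) hb1
      have e2 : ∀ᶠ t in 𝓝[>] (0 : ℝ), t < s - dist v y :=
        nhdsWithin_le_nhds (gt_mem_nhds (by linarith))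
      obtain ⟨t, ⟨h1, h2⟩, ht0 : 0 < t⟩ := ((e1.and e2).and self_mem_nhdsWithin).exists
      set u := ‖v - P v‖⁻¹ • (v - P v) with hu
      have hu1 : ‖u‖ = 1 := by
        simp [hu, norm_smul, norm_ne_zero_iff.2 (sub_ne_zero.2 (hne v hv))]
      have h3 : dist (v + t • u) y ≤ dist v y + t := by
        have := dist_triangle (v + t • u) v y
        rw [dist_self_add_left, norm_smul, hu1, Real.norm_of_nonneg ht0.le] at this
        linarith
      have h4 := hvmax (show v + t • u ∈ Metric.closedBall y s from
        Metric.mem_closedBall.2 (by linarith))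
      simp only [mem_ofPred_eq, hd] at h4
      nlinarith
    have h5 := hvmax (Metric.mem_closedBall_self hs0.le : y ∈ Metric.closedBall y s)
    have h6 := hwmax hv
    simp only [mem_ofPred_eq, dist_self, hvs, hdy] at h5 h6
    linarith
  have hws : T + s ≤ Metric.infDist w Γ := by
    refine le_of_forall_pos_lt_add fun e he => ?_
    have := key (1 - min (e / (2 * s)) (1 / 2)) (by
      have : 0 < min (e / (2 * s)) (1 / 2) := lt_min (by positivity) (by norm_num)
      linarith) (by linarith [min_le_right (e / (2 * s)) (1 / 2)])
    have h7 : min (e / (2 * s)) (1 / 2) * s ≤ e / 2 := by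
      calc min (e / (2 * s)) (1 / 2) * s ≤ e / (2 * s) * s := by
            gcongr; exact min_le_left _ _
        _ = e / 2 := by field_simp
    linarith
  -- Equality case of the triangle inequality: w is at distance at least T + s from x and at most s
  -- from y, while y is at distance T from x.
  have hweq : w = x + (T + s) • n := by
    have h8 : T + s ≤ dist w x := hws.trans (Metric.infDist_le_dist_of_mem h.1)
    have h9 : ‖w - y‖ ≤ s := by rw [← dist_eq_norm]; exact hw
    have h10 : w - x = (w - y) + T • n := by rw [hy]; abel
    rw [dist_eq_norm, h10] at h8
    have h11 : ‖(w - y) + T • n‖ ^ 2 = ‖w - y‖ ^ 2 + 2 * T * ⟪w - y, n⟫ + T ^ 2 := by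
      rw [norm_add_sq_real, inner_smul_right, norm_smul, hn, mul_one, Real.norm_eq_abs, sq_abs]
      ring
    have h12 : ‖(w - y) - s • n‖ ^ 2 = ‖w - y‖ ^ 2 - 2 * s * ⟪w - y, n⟫ + s ^ 2 := by
      rw [norm_sub_sq_real, inner_smul_right, norm_smul, hn, mul_one, Real.norm_eq_abs, sq_abs]
      ring
    have h13 : s ≤ ⟪w - y, n⟫ := by
      have : (T + s) ^ 2 ≤ ‖(w - y) + T • n‖ ^ 2 := by gcongr
      have h14 : ‖w - y‖ ^ 2 ≤ s ^ 2 := by gcongr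
      by_contra hlt
      nlinarith [mul_lt_mul_of_pos_left (not_le.1 hlt) hT]
    have h15 : ‖(w - y) - s • n‖ ^ 2 ≤ 0 := by
      have h14 : ‖w - y‖ ^ 2 ≤ s ^ 2 := by gcongr
      nlinarith
    have h16 : (w - y) - s • n = 0 := by
      rw [← norm_eq_zero]
      exact pow_eq_zero_iff two_ne_zero |>.1 (le_antisymm h15 (sq_nonneg _))
    rw [add_smul, ← add_assoc, ← hy]
    rw [sub_eq_zero] at h16
    rw [← h16]; abel
  refine ⟨T + s, by linarith, hsR, (isClosestPoint_add_smul_iff h.1 hn (by linarith)).2 ?_⟩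
  intro q hq
  rw [← hweq]
  exact hws.trans (Metric.infDist_le_dist_of_mem hq)

/-- Along a normal direction, a point of the surface stays the closest point up to the reach. -/
theorem isClosestPoint_add_smul_of_lt_reach (hΓ : IsCompact Γ) (hP : IsClosestPointMap Γ P)
    {x n : E3} (hx : x ∈ Γ) (hn : ‖n‖ = 1) {T₀ : ℝ} (hT₀ : 0 < T₀)
    (h₀ : IsClosestPoint Γ (x + T₀ • n) x) {T R : ℝ} (hT : 0 ≤ T) (hTR : T ≤ R)
    (hR : ENNReal.ofReal R < reach Γ) : IsClosestPoint Γ (x + T • n) x := by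
  have mono : ∀ {S S' : ℝ}, 0 ≤ S' → S' ≤ S → IsClosestPoint Γ (x + S • n) x →
      IsClosestPoint Γ (x + S' • n) x := by
    intro S S' hS' hSS h
    rw [isClosestPoint_add_smul_iff hx hn (hS'.trans hSS)] at h
    rw [isClosestPoint_add_smul_iff hx hn hS']
    intro q hq
    have h1 := h q hq
    have h2 := dist_triangle (x + S • n) (x + S' • n) q
    have h3 : dist (x + S • n) (x + S' • n) = S - S' := by
      rw [dist_add_left, dist_eq_norm, ← sub_smul, norm_smul, hn, mul_one,
        Real.norm_of_nonneg (by linarith)]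
    linarith
  rcases hT.eq_or_lt with rfl | hTpos
  · exact mono le_rfl hT₀.le h₀
  have hRpos : 0 < R := hTpos.trans_le hTR
  -- Continuity method: the admissible lengths up to R form a compact set, and its greatest element
  -- is R because any smaller one could be extended.
  let A : Set ℝ := Icc 0 R ∩ {S | ∀ q ∈ Γ, S ≤ dist (x + S • n) q}
  have hAcl : IsClosed {S : ℝ | ∀ q ∈ Γ, S ≤ dist (x + S • n) q} := by
    simp only [ofPred_forall]
    exact isClosed_iInter fun q => isClosed_iInter fun _ =>
      isClosed_le continuous_id (by fun_prop)
  have hA : IsCompact A := isCompact_Icc.inter_right hAcl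
  have hmin : min T₀ R ∈ A :=
    ⟨⟨(lt_min hT₀ hRpos).le, min_le_right _ _⟩,
      (isClosestPoint_add_smul_iff hx hn (lt_min hT₀ hRpos).le).1
        (mono (lt_min hT₀ hRpos).le (min_le_left _ _) h₀)⟩
  obtain ⟨S, hSA, hSmax⟩ := hA.exists_isGreatest ⟨_, hmin⟩
  have hSpos : 0 < S := (lt_min hT₀ hRpos).trans_le (hSmax hmin)
  have hScl := (isClosestPoint_add_smul_iff hx hn hSpos.le).2 hSA.2
  rcases hSA.1.2.eq_or_lt with hSR | hSR
  · exact mono hT (hTR.trans hSR.ge) hScl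
  · obtain ⟨S', h1, h2, h3⟩ := hScl.exists_extend hΓ hP hn hSpos hSR hR
    have := hSmax (show S' ∈ A from ⟨⟨by linarith, h2⟩,
      (isClosestPoint_add_smul_iff hx hn (by linarith)).1 h3⟩)
    exact absurd this (not_le.2 h1)

end ClosestPoint

/-! ### Taylor's formula with remainder. -/

section Taylor

variable {E F : Type*} [NormedAddCommGroup E] [NormedSpace ℝ E] [NormedAddCommGroup F]
  [NormedSpace ℝ F] [CompleteSpace F]

/-- **Taylor's theorem** with a remainder of the order of the first omitted term. -/
theorem ContDiffAt.sub_taylor_isBigO {f : E → F} {x : E} {n : ℕ}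
    (hf : ContDiffAt ℝ (n + 1 : ℕ) f x) :
    (fun y => f (x + y) - ∑ k ∈ Finset.range (n + 1),
      (k.factorial : ℝ)⁻¹ • iteratedFDeriv ℝ k f x (fun _ => y)) =O[𝓝 0]
      fun y => ‖y‖ ^ (n + 1) := by
  have h1 : ∀ᶠ z in 𝓝 x, ContDiffAt ℝ (n + 1 : ℕ) f z := hf.eventually (by simp)
  have hc : ContinuousAt (iteratedFDeriv ℝ (n + 1) f) x :=
    (hf.iteratedFDeriv_right (i := n + 1) (m := 0) (by simp)).continuousAt
  have h2 : ∀ᶠ z in 𝓝 x, ‖iteratedFDeriv ℝ (n + 1) f z‖ < ‖iteratedFDeriv ℝ (n + 1) f x‖ + 1 :=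
    hc.norm.eventually_lt_const (lt_add_one _)
  obtain ⟨δ, hδ, hball⟩ := Metric.eventually_nhds_iff_ball.1 (h1.and h2)
  set C := ‖iteratedFDeriv ℝ (n + 1) f x‖ + 1
  refine IsBigO.of_bound (‖((n.factorial : ℝ)⁻¹)‖ * C) ?_
  filter_upwards [Metric.ball_mem_nhds (0 : E) hδ] with y hy
  have hmem : ∀ t ∈ Icc (0 : ℝ) 1, x + t • y ∈ Metric.ball x δ := by
    intro t ht
    rw [mem_ball_zero_iff] at hy
    rw [mem_ball_iff_norm, add_sub_cancel_left, norm_smul, Real.norm_of_nonneg ht.1]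
    nlinarith [norm_nonneg y, ht.2]
  have h3 := map_add_eq_sum_add_integral_iteratedFDeriv (f := f) (x := x) (y := y) (n := n)
    fun t ht => by exact_mod_cast (hball _ (hmem t ht)).1
  rw [h3, add_sub_cancel_left, norm_smul, mul_assoc, norm_pow, norm_norm]
  gcongr
  have h4 := intervalIntegral.norm_integral_le_of_norm_le_const (a := (0 : ℝ)) (b := 1)
    (C := C * ‖y‖ ^ (n + 1))
    (f := fun t => (1 - t) ^ n • iteratedFDeriv ℝ (n + 1) f (x + t • y) fun _ => y) (by
      intro t ht
      rw [uIoc_of_le zero_le_one] at ht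
      have h5 := (hball _ (hmem t (Ioc_subset_Icc_self ht))).2
      have h6 : ‖(1 - t) ^ n‖ ≤ 1 := by
        rw [norm_pow, Real.norm_of_nonneg (by linarith [ht.2])]
        exact pow_le_one₀ (by linarith [ht.2]) (by linarith [ht.1])
      rw [norm_smul]
      calc _ ≤ 1 * ‖iteratedFDeriv ℝ (n + 1) f (x + t • y) fun _ => y‖ := by gcongr
        _ ≤ ‖iteratedFDeriv ℝ (n + 1) f (x + t • y)‖ * ∏ _i : Fin (n + 1), ‖y‖ := by
            rw [one_mul]; exact ContinuousMultilinearMap.le_opNorm _ _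
        _ ≤ C * ‖y‖ ^ (n + 1) := by
            rw [Finset.prod_const, Finset.card_univ, Fintype.card_fin]; gcongr)
  simpa using h4

end Taylor

/-! ### Local defining functions and the outward normal. -/

section DefiningFunction

variable {Ω Γ : Set E3} {φ ψ : E3 → ℝ} {x : E3}

theorem inner_gradient_eq_fderiv (φ : E3 → ℝ) (x v : E3) : ⟪gradient φ x, v⟫ = fderiv ℝ φ x v := by
  simp [gradient, InnerProductSpace.toDual_symm_apply]

theorem ContDiffOn.gradient_of_isOpen {U : Set E3} (hU : IsOpen U) (h : ContDiffOn ℝ ∞ φ U) :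
    ContDiffOn ℝ ∞ (gradient φ) U :=
  (InnerProductSpace.toDual ℝ E3).symm.contDiff.comp_contDiffOn
    ((contDiffOn_infty_iff_fderiv_of_isOpen hU).1 h).2

theorem HasDerivAt.eventually_pos {g : ℝ → ℝ} {g' : ℝ} (h : HasDerivAt g g' 0) (h0 : g 0 = 0)
    (hg' : 0 < g') : ∀ᶠ t in 𝓝[>] (0 : ℝ), 0 < g t := by
  have h1 : Tendsto (slope g 0) (𝓝[>] 0) (𝓝 g') :=
    (hasDerivAt_iff_tendsto_slope.1 h).mono_left (nhdsWithin_mono _ fun t ht => ne_of_gt ht)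
  filter_upwards [h1.eventually_const_lt hg', self_mem_nhdsWithin] with t h2 (h3 : 0 < t)
  rw [slope_def_field, h0, sub_zero, sub_zero] at h2
  exact (div_pos_iff_of_pos_right h3).1 h2

theorem eventually_pos_of_fderiv_pos {v : E3} (hφ : DifferentiableAt ℝ φ x) (h0 : φ x = 0)
    (hv : 0 < fderiv ℝ φ x v) : ∀ᶠ t in 𝓝[>] (0 : ℝ), 0 < φ (x + t • v) := by
  refine HasDerivAt.eventually_pos (g' := fderiv ℝ φ x v) ?_ (by simpa using h0) hv
  have h1 : HasDerivAt (fun t : ℝ => x + t • v) v 0 := by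
    simpa using ((hasDerivAt_id (0 : ℝ)).smul_const v).const_add x
  have h2 : HasFDerivAt φ (fderiv ℝ φ x) (x + (0 : ℝ) • v) := by simpa using hφ.hasFDerivAt
  exact h2.comp_hasDerivAt (0 : ℝ) h1

theorem tendsto_add_smul (x v : E3) : Tendsto (fun t : ℝ => x + t • v) (𝓝[>] 0) (𝓝 x) := by
  have : Tendsto (fun t : ℝ => x + t • v) (𝓝 0) (𝓝 (x + (0 : ℝ) • v)) :=
    (by fun_prop : Continuous fun t : ℝ => x + t • v).tendsto 0
  rw [zero_smul, add_zero] at this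
  exact this.mono_left nhdsWithin_le_nhds

theorem IsLocalDefiningFunction.contDiffAt (h : IsLocalDefiningFunction Ω x φ) :
    ContDiffAt ℝ ∞ φ x := by
  obtain ⟨-, U, hU, hxU, hφ, -⟩ := h
  exact hφ.contDiffAt (hU.mem_nhds hxU)

theorem IsLocalDefiningFunction.eq_zero (h : IsLocalDefiningFunction Ω x φ)
    (hx : x ∈ frontier Ω) : φ x = 0 := by
  obtain ⟨-, U, hU, hxU, hφ, hiff⟩ := h
  exact (hiff x hxU).2.1 hx

/-- The outward unit normal does not depend on the defining function. -/
theorem IsLocalDefiningFunction.unit_gradient_unique (hx : x ∈ frontier Ω)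
    (hφ : IsLocalDefiningFunction Ω x φ) (hψ : IsLocalDefiningFunction Ω x ψ) :
    ‖gradient φ x‖⁻¹ • gradient φ x = ‖gradient ψ x‖⁻¹ • gradient ψ x := by
  set a := ‖gradient φ x‖⁻¹ • gradient φ x with ha
  set b := ‖gradient ψ x‖⁻¹ • gradient ψ x with hb
  by_contra hne
  have ha1 : ‖a‖ = 1 := by simp [ha, norm_smul, norm_ne_zero_iff.2 hφ.1]
  have hb1 : ‖b‖ = 1 := by simp [hb, norm_smul, norm_ne_zero_iff.2 hψ.1]
  have hab : ⟪a, b⟫ < 1 := (inner_lt_one_iff_real_of_norm_eq_one ha1 hb1).2 hne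
  have hga : gradient φ x = ‖gradient φ x‖ • a := by
    rw [ha, smul_smul, mul_inv_cancel₀ (norm_ne_zero_iff.2 hφ.1), one_smul]
  have hgb : gradient ψ x = ‖gradient ψ x‖ • b := by
    rw [hb, smul_smul, mul_inv_cancel₀ (norm_ne_zero_iff.2 hψ.1), one_smul]
  -- For distinct unit vectors a and b, the direction b - a strictly decreases φ and strictly
  -- increases ψ. A short step from x along it lies in Ω according to φ and not according to ψ.
  have h1 : 0 < fderiv ℝ (fun p => -φ p) x (b - a) := by
    rw [fderiv_fun_neg, neg_apply, ← inner_gradient_eq_fderiv, hga,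
      real_inner_smul_left, inner_sub_right, real_inner_self_eq_norm_sq, ha1]
    have := norm_pos_iff.2 hφ.1
    nlinarith
  have h2 : 0 < fderiv ℝ ψ x (b - a) := by
    rw [← inner_gradient_eq_fderiv, hgb, real_inner_smul_left, inner_sub_right,
      real_inner_self_eq_norm_sq, hb1, real_inner_comm]
    have := norm_pos_iff.2 hψ.1
    nlinarith
  have e1 := eventually_pos_of_fderiv_pos (hφ.contDiffAt.differentiableAt (by simp)).neg
    (by simp [hφ.eq_zero hx]) h1
  have e2 := eventually_pos_of_fderiv_pos (hψ.contDiffAt.differentiableAt (by simp))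
    (hψ.eq_zero hx) h2
  obtain ⟨-, U, hU, hxU, -, hUφ⟩ := hφ
  obtain ⟨-, W, hW, hxW, -, hWψ⟩ := hψ
  have e3 := (tendsto_add_smul x (b - a)).eventually (hU.mem_nhds hxU)
  have e4 := (tendsto_add_smul x (b - a)).eventually (hW.mem_nhds hxW)
  obtain ⟨t, ⟨⟨h1, h2⟩, h3⟩, h4⟩ := (((e1.and e2).and e3).and e4).exists
  have h5 := (hWψ _ h4).1.1 ((hUφ _ h3).1.2 (by simpa using h1))
  linarith

/-- The data of a smooth surface near one of its points: a defining function on an open set,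
with nonvanishing gradient, which determines the unit normal. -/
structure IsDefiningOn (Ω Γ : Set E3) (ν : E3 → E3) (φ : E3 → ℝ) (U : Set E3) : Prop where
  isOpen : IsOpen U
  contDiffOn : ContDiffOn ℝ ∞ φ U
  gradient_ne : ∀ q ∈ U, gradient φ q ≠ 0
  mem_interior_iff : ∀ q ∈ U, q ∈ Ω ↔ φ q < 0
  mem_iff : ∀ q ∈ U, q ∈ Γ ↔ φ q = 0
  normal_eq : ∀ q ∈ U, q ∈ Γ → ν q = ‖gradient φ q‖⁻¹ • gradient φ q

/-- On the open set where the gradient of one defining function is nonzero, that function serves all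
surface points at once. Independence of the normal from the defining function identifies ν with its
normalized gradient there, so ν is the restriction of a smooth field. -/
theorem IsSmoothClosedSurface.exists_isDefiningOn {ν : E3 → E3} (hΓ : IsSmoothClosedSurface Γ Ω)
    (hν : ∀ p ∈ Γ, IsOutwardUnitNormal Ω p (ν p)) (hx : x ∈ Γ) :
    ∃ φ U, x ∈ U ∧ IsDefiningOn Ω Γ ν φ U := by
  obtain ⟨φ, hg, U, hU, hxU, hφ, hiff⟩ := hΓ.smooth x hx
  have hgrad := hφ.gradient_of_isOpen hU
  have hV : IsOpen (U ∩ gradient φ ⁻¹' {0}ᶜ) :=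
    hgrad.continuousOn.isOpen_inter_preimage hU isOpen_compl_singleton
  refine ⟨φ, U ∩ gradient φ ⁻¹' {0}ᶜ, ⟨hxU, hg⟩, hV, hφ.mono inter_subset_left, fun q hq => hq.2,
    fun q hq => (hiff q hq.1).1, fun q hq => hΓ.frontier_eq ▸ (hiff q hq.1).2, ?_⟩
  intro q hq hqΓ
  obtain ⟨ψ, hψ, hψν⟩ := hν q hqΓ
  rw [hψν]
  exact IsLocalDefiningFunction.unit_gradient_unique (hΓ.frontier_eq ▸ hqΓ) hψ
    ⟨hq.2, U, hU, hq.1, hφ, hiff⟩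

end DefiningFunction

/-! ### Touching balls, and the normality of closest-point segments. -/

section Tubular

variable {Ω Γ : Set E3} {ν : E3 → E3} {φ : E3 → ℝ} {U : Set E3} {x : E3}

/-- Expanding the square turns membership in the ball that touches the tangent plane at x into a
comparison of the height ⟨n, q - x⟩ with |q - x|², which Taylor expansions can decide. -/
theorem dist_add_smul_lt_iff {n q : E3} (hn : ‖n‖ = 1) {T : ℝ} (hT : 0 < T) :
    dist (x + T • n) q < T ↔ ‖q - x‖ ^ 2 < 2 * T * ⟪n, q - x⟫ := by
  have h1 : x + T • n - q = T • n - (q - x) := by abel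
  have h2 : ‖T • n - (q - x)‖ ^ 2 = T ^ 2 - 2 * T * ⟪n, q - x⟫ + ‖q - x‖ ^ 2 := by
    rw [norm_sub_sq_real, real_inner_smul_left, norm_smul, hn, mul_one, Real.norm_eq_abs, sq_abs]
    ring
  rw [dist_eq_norm, h1, ← sq_lt_sq₀ (norm_nonneg _) hT.le, h2]
  constructor <;> intro h <;> linarith

theorem IsDefiningOn.contDiffAt (D : IsDefiningOn Ω Γ ν φ U) (hx : x ∈ U) : ContDiffAt ℝ ∞ φ x :=
  D.contDiffOn.contDiffAt (D.isOpen.mem_nhds hx)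

/-- A point of the surface is the closest one to all points nearby on its normal line. -/
theorem IsDefiningOn.exists_isClosestPoint (D : IsDefiningOn Ω Γ ν φ U) (hxU : x ∈ U)
    (hx : x ∈ Γ) {n : E3} (hn : ‖n‖ = 1) {c : ℝ} (hc : n = c • gradient φ x) :
    ∃ T : ℝ, 0 < T ∧ IsClosestPoint Γ (x + T • n) x := by
  have h2 : ContDiffAt ℝ (1 + 1 : ℕ) φ x := contDiffAt_infty.1 (D.contDiffAt hxU) _
  obtain ⟨C, hC0, hC⟩ := h2.sub_taylor_isBigO.exists_pos
  obtain ⟨δ, hδ, hball⟩ := Metric.eventually_nhds_iff_ball.1 hC.bound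
  obtain ⟨δ', hδ', hball'⟩ := Metric.isOpen_iff.1 D.isOpen x hxU
  have hcC : 0 < 4 * (|c| * C + 1) := by positivity
  -- A point of Γ in the ball lies within 2T of x, so the first bound puts it in the Taylor
  -- neighbourhood and in U. The second bound makes 2T|c|C at most 1/2, which contradicts |q - x|² <
  -- 2T⟨n, q - x⟩.
  set T := min (min δ δ' / 2) (1 / (4 * (|c| * C + 1))) with hTdef
  have hT : 0 < T := lt_min (by have := lt_min hδ hδ'; linarith) (by positivity)
  refine ⟨T, hT, (isClosestPoint_add_smul_iff hx hn hT.le).2 fun q hq => not_lt.1 fun hlt => ?_⟩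
  have h3 := (dist_add_smul_lt_iff hn hT).1 hlt
  have h4 : ‖q - x‖ < 2 * T := by
    have h5 := real_inner_le_norm n (q - x)
    rw [hn, one_mul] at h5
    by_contra h6
    nlinarith [norm_nonneg (q - x)]
  have h5 : 2 * T ≤ min δ δ' := by linarith [min_le_left (min δ δ' / 2) (1 / (4 * (|c| * C + 1)))]
  have hqU : q ∈ U := hball' (mem_ball_iff_norm.2 (h4.trans_le (h5.trans (min_le_right _ _))))
  have h6 := hball (q - x) (mem_ball_zero_iff.2 (h4.trans_le (h5.trans (min_le_left _ _))))
  simp only [Finset.sum_range_succ, Finset.range_zero, Finset.sum_empty,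
    iteratedFDeriv_zero_apply, iteratedFDeriv_one_apply, add_sub_cancel, (D.mem_iff q hqU).1 hq,
    (D.mem_iff x hxU).1 hx, Nat.factorial] at h6
  norm_num at h6
  rw [hc, real_inner_smul_left, inner_gradient_eq_fderiv] at h3
  have h7 : c * fderiv ℝ φ x (q - x) ≤ |c| * (C * ‖q - x‖ ^ 2) := by
    refine (le_abs_self _).trans ?_
    rw [abs_mul]
    exact mul_le_mul_of_nonneg_left (by simpa [abs_sub_comm] using h6) (abs_nonneg c)
  have h8 : T * (4 * (|c| * C + 1)) ≤ 1 := by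
    calc T * (4 * (|c| * C + 1)) ≤ 1 / (4 * (|c| * C + 1)) * (4 * (|c| * C + 1)) := by
          gcongr; exact min_le_right _ _
      _ = 1 := by field_simp
  have h9 : 0 ≤ ‖q - x‖ ^ 2 := sq_nonneg _
  have h10 : 2 * T * (c * fderiv ℝ φ x (q - x)) ≤ 2 * T * (|c| * (C * ‖q - x‖ ^ 2)) := by gcongr
  have h11 : 2 * T * (|c| * (C * ‖q - x‖ ^ 2)) ≤ 1 / 2 * ‖q - x‖ ^ 2 := by
    calc 2 * T * (|c| * (C * ‖q - x‖ ^ 2)) = 2 * (T * (|c| * C)) * ‖q - x‖ ^ 2 := by ring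
      _ ≤ _ := by gcongr; linarith
  linarith

/-- The second order behaviour of a function along a curve tangent to its zero set. -/
theorem tendsto_div_sq_of_fderiv_eq_zero (hφ : ContDiffAt ℝ ∞ φ x) (h0 : φ x = 0) {v : E3}
    (hv : fderiv ℝ φ x v = 0) (b : E3) :
    Tendsto (fun s : ℝ => φ (x + s • (v + s • b)) / s ^ 2) (𝓝[>] 0)
      (𝓝 (fderiv ℝ φ x b + 1 / 2 * fderiv ℝ (fderiv ℝ φ) x v v)) := by
  have h3 : ContDiffAt ℝ (2 + 1 : ℕ) φ x := contDiffAt_infty.1 hφ _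
  have hy : Tendsto (fun s : ℝ => s • (v + s • b)) (𝓝[>] 0) (𝓝 0) := by
    have : Tendsto (fun s : ℝ => s • (v + s • b)) (𝓝 0) (𝓝 ((0 : ℝ) • (v + (0 : ℝ) • b))) :=
      (by fun_prop : Continuous fun s : ℝ => s • (v + s • b)).tendsto 0
    rw [zero_smul] at this
    exact this.mono_left nhdsWithin_le_nhds
  have h4 := h3.sub_taylor_isBigO.comp_tendsto hy
  have h5 : (fun s : ℝ => ‖s • (v + s • b)‖ ^ (2 + 1)) =O[𝓝[>] 0] fun s => s ^ 3 := by
    have h6 : (fun s : ℝ => v + s • b) =O[𝓝[>] 0] fun _ => (1 : ℝ) :=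
      (((by fun_prop : Continuous fun s : ℝ => v + s • b).tendsto 0).isBigO_one ℝ).mono
        nhdsWithin_le_nhds
    have h7 := ((isBigO_refl (fun s : ℝ => s) (𝓝[>] 0)).smul h6).norm_left.pow 3
    simpa using h7
  have h6 : (fun s : ℝ => s ^ 3) =o[𝓝[>] 0] fun s => s ^ 2 :=
    (isLittleO_pow_pow (by norm_num)).mono nhdsWithin_le_nhds
  have h7 := (h4.trans_isLittleO (h5.trans_isLittleO h6)).tendsto_div_nhds_zero
  have h8 : Tendsto (fun s : ℝ => fderiv ℝ φ x b +
      1 / 2 * fderiv ℝ (fderiv ℝ φ) x (v + s • b) (v + s • b)) (𝓝[>] 0)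
      (𝓝 (fderiv ℝ φ x b + 1 / 2 * fderiv ℝ (fderiv ℝ φ) x (v + (0 : ℝ) • b)
        (v + (0 : ℝ) • b))) :=
    ((by fun_prop : Continuous fun s : ℝ => fderiv ℝ φ x b +
      1 / 2 * fderiv ℝ (fderiv ℝ φ) x (v + s • b) (v + s • b)).tendsto 0).mono_left
      nhdsWithin_le_nhds
  have h9 := h7.add h8
  simp only [zero_smul, add_zero, zero_add] at h9
  refine h9.congr' ?_
  filter_upwards [self_mem_nhdsWithin] with s (hs : 0 < s)
  simp only [Function.comp_apply, Finset.sum_range_succ, Finset.range_zero, Finset.sum_empty,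
    iteratedFDeriv_zero_apply, iteratedFDeriv_one_apply, iteratedFDeriv_two_apply, h0,
    map_smul, map_add, hv, smul_apply, add_apply, smul_eq_mul, Nat.factorial]
  field_simp
  push_cast
  ring

/-- An enclosed ball touching the zero set bounds the second derivative in tangential
directions. -/
theorem neg_le_fderiv_fderiv_of_isClosestPoint (hφ : ContDiffAt ℝ ∞ φ x)
    (hΓ : ∀ᶠ q in 𝓝 x, q ∈ Γ ↔ φ q = 0) (hg : gradient φ x ≠ 0) {R : ℝ} (hR : 0 < R)
    (hcl : IsClosestPoint Γ (x + R • (‖gradient φ x‖⁻¹ • gradient φ x)) x) {v : E3}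
    (hv : fderiv ℝ φ x v = 0) :
    -(‖gradient φ x‖ / R * ‖v‖ ^ 2) ≤ fderiv ℝ (fderiv ℝ φ) x v v := by
  by_contra hlt
  rw [not_le] at hlt
  set m := ‖gradient φ x‖ with hm
  have hmpos : 0 < m := norm_pos_iff.2 hg
  set n := m⁻¹ • gradient φ x with hn
  have hn1 : ‖n‖ = 1 := by simp [hn, norm_smul, hm, norm_ne_zero_iff.2 hg]
  have hnv : ⟪n, v⟫ = 0 := by
    rw [hn, real_inner_smul_left, inner_gradient_eq_fderiv, hv, mul_zero]
  have hφn : fderiv ℝ φ x n = m := by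
    rw [← inner_gradient_eq_fderiv, hn, inner_smul_right, real_inner_self_eq_norm_sq, ← hm]
    field_simp
  set h := fderiv ℝ (fderiv ℝ φ) x v v
  have h0 : φ x = 0 := hΓ.self_of_nhds.1 hcl.1
  -- Along the parabola x + s v + s² a n the function φ is negative to order s², since a < -h/(2m),
  -- yet the parabola lies inside the ball for small s, since a > |v|²/(2R).
  obtain ⟨a, ha1, ha2⟩ : ∃ a, ‖v‖ ^ 2 / (2 * R) < a ∧ a < -h / (2 * m) := by
    refine exists_between ?_
    rw [div_lt_div_iff₀ (by positivity) (by positivity)]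
    have : m / R * ‖v‖ ^ 2 * R = m * ‖v‖ ^ 2 := by field_simp
    nlinarith
  rw [div_lt_iff₀ (by positivity)] at ha1
  rw [lt_div_iff₀ (by positivity)] at ha2
  obtain ⟨a', ha'⟩ := exists_gt (max a (-h / (2 * m)))
  have haa' : a < a' := (le_max_left _ _).trans_lt ha'
  have ha3 := (le_max_right a (-h / (2 * m))).trans_lt ha'
  rw [div_lt_iff₀ (by positivity)] at ha3
  have ha0 : 0 < a := by nlinarith [sq_nonneg ‖v‖]
  obtain ⟨δ, hδ, hball⟩ := Metric.eventually_nhds_iff_ball.1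
    (hΓ.and (((contDiffAt_infty.1 hφ 1).eventually
      (by simp)).mono fun q hq => hq.continuousAt))
  have t1 := tendsto_div_sq_of_fderiv_eq_zero hφ h0 hv (a • n)
  have t2 := tendsto_div_sq_of_fderiv_eq_zero hφ h0 hv (a' • n)
  rw [map_smul, hφn, smul_eq_mul] at t1 t2
  have e1 := t1.eventually_lt_const (show a * m + 1 / 2 * h < 0 by linarith)
  have e2 := t2.eventually_const_lt (show 0 < a' * m + 1 / 2 * h by linarith)
  have e3 : ∀ᶠ s in 𝓝[>] (0 : ℝ), s * (‖v‖ + s * a') < δ := by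
    refine nhdsWithin_le_nhds (((by fun_prop : Continuous fun s : ℝ =>
      s * (‖v‖ + s * a')).tendsto 0).eventually_lt_const (by simpa using hδ))
  have e4 : ∀ᶠ s in 𝓝[>] (0 : ℝ), ‖v‖ ^ 2 + s ^ 2 * a' ^ 2 < 2 * R * a := by
    refine nhdsWithin_le_nhds (((by fun_prop : Continuous fun s : ℝ =>
      ‖v‖ ^ 2 + s ^ 2 * a' ^ 2).tendsto 0).eventually_lt_const (by simp; linarith))
  obtain ⟨s, ⟨⟨⟨h1, h2⟩, h3⟩, h4⟩, hs : 0 < s⟩ :=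
    ((((e1.and e2).and e3).and e4).and self_mem_nhdsWithin).exists
  have hs2 : 0 < s ^ 2 := by positivity
  replace h1 := (div_lt_iff₀ hs2).1 h1
  rw [zero_mul] at h1
  replace h2 := (div_pos_iff_of_pos_right hs2).1 h2
  have hin : ∀ r ∈ Icc a a', x + s • (v + s • (r • n)) ∈ Metric.ball x δ := by
    intro r hr
    rw [mem_ball_iff_norm, add_sub_cancel_left, norm_smul, Real.norm_of_nonneg hs.le]
    refine lt_of_le_of_lt ?_ h3
    gcongr
    refine (norm_add_le _ _).trans ?_
    rw [norm_smul, norm_smul, hn1, mul_one, Real.norm_of_nonneg hs.le,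
      Real.norm_of_nonneg (ha0.le.trans hr.1)]
    gcongr
    exact hr.2
  have hcont : ContinuousOn (fun r : ℝ => φ (x + s • (v + s • (r • n)))) (Icc a a') := by
    intro r hr
    exact ((hball _ (hin r hr)).2.comp (f := fun r : ℝ => x + s • (v + s • (r • n)))
      (by fun_prop)).continuousWithinAt
  -- For fixed small s, φ changes sign between the parabolas with coefficients a and a'. The zero in
  -- between is a point of Γ strictly inside the touching ball.
  obtain ⟨r, hr, hr0⟩ := intermediate_value_Icc haa'.le hcont (show (0 : ℝ) ∈ _ from ⟨h1.le, h2.le⟩)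
  have hq := (hball _ (hin r hr)).1.2 hr0
  have h5 := (isClosestPoint_add_smul_iff hcl.1 hn1 hR.le).1 hcl _ hq
  refine absurd h5 (not_le.2 ((dist_add_smul_lt_iff hn1 hR).2 ?_))
  rw [add_sub_cancel_left, norm_smul, inner_smul_right, inner_add_right, hnv, zero_add,
    inner_smul_right, inner_smul_right, real_inner_self_eq_norm_sq, hn1, mul_pow,
    norm_add_sq_real, inner_smul_right, inner_smul_right, real_inner_comm, hnv, norm_smul,
    norm_smul, hn1, Real.norm_of_nonneg hs.le, Real.norm_of_nonneg (ha0.le.trans hr.1)]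
  have h6 : s ^ 2 * r ^ 2 ≤ s ^ 2 * a' ^ 2 := by
    have := ha0.le.trans hr.1
    gcongr
    exact hr.2
  have h7 : 2 * R * a ≤ 2 * R * r := by gcongr; exact hr.1
  have h8 : ‖v‖ ^ 2 + s ^ 2 * r ^ 2 < 2 * R * r := by linarith
  nlinarith [mul_lt_mul_of_pos_left h8 hs2]

/-- The vector from a closest point is normal to the surface. -/
theorem IsDefiningOn.sub_eq_smul_gradient (D : IsDefiningOn Ω Γ ν φ U) {w q : E3} (hq : q ∈ U)
    (h : IsClosestPoint Γ w q) :
    w - q = (⟪w - q, gradient φ q⟫ / ‖gradient φ q‖ ^ 2) • gradient φ q := by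
  have hne := D.gradient_ne q hq
  have hext : IsLocalExtrOn (fun p => ‖p - w‖ ^ 2) {p | φ p = φ q} q := by
    refine Or.inl (eventually_nhdsWithin_iff.2 ?_)
    filter_upwards [D.isOpen.mem_nhds hq] with p hp hpq
    have hpΓ : p ∈ Γ := (D.mem_iff p hp).2 (hpq.trans ((D.mem_iff q hq).1 h.1))
    have := h.2 p hpΓ
    rw [dist_comm w q, dist_comm w p, dist_eq_norm, dist_eq_norm] at this
    gcongr
  -- Lagrange multipliers for the squared distance on the level set of φ. The multiplier b of the
  -- distance is nonzero because the gradient of φ is.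
  obtain ⟨a, b, hab, hsum⟩ := hext.exists_multipliers_of_hasStrictFDerivAt_1d
    ((D.contDiffAt hq).hasStrictFDerivAt (by simp))
    ((hasStrictFDerivAt_norm_sq (q - w)).comp q ((hasStrictFDerivAt_id q).sub_const w))
  have hvec : a • gradient φ q + (2 * b) • (q - w) = 0 := by
    refine ext_inner_right ℝ fun v => ?_
    have := congrArg (fun L : E3 →L[ℝ] ℝ => L v) hsum
    simp only [add_apply, smul_apply, smul_eq_mul, zero_apply,
      ContinuousLinearMap.comp_apply, ContinuousLinearMap.id_apply, innerSL_apply_apply] at this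
    rw [inner_add_left, real_inner_smul_left, real_inner_smul_left, inner_gradient_eq_fderiv,
      inner_zero_left]
    simp only [nsmul_eq_mul] at this
    push_cast at this
    linarith
  have hb : b ≠ 0 := by
    rintro rfl
    simp only [mul_zero, zero_smul, add_zero, smul_eq_zero, hne, or_false] at hvec
    exact hab (by simp [hvec])
  have hk : w - q = (a / (2 * b)) • gradient φ q := by
    have h1 : (2 * b) • (w - q) = a • gradient φ q := by
      rw [← sub_eq_zero, ← neg_eq_zero, ← hvec]
      module
    rw [div_eq_inv_mul, mul_smul, ← h1, smul_smul, inv_mul_cancel₀ (by simpa using hb), one_smul]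
  have h2 : ‖gradient φ q‖ ≠ 0 := norm_ne_zero_iff.2 hne
  nth_rewrite 1 [hk]
  rw [hk, real_inner_smul_left, real_inner_self_eq_norm_sq]
  congr 1
  field_simp

end Tubular

/-! ### Smoothness of the closest point mapping and the signed distance below the reach. -/

section TubularSmooth

variable {Ω Γ : Set E3} {ν P : E3 → E3} {φ : E3 → ℝ} {U : Set E3} {x : E3}

theorem IsDefiningOn.norm_normal (D : IsDefiningOn Ω Γ ν φ U) (hxU : x ∈ U) (hx : x ∈ Γ) :
    ‖ν x‖ = 1 := by
  rw [D.normal_eq x hxU hx]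
  simp [norm_smul, norm_ne_zero_iff.2 (D.gradient_ne x hxU)]

theorem IsDefiningOn.contDiffOn_gradient (D : IsDefiningOn Ω Γ ν φ U) :
    ContDiffOn ℝ ∞ (gradient φ) U :=
  D.contDiffOn.gradient_of_isOpen D.isOpen

/-- Taylor's formula provides a small touching ball on each side of the surface, and the extension
argument enlarges it to any radius below the reach. Negative t are treated with the normal -ν. -/
theorem IsDefiningOn.isClosestPoint_add_smul_normal (D : IsDefiningOn Ω Γ ν φ U)
    (hΓ : IsCompact Γ) (hP : IsClosestPointMap Γ P) (hxU : x ∈ U) (hx : x ∈ Γ) {t R : ℝ}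
    (ht : |t| ≤ R) (hR : ENNReal.ofReal R < reach Γ) : IsClosestPoint Γ (x + t • ν x) x := by
  have hν := D.normal_eq x hxU hx
  have hν1 := D.norm_normal hxU hx
  rcases le_total 0 t with h | h
  · obtain ⟨T, hT, hcl⟩ := D.exists_isClosestPoint hxU hx hν1 hν
    exact isClosestPoint_add_smul_of_lt_reach hΓ hP hx hν1 hT hcl h
      ((le_abs_self t).trans ht) hR
  · have hν' : -ν x = (-‖gradient φ x‖⁻¹) • gradient φ x := by rw [hν, neg_smul]
    have hν1' : ‖-ν x‖ = 1 := by rw [norm_neg, hν1]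
    obtain ⟨T, hT, hcl⟩ := D.exists_isClosestPoint hxU hx hν1' hν'
    have := isClosestPoint_add_smul_of_lt_reach hΓ hP hx hν1' hT hcl (neg_nonneg.2 h)
      ((neg_le_abs t).trans ht) hR
    simpa using this

theorem inner_fderiv_gradient (hφ : ContDiffAt ℝ ∞ φ x) (v v' : E3) :
    ⟪fderiv ℝ (gradient φ) x v, v'⟫ = fderiv ℝ (fderiv ℝ φ) x v v' := by
  have h1 : DifferentiableAt ℝ (fderiv ℝ φ) x :=
    ((contDiffAt_infty.1 hφ 2).fderiv_right (m := 1) (by norm_num)).differentiableAt (by simp)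
  have h2 : DifferentiableAt ℝ (gradient φ) x :=
    (InnerProductSpace.toDual ℝ E3).symm.differentiable.differentiableAt.comp x h1
  have h3 : (fun q => ⟪gradient φ q, v'⟫) = fun q => fderiv ℝ φ q v' :=
    funext fun q => inner_gradient_eq_fderiv φ q v'
  have h4 := congrArg (fun f : E3 → ℝ => fderiv ℝ f x v) h3
  rw [fderiv_inner_apply ℝ h2 (differentiableAt_const _)] at h4
  rw [fderiv_clm_apply h1 (differentiableAt_const _)] at h4
  simpa using h4

/-- The curvature bound coming from the two balls of radius `R` touching the surface. -/
theorem IsDefiningOn.abs_fderiv_fderiv_le (D : IsDefiningOn Ω Γ ν φ U)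
    (hΓ : IsCompact Γ) (hP : IsClosestPointMap Γ P) (hxU : x ∈ U) (hx : x ∈ Γ) {R : ℝ}
    (hR0 : 0 < R) (hR : ENNReal.ofReal R < reach Γ) {v : E3} (hv : fderiv ℝ φ x v = 0) :
    |fderiv ℝ (fderiv ℝ φ) x v v| ≤ ‖gradient φ x‖ / R * ‖v‖ ^ 2 := by
  have hν := D.normal_eq x hxU hx
  have hg := D.gradient_ne x hxU
  have hneg : gradient (-φ) x = -gradient φ x := by
    refine ext_inner_right ℝ fun w => ?_
    rw [inner_gradient_eq_fderiv, inner_neg_left, inner_gradient_eq_fderiv, fderiv_neg,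
      neg_apply]
  have hneg2 : fderiv ℝ (fderiv ℝ (-φ)) x v v = -fderiv ℝ (fderiv ℝ φ) x v v := by
    have : fderiv ℝ (-φ) = -fderiv ℝ φ := funext fun q => fderiv_neg
    rw [this, fderiv_neg, neg_apply, neg_apply]
  -- The ball on the outer side gives the lower bound. The ball on the inner side gives the upper
  -- one, by the same lemma for -φ.
  have h1 := neg_le_fderiv_fderiv_of_isClosestPoint (Γ := Γ) (D.contDiffAt hxU)
    (by filter_upwards [D.isOpen.mem_nhds hxU] with q hq using D.mem_iff q hq) hg hR0 (by
      rw [← hν]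
      exact D.isClosestPoint_add_smul_normal hΓ hP hxU hx (abs_of_pos hR0).le hR) hv
  have h2 := neg_le_fderiv_fderiv_of_isClosestPoint (Γ := Γ) (φ := -φ) (D.contDiffAt hxU).neg
    (by
      filter_upwards [D.isOpen.mem_nhds hxU] with q hq
      rw [D.mem_iff q hq, Pi.neg_apply, neg_eq_zero]) (by rwa [hneg, neg_ne_zero]) hR0 (by
      rw [hneg, norm_neg, smul_neg, ← hν]
      have := D.isClosestPoint_add_smul_normal hΓ hP hxU hx (t := -R)
        (by rw [abs_neg, abs_of_pos hR0]) hR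
      simpa using this) (v := v) (by rw [fderiv_neg, neg_apply, hv, neg_zero])
  rw [hneg, norm_neg, hneg2] at h2
  exact abs_le.2 ⟨h1, by linarith⟩

/-- The closest point mapping is smooth at points of a normal line, up to the reach. -/
theorem IsDefiningOn.contDiffAt_closestPoint (D : IsDefiningOn Ω Γ ν φ U)
    (hΓ : IsCompact Γ) (hP : IsClosestPointMap Γ P) (hxU : x ∈ U) (hx : x ∈ Γ) {t R : ℝ}
    (ht : |t| < R) (hR : ENNReal.ofReal R < reach Γ) :
    ContDiffAt ℝ ∞ P (x + t • ν x) ∧ P (x + t • ν x) = x := by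
  have hR0 : 0 < R := (abs_nonneg t).trans_lt ht
  have hν := D.normal_eq x hxU hx
  have hν1 := D.norm_normal hxU hx
  have hg := D.gradient_ne x hxU
  set g := gradient φ with hgdef
  clear_value g
  set m := ‖g x‖ with hm
  have hm0 : 0 < m := norm_pos_iff.2 hg
  set y := x + t • ν x with hy
  have hcl : IsClosestPoint Γ y x := D.isClosestPoint_add_smul_normal hΓ hP hxU hx ht.le hR
  have huniq : ∀ q, IsClosestPoint Γ y q → q = x := by
    intro q hq
    refine hq.eq_of_dist_lt_reach hcl hx (lt_of_le_of_lt (ENNReal.ofReal_le_ofReal ?_) hR)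
    rw [hy, dist_eq_norm, add_sub_cancel_left, norm_smul, hν1, mul_one]
    exact ht.le
  have hPy : P y = x := huniq _ (hP y)
  refine ⟨?_, hPy⟩
  have hPt : Tendsto P (𝓝 y) (𝓝 x) := hP.tendsto hΓ huniq
  have hφ := D.contDiffAt hxU
  have hgs : ContDiffAt ℝ ∞ g x := hgdef ▸ D.contDiffOn_gradient.contDiffAt (D.isOpen.mem_nhds hxU)
  set s₀ := t / m with hs₀
  -- Normal coordinates in which the surface is cut out by the last component, so no parametrization
  -- of Γ is needed. The normal is left unnormalized, hence the parameter s₀ = t/m of the point y.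
  let Ψ : E3 × ℝ → E3 × ℝ := fun p => (p.1 + p.2 • g p.1, φ p.1)
  have hΨ : ContDiffAt ℝ ∞ Ψ (x, s₀) := by
    have h1 : ContDiffAt ℝ ∞ (fun p : E3 × ℝ => g p.1) (x, s₀) := hgs.comp (x, s₀) contDiffAt_fst
    have h2 : ContDiffAt ℝ ∞ (fun p : E3 × ℝ => φ p.1) (x, s₀) := hφ.comp (x, s₀) contDiffAt_fst
    exact (contDiffAt_fst.add (contDiffAt_snd.smul h1)).prodMk h2
  have hΨd : ∀ p : E3 × ℝ, fderiv ℝ Ψ (x, s₀) p =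
      (p.1 + (s₀ • fderiv ℝ g x p.1 + p.2 • g x), fderiv ℝ φ x p.1) := by
    intro p
    have h1 : HasFDerivAt (fun p : E3 × ℝ => g p.1) ((fderiv ℝ g x).comp
        (ContinuousLinearMap.fst ℝ E3 ℝ)) (x, s₀) :=
      (hgs.differentiableAt (by simp)).hasFDerivAt.comp (x, s₀) hasFDerivAt_fst
    have h2 : HasFDerivAt (fun p : E3 × ℝ => φ p.1) ((fderiv ℝ φ x).comp
        (ContinuousLinearMap.fst ℝ E3 ℝ)) (x, s₀) :=
      (hφ.differentiableAt (by simp)).hasFDerivAt.comp (x, s₀) hasFDerivAt_fst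
    have h3 := (hasFDerivAt_fst.add (hasFDerivAt_snd.smul h1)).prodMk h2
    have h4 : fderiv ℝ Ψ (x, s₀) = _ := h3.fderiv
    rw [h4]
    simp
  have hinj : Function.Injective (fderiv ℝ Ψ (x, s₀)) := by
    refine (injective_iff_map_eq_zero _).2 fun p hp => ?_
    rw [hΨd, Prod.mk_eq_zero] at hp
    obtain ⟨hp1, hp2⟩ := hp
    -- A kernel vector has tangential first component v, and pairing with v gives |v|² + s₀ φ''(v,
    -- v) = 0. The curvature bound makes the second term at most (|t|/R)|v|² in modulus, with |t|/R
    -- < 1, so v = 0.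
    have h1 := congrArg (fun w => ⟪w, p.1⟫) hp1
    simp only [inner_add_left, real_inner_smul_left, inner_zero_left,
      real_inner_self_eq_norm_sq] at h1
    rw [hgdef, inner_fderiv_gradient hφ, inner_gradient_eq_fderiv, hp2, mul_zero, add_zero] at h1
    have h2 := D.abs_fderiv_fderiv_le hΓ hP hxU hx hR0 hR hp2
    rw [← hgdef, ← hm] at h2
    have h3 : |s₀ * fderiv ℝ (fderiv ℝ φ) x p.1 p.1| ≤ |t| / R * ‖p.1‖ ^ 2 := by
      rw [abs_mul, hs₀, abs_div, abs_of_pos hm0]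
      calc _ ≤ |t| / m * (m / R * ‖p.1‖ ^ 2) := by gcongr
        _ = _ := by field_simp
    have h4 : |t| / R < 1 := (div_lt_one hR0).2 ht
    have h5 : ‖p.1‖ ^ 2 ≤ 0 := by
      by_contra h6
      rw [not_le] at h6
      have := (abs_le.1 h3).1
      nlinarith
    have h6 : p.1 = 0 := by
      rw [← norm_eq_zero]
      exact pow_eq_zero_iff two_ne_zero |>.1 (le_antisymm h5 (sq_nonneg _))
    rw [h6, map_zero, smul_zero, zero_add, zero_add, smul_eq_zero] at hp1
    exact Prod.ext h6 (hp1.resolve_right hg)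
  let e : (E3 × ℝ) ≃L[ℝ] (E3 × ℝ) :=
    (LinearEquiv.ofInjectiveEndo (fderiv ℝ Ψ (x, s₀) : E3 × ℝ →ₗ[ℝ] E3 × ℝ)
      hinj).toContinuousLinearEquiv
  have he : (e : E3 × ℝ →L[ℝ] E3 × ℝ) = fderiv ℝ Ψ (x, s₀) := by
    exact ContinuousLinearMap.ext fun _ => rfl
  have hΨ' : HasFDerivAt Ψ (e : E3 × ℝ →L[ℝ] E3 × ℝ) (x, s₀) := by
    rw [he]; exact (hΨ.differentiableAt (by simp)).hasFDerivAt
  have hne : (∞ : ℕ∞ω) ≠ 0 := by simp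
  have hinv := hΨ.to_localInverse hΨ' hne
  have hleft := (hΨ.hasStrictFDerivAt' hΨ' hne).eventually_left_inverse
  have hΨx : Ψ (x, s₀) = (y, 0) := by
    simp only [Ψ, hy, hν, hs₀, (D.mem_iff x hxU).1 hx, smul_smul]
    rw [div_eq_mul_inv]
  rw [hΨx] at hinv
  -- The multiplier with w - P(w) = σ(w) ∇φ(P(w)). Thus Ψ sends (P(w), σ(w)) to (w, 0), and this
  -- pair tends to (x, s₀), so near y it is the value of the local inverse.
  let σ : E3 → ℝ := fun w => ⟪w - P w, g (P w)⟫ / ‖g (P w)‖ ^ 2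
  have hσ : Tendsto (fun w => (P w, σ w)) (𝓝 y) (𝓝 (x, s₀)) := by
    refine hPt.prodMk_nhds ?_
    have h1 : Tendsto (fun w => g (P w)) (𝓝 y) (𝓝 (g x)) := hgs.continuousAt.tendsto.comp hPt
    have h2 := (((continuous_id'.tendsto y).sub hPt).inner h1).div (h1.norm.pow 2) (by positivity)
    convert! h2 using 2
    rw [hy, hν, add_sub_cancel_left, real_inner_smul_left, real_inner_smul_left,
      real_inner_self_eq_norm_sq, ← hm, hs₀]
    field_simp
  have hev : ∀ᶠ w in 𝓝 y, P w = (hΨ.localInverse hΨ' hne (w, 0)).1 := by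
    filter_upwards [hσ.eventually hleft, hPt.eventually (D.isOpen.mem_nhds hxU)] with w h1 h2
    have h3 : Ψ (P w, σ w) = (w, 0) := by
      have := D.sub_eq_smul_gradient h2 (hP w)
      simp only [Ψ, σ, (D.mem_iff _ h2).1 (hP w).1]
      rw [← hgdef] at this
      rw [← this, add_sub_cancel]
    rw [h3] at h1
    exact (congrArg Prod.fst h1).symm
  refine ContDiffAt.congr_of_eventuallyEq ?_ hev
  exact contDiffAt_fst.comp y (hinv.comp y (contDiffAt_id.prodMk contDiffAt_const))

/-- A point with closest point `q` lies on the normal line at `q`. -/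
theorem IsDefiningOn.eq_add_smul_normal (D : IsDefiningOn Ω Γ ν φ U) {w q : E3} (hq : q ∈ U)
    (h : IsClosestPoint Γ w q) : ∃ t : ℝ, |t| = dist w q ∧ w = q + t • ν q := by
  have h1 := D.sub_eq_smul_gradient hq h
  have h2 : ‖gradient φ q‖ ≠ 0 := norm_ne_zero_iff.2 (D.gradient_ne q hq)
  have h3 : w - q = (⟪w - q, gradient φ q⟫ / ‖gradient φ q‖) • ν q := by
    rw [D.normal_eq q hq h.1, smul_smul]
    nth_rewrite 1 [h1]
    congr 1
    field_simp
  refine ⟨⟪w - q, gradient φ q⟫ / ‖gradient φ q‖, ?_, by rw [← h3, add_sub_cancel]⟩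
  rw [dist_eq_norm, h3, norm_smul, D.norm_normal hq h.1, mul_one, ← h3, Real.norm_eq_abs]

/-- The closest point mapping is smooth on tubular neighborhoods of radius less than the reach. -/
theorem contDiffOn_closestPoint (hΓ : IsSmoothClosedSurface Γ Ω)
    (hν : ∀ p ∈ Γ, IsOutwardUnitNormal Ω p (ν p)) (hP : IsClosestPointMap Γ P) {R : ℝ}
    (hR : ENNReal.ofReal R < reach Γ) : ContDiffOn ℝ ∞ P {w | Metric.infDist w Γ < R} := by
  intro w hw
  obtain ⟨φ, U, hU, D⟩ := hΓ.exists_isDefiningOn hν (hP w).1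
  obtain ⟨t, ht, hwt⟩ := D.eq_add_smul_normal hU (hP w)
  have h1 : |t| < R := by rw [ht, ← (hP w).infDist_eq]; exact hw
  have h2 := (D.contDiffAt_closestPoint hΓ.isCompact hP hU (hP w).1 h1 hR).1
  rw [← hwt] at h2
  exact h2.contDiffWithinAt

theorem isOpen_tubular (Γ : Set E3) (R : ℝ) : IsOpen {w | Metric.infDist w Γ < R} :=
  isOpen_lt (Metric.continuous_infDist_pt Γ) continuous_const

/-- The signed distance is the coordinate along the normal line. -/
theorem IsDefiningOn.surfaceSignedDist_add_smul_normal (D : IsDefiningOn Ω Γ ν φ U)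
    (hΓ : IsSmoothClosedSurface Γ Ω) (hP : IsClosestPointMap Γ P) (hxU : x ∈ U) (hx : x ∈ Γ)
    {t R : ℝ} (ht : |t| ≤ R) (hR : ENNReal.ofReal R < reach Γ) :
    surfaceSignedDist Γ Ω (x + t • ν x) = t := by
  have hν1 := D.norm_normal hxU hx
  have hcl : ∀ s, |s| ≤ R → IsClosestPoint Γ (x + s • ν x) x := fun s hs =>
    D.isClosestPoint_add_smul_normal hΓ.isCompact hP hxU hx hs hR
  have hinf : ∀ s, |s| ≤ R → Metric.infDist (x + s • ν x) Γ = |s| := by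
    intro s hs
    rw [(hcl s hs).infDist_eq, dist_eq_norm, add_sub_cancel_left, norm_smul, hν1, mul_one,
      Real.norm_eq_abs]
  have hnot : ∀ s, |s| ≤ R → s ≠ 0 → x + s • ν x ∉ Γ := by
    intro s hs hs0 hmem
    have := hinf s hs
    rw [Metric.infDist_zero_of_mem hmem] at this
    exact hs0 (abs_eq_zero.1 this.symm)
  have hg := D.gradient_ne x hxU
  have hφν : 0 < fderiv ℝ φ x (ν x) := by
    rw [← inner_gradient_eq_fderiv, D.normal_eq x hxU hx, inner_smul_right,
      real_inner_self_eq_norm_sq]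
    have := norm_pos_iff.2 hg
    positivity
  have hφ0 := (D.mem_iff x hxU).1 hx
  have hdiff := (D.contDiffAt hxU).differentiableAt (by simp)
  -- A segment of the normal line that avoids x does not meet Γ below the reach, so by connectedness
  -- it lies either in Ω or in the complement of its closure.
  have hconst : ∀ {a b : ℝ}, a ≤ b → |a| ≤ R → |b| ≤ R → (0 < a ∨ b < 0) →
      (x + a • ν x ∈ Ω ↔ x + b • ν x ∈ Ω) := by
    intro a b hab ha hb h0
    have hpre : IsPreconnected ((fun s : ℝ => x + s • ν x) '' Icc a b) :=
      isPreconnected_Icc.image _ (by fun_prop : Continuous _).continuousOn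
    have hfr : ∀ p ∈ (fun s : ℝ => x + s • ν x) '' Icc a b, p ∉ frontier Ω := by
      rintro p ⟨s, hs, rfl⟩
      rw [hΓ.frontier_eq]
      refine hnot s (abs_le.2 ⟨by linarith [(abs_le.1 ha).1, hs.1],
        by linarith [(abs_le.1 hb).2, hs.2]⟩) ?_
      rintro rfl
      rcases h0 with h0 | h0 <;> linarith [hs.1, hs.2]
    have hsub : (fun s : ℝ => x + s • ν x) '' Icc a b ⊆ Ω ∪ (closure Ω)ᶜ := by
      intro p hp
      by_cases h : p ∈ Ω
      · exact Or.inl h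
      · exact Or.inr fun hcl => hfr p hp ⟨hcl, by rwa [hΓ.isOpen.interior_eq]⟩
    have hdisj : Disjoint Ω (closure Ω)ᶜ :=
      disjoint_compl_right.mono_left subset_closure
    have ham : x + a • ν x ∈ (fun s : ℝ => x + s • ν x) '' Icc a b := ⟨a, ⟨le_rfl, hab⟩, rfl⟩
    have hbm : x + b • ν x ∈ (fun s : ℝ => x + s • ν x) '' Icc a b := ⟨b, ⟨hab, le_rfl⟩, rfl⟩
    rcases hpre.subset_or_subset hΓ.isOpen isClosed_closure.isOpen_compl hdisj hsub with h | h
    · exact ⟨fun _ => h hbm, fun _ => h ham⟩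
    · exact ⟨fun ha' => absurd (subset_closure ha') (h ham),
        fun hb' => absurd (subset_closure hb') (h hbm)⟩
  -- The side is decided at a point very close to x, where the sign of φ is that of its first order
  -- term, and is then carried along the segment to t.
  rcases lt_trichotomy t 0 with h | rfl | h
  · have e1 := eventually_pos_of_fderiv_pos (φ := -φ) (v := -ν x) hdiff.neg (by simp [hφ0])
      (by rw [fderiv_neg]; simpa using hφν)
    have e2 := (tendsto_add_smul x (-ν x)).eventually (D.isOpen.mem_nhds hxU)
    have e3 : ∀ᶠ s in 𝓝[>] (0 : ℝ), s < -t := nhdsWithin_le_nhds (gt_mem_nhds (by linarith))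
    obtain ⟨s, ⟨⟨h1, h2⟩, h3⟩, hs : 0 < s⟩ := (((e1.and e2).and e3).and self_mem_nhdsWithin).exists
    have h4 : x + (-s) • ν x ∈ Ω := by
      rw [smul_neg, ← neg_smul] at h2 h1
      exact (D.mem_interior_iff _ h2).2 (by simpa using h1)
    have h5 := (hconst (a := t) (b := -s) (by linarith) ht
      (by rw [abs_neg, abs_of_pos hs]; rw [abs_of_neg h] at ht; linarith)
      (Or.inr (by linarith))).2 h4
    rw [surfaceSignedDist, if_pos h5, hinf t ht, abs_of_neg h, neg_neg]
  · rw [zero_smul, add_zero, surfaceSignedDist, Metric.infDist_zero_of_mem hx]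
    simp
  · have e1 := eventually_pos_of_fderiv_pos hdiff hφ0 hφν
    have e2 := (tendsto_add_smul x (ν x)).eventually (D.isOpen.mem_nhds hxU)
    have e3 : ∀ᶠ s in 𝓝[>] (0 : ℝ), s < t := nhdsWithin_le_nhds (gt_mem_nhds h)
    obtain ⟨s, ⟨⟨h1, h2⟩, h3⟩, hs : 0 < s⟩ := (((e1.and e2).and e3).and self_mem_nhdsWithin).exists
    have h4 : x + s • ν x ∉ Ω := fun hmem => by
      linarith [(D.mem_interior_iff _ h2).1 hmem]
    have h5 := mt (hconst h3.le (by rw [abs_of_pos hs]; rw [abs_of_pos h] at ht; linarith) ht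
      (Or.inl hs)).2 h4
    rw [surfaceSignedDist, if_neg h5, hinf t ht, abs_of_pos h]

end TubularSmooth

/-! ### Polar coordinates: division by powers of the radius. -/

section Polar

variable {W : Type} [NormedAddCommGroup W] [NormedSpace ℝ W]

theorem hasDerivAt_smul_zero {g : ℝ → W} (hg : DifferentiableAt ℝ g 0) :
    HasDerivAt (fun t : ℝ => t • g t) (g 0) 0 := by
  simpa using (hasDerivAt_id' (0 : ℝ)).fun_smul hg.hasDerivAt

theorem differentiableAt_slice {V : Type} [NormedAddCommGroup V] [NormedSpace ℝ V]
    {S : Set (ℝ × V)} (hS : IsOpen S) {G : ℝ × V → W} (hG : ContDiffOn ℝ ∞ G S) {t : ℝ} {u : V}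
    (h : (t, u) ∈ S) : DifferentiableAt ℝ (fun t => G (t, u)) t :=
  (((hG.differentiableOn (by simp)).differentiableAt (hS.mem_nhds h)).comp t
    (f := fun t : ℝ => (t, u)) (by fun_prop))

/-- Identifies the Hadamard quotient at radius zero with the radial derivative. -/
theorem deriv_slice_of_eq_add_smul {V : Type} [NormedAddCommGroup V] [NormedSpace ℝ V]
    {S : Set (ℝ × V)} (hS : IsOpen S) {F G : ℝ × V → W} (hG : ContDiffOn ℝ ∞ G S)
    (hFG : ∀ p ∈ S, F p = F (0, p.2) + p.1 • G p) {u : V} (hu : ((0 : ℝ), u) ∈ S) :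
    HasDerivAt (fun t => F (t, u)) (G (0, u)) 0 := by
  have h1 := (hasDerivAt_smul_zero (differentiableAt_slice hS hG hu)).const_add (F (0, u))
  refine h1.congr_of_eventuallyEq ?_
  have h2 : ∀ᶠ t in 𝓝 (0 : ℝ), (t, u) ∈ S :=
    (by fun_prop : Continuous fun t : ℝ => (t, u)).continuousAt.eventually (hS.mem_nhds hu)
  filter_upwards [h2] with t ht
  exact hFG _ ht

variable [CompleteSpace W]

/-- The domain on which a function on a ball is expressed in polar coordinates. -/
def polarDomain (ρ : ℝ) : Set (ℝ × E2) := {p | ‖p.1 • p.2‖ < ρ}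

theorem isOpen_polarDomain (ρ : ℝ) : IsOpen (polarDomain ρ) :=
  isOpen_lt (by fun_prop) continuous_const

theorem zero_mem_polarDomain {ρ : ℝ} (hρ : 0 < ρ) (u : E2) : ((0 : ℝ), u) ∈ polarDomain ρ := by
  simpa [polarDomain] using hρ

theorem polarDomain_star {ρ : ℝ} : ∀ p ∈ polarDomain ρ, ∀ s ∈ Icc (0 : ℝ) 1,
    (s * p.1, p.2) ∈ polarDomain ρ := by
  intro p hp s hs
  have hp' : ‖p.1 • p.2‖ < ρ := hp
  change ‖(s * p.1) • p.2‖ < ρ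
  rw [mul_smul, norm_smul, Real.norm_of_nonneg hs.1]
  nlinarith [norm_nonneg (p.1 • p.2), hs.2]

/-- A smooth function vanishing at the origin, divided by the radius in polar coordinates. -/
theorem exists_polar_factor {ρ : ℝ} (hρ : 0 < ρ) {F : E2 → W}
    (hF : ContDiffOn ℝ ∞ F (Metric.ball 0 ρ)) (h0 : F 0 = 0) :
    ∃ G : ℝ × E2 → W, ContDiffOn ℝ ∞ G (polarDomain ρ) ∧
      (∀ p ∈ polarDomain ρ, F (p.1 • p.2) = p.1 • G p) ∧ ∀ u, G (0, u) = fderiv ℝ F 0 u := by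
  have hFp : ContDiffOn ℝ ∞ (fun p : ℝ × E2 => F (p.1 • p.2)) (polarDomain ρ) :=
    hF.comp (by fun_prop) fun p hp => mem_ball_zero_iff.2 hp
  obtain ⟨G, hG, hGF⟩ := exists_contDiffOn_smul_of_contDiffOn (isOpen_polarDomain ρ)
    polarDomain_star hFp
  refine ⟨G, hG, fun p hp => by simpa [h0] using hGF p hp, fun u => ?_⟩
  have h1 := deriv_slice_of_eq_add_smul (isOpen_polarDomain ρ) hG hGF (zero_mem_polarDomain hρ u)
  have h2 : HasDerivAt (fun t : ℝ => t • u) u 0 := by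
    simpa using (hasDerivAt_id (0 : ℝ)).smul_const u
  have h3 : HasFDerivAt F (fderiv ℝ F 0) ((0 : ℝ) • u) := by
    rw [zero_smul]
    exact ((hF.differentiableOn (by simp)).differentiableAt
      (Metric.ball_mem_nhds 0 hρ)).hasFDerivAt
  exact h1.unique (h3.comp_hasDerivAt (0 : ℝ) h2)

/-- A smooth function vanishing to second order at the origin, divided by the squared radius. -/
theorem exists_polar_factor_sq {ρ : ℝ} (hρ : 0 < ρ) {F : E2 → W}
    (hF : ContDiffOn ℝ ∞ F (Metric.ball 0 ρ)) (h0 : F 0 = 0) (h1 : fderiv ℝ F 0 = 0) :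
    ∃ G : ℝ × E2 → W, ContDiffOn ℝ ∞ G (polarDomain ρ) ∧
      ∀ p ∈ polarDomain ρ, F (p.1 • p.2) = p.1 ^ 2 • G p := by
  obtain ⟨G, hG, hFG, hG0⟩ := exists_polar_factor hρ hF h0
  obtain ⟨G', hG', hGG'⟩ := exists_contDiffOn_smul_of_contDiffOn (isOpen_polarDomain ρ)
    polarDomain_star hG
  refine ⟨G', hG', fun p hp => ?_⟩
  rw [hFG p hp, hGG' p hp, hG0, h1, zero_apply, zero_add, smul_smul, sq]

/-- A condition on an open set that contains the unit circle at radius zero holds on an open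
annular box. -/
theorem exists_box_of_isOpen {S : Set (ℝ × E2)} (hS : IsOpen S)
    (h : ∀ u ∈ Metric.sphere (0 : E2) 1, ((0 : ℝ), u) ∈ S) :
    ∃ r > 0, ∃ N : Set E2, IsOpen N ∧ Metric.sphere (0 : E2) 1 ⊆ N ∧ Ioo (-r) r ×ˢ N ⊆ S := by
  obtain ⟨A, N, hA, hN, h0A, hsN, hsub⟩ := generalized_tube_lemma (s := {(0 : ℝ)})
    isCompact_singleton (isCompact_sphere (0 : E2) 1) hS (by
      rintro ⟨t, u⟩ ⟨ht, hu⟩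
      obtain rfl : t = 0 := ht
      exact h u hu)
  obtain ⟨r, hr, hball⟩ := Metric.isOpen_iff.1 hA 0 (h0A rfl)
  rw [Real.ball_eq_Ioo, zero_sub, zero_add] at hball
  exact ⟨r, hr, N, hN, hsN, (prod_mono_left hball).trans hsub⟩

/-- The direction ranges over an open set N of the plane so that all calculus takes place in vector
spaces. Smoothness on the circle as a manifold is obtained only here, by restriction. -/
theorem contMDiffOn_sphere_of_contDiffOn {r : ℝ} {N : Set E2}
    (hsN : Metric.sphere (0 : E2) 1 ⊆ N) {L : ℝ × E2 → ℝ}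
    (hL : ContDiffOn ℝ ∞ L (Ioo (-r) r ×ˢ N)) :
    ContMDiffOn (𝓘(ℝ, ℝ).prod (𝓡 1)) 𝓘(ℝ, ℝ) ∞
      (fun p : ℝ × Metric.sphere (0 : E2) 1 => L (p.1, p.2)) (Ioo (-r) r ×ˢ univ) := by
  have h1 : ContMDiff (𝓘(ℝ, ℝ).prod (𝓡 1)) 𝓘(ℝ, ℝ × E2) ∞
      (fun p : ℝ × Metric.sphere (0 : E2) 1 => (p.1, (p.2 : E2))) :=
    contMDiff_fst.prodMk_space (contMDiff_coe_sphere.comp contMDiff_snd)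
  exact hL.contMDiffOn.comp h1.contMDiffOn fun p hp => ⟨hp.1, hsN p.2.2⟩

/-- Uniform first order Taylor expansion in the radius. -/
theorem exists_radial_remainder_bound {r : ℝ} (hr : 0 < r) {N : Set E2} (hN : IsOpen N)
    (hsN : Metric.sphere (0 : E2) 1 ⊆ N) {L : ℝ × E2 → ℝ}
    (hL : ContDiffOn ℝ ∞ L (Ioo (-r) r ×ˢ N)) :
    ∃ C : ℝ, ∀ t ∈ Icc (0 : ℝ) (r / 2), ∀ u ∈ Metric.sphere (0 : E2) 1,
      |L (t, u) - (L (0, u) + t * deriv (fun t => L (t, u)) 0)| ≤ C * t ^ 2 := by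
  have hS : IsOpen (Ioo (-r) r ×ˢ N) := isOpen_Ioo.prod hN
  have hstar : ∀ p ∈ Ioo (-r) r ×ˢ N, ∀ s ∈ Icc (0 : ℝ) 1, (s * p.1, p.2) ∈ Ioo (-r) r ×ˢ N := by
    rintro ⟨t, u⟩ ⟨ht, hu⟩ s hs
    refine ⟨?_, hu⟩
    simp only [mem_Ioo] at ht ⊢
    rw [← abs_lt] at ht ⊢
    rw [abs_mul, abs_of_nonneg hs.1]
    nlinarith [abs_nonneg t, hs.2]
  -- Two applications of Hadamard's lemma write the remainder as t² G'(t, u) with G' continuous,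
  -- hence bounded on the compact product of [0, r/2] and the circle.
  obtain ⟨G, hG, hLG⟩ := exists_contDiffOn_smul_of_contDiffOn hS hstar hL
  obtain ⟨G', hG', hGG'⟩ := exists_contDiffOn_smul_of_contDiffOn hS hstar hG
  have hsub : Icc (0 : ℝ) (r / 2) ×ˢ Metric.sphere (0 : E2) 1 ⊆ Ioo (-r) r ×ˢ N :=
    prod_mono (fun t ht => ⟨by linarith [ht.1], by linarith [ht.2]⟩) hsN
  obtain ⟨C, hC⟩ := (isCompact_Icc.prod (isCompact_sphere (0 : E2) 1)).exists_bound_of_continuousOn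
    (hG'.continuousOn.mono hsub)
  refine ⟨C, fun t ht u hu => ?_⟩
  have hmem := hsub (mk_mem_prod ht hu)
  have h0 : ((0 : ℝ), u) ∈ Ioo (-r) r ×ˢ N := ⟨⟨by simpa using hr, hr⟩, hsN hu⟩
  rw [(deriv_slice_of_eq_add_smul hS hG hLG h0).deriv]
  have e1 := hLG _ hmem
  have e2 := hGG' _ hmem
  simp only [smul_eq_mul] at e1 e2
  have e3 : L (t, u) - (L (0, u) + t * G (0, u)) = G' (t, u) * t ^ 2 := by
    rw [e1, e2]; ring
  rw [e3, abs_mul, abs_of_nonneg (sq_nonneg t)]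
  have := hC (t, u) (mk_mem_prod ht hu)
  rw [Real.norm_eq_abs] at this
  gcongr

end Polar

/-! ### Horizontal directions. -/

section Horizontal

/-- The inclusion of the horizontal plane. -/
noncomputable def horizontal : E2 →L[ℝ] E3 :=
  LinearMap.toContinuousLinearMap
    { toFun := fun y => planePoint y 0
      map_add' := fun a b => by
        ext i; fin_cases i <;> simp [planePoint]
      map_smul' := fun c a => by
        ext i; fin_cases i <;> simp [planePoint] }

@[simp] theorem horizontal_apply_zero (y : E2) : horizontal y 0 = y 0 := rfl
@[simp] theorem horizontal_apply_one (y : E2) : horizontal y 1 = y 1 := rfl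
@[simp] theorem horizontal_apply_two (y : E2) : horizontal y 2 = 0 := rfl

/-- The transversality supplied by n₃ ≠ 0. It makes the derivative of the closest point mapping
injective on the plane, although in space this derivative kills the normal direction. -/
theorem horizontal_eq_zero_of_eq_smul {y : E2} {c : ℝ} {n : E3} (hn : n 2 ≠ 0)
    (h : horizontal y = c • n) : y = 0 := by
  have h2 := congrArg (fun p : E3 => p 2) h
  simp only [horizontal_apply_two, PiLp.smul_apply, smul_eq_mul] at h2
  have hc : c = 0 := by
    rcases mul_eq_zero.1 h2.symm with h | h
    · exact h
    · exact absurd h hn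
  rw [hc, zero_smul] at h
  ext i
  fin_cases i
  · simpa using congrArg (fun p : E3 => p 0) h
  · simpa using congrArg (fun p : E3 => p 1) h

theorem planePoint_add_normalLinePlanar (x n : E3) (hn : n 2 ≠ 0) (z : ℝ) (y : E2) :
    planePoint (y + normalLinePlanar x n z) z = normalLinePoint x n z + horizontal y := by
  ext i
  fin_cases i
  · simp [planePoint, normalLinePlanar, add_comm]
  · simp [planePoint, normalLinePlanar, add_comm]
  · simp [planePoint, normalLinePoint, hn]

end Horizontal

/-! ### The closest point mapping on the plane in polar form. -/

section PolarSurface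

variable {Ω Γ : Set E3} {ν P : E3 → E3} {φ : E3 → ℝ} {U : Set E3} {x : E3}

/-- The closest point mapping on the plane, relative to the target point. -/
noncomputable def relativeClosestPoint (P : E3 → E3) (x y₀ : E3) (y : E2) : E3 := P (y₀ + horizontal y) - x

theorem add_relativeClosestPoint (P : E3 → E3) (x y₀ : E3) (y : E2) :
    x + relativeClosestPoint P x y₀ y = P (y₀ + horizontal y) := by
  simp [relativeClosestPoint]

theorem IsDefiningOn.exists_ball (D : IsDefiningOn Ω Γ ν φ U) (hΓ : IsSmoothClosedSurface Γ Ω)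
    (hν : ∀ p ∈ Γ, IsOutwardUnitNormal Ω p (ν p)) (hP : IsClosestPointMap Γ P)
    (hxU : x ∈ U) (hx : x ∈ Γ) {t R : ℝ} (ht : |t| < R) (hR : ENNReal.ofReal R < reach Γ) :
    relativeClosestPoint P x (x + t • ν x) 0 = 0 ∧
    ∃ ρ > 0, ContDiffOn ℝ ∞ (relativeClosestPoint P x (x + t • ν x)) (Metric.ball 0 ρ) ∧
      ∀ y ∈ Metric.ball (0 : E2) ρ, P (x + t • ν x + horizontal y) ∈ U := by
  obtain ⟨-, hPx⟩ := D.contDiffAt_closestPoint hΓ.isCompact hP hxU hx ht hR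
  have hsm := contDiffOn_closestPoint hΓ hν hP hR
  have hO := isOpen_tubular Γ R
  set y₀ := x + t • ν x
  have hy₀ : y₀ ∈ {w | Metric.infDist w Γ < R} := by
    have : dist y₀ x = |t| := by
      simp [y₀, dist_eq_norm, norm_smul, D.norm_normal hxU hx]
    exact (Metric.infDist_le_dist_of_mem hx).trans_lt (by rw [this]; exact ht)
  refine ⟨by simp [relativeClosestPoint, hPx], ?_⟩
  have hT : IsOpen ({w | Metric.infDist w Γ < R} ∩ P ⁻¹' U) :=
    hsm.continuousOn.isOpen_inter_preimage hO D.isOpen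
  have hpre := hT.preimage (f := fun y : E2 => y₀ + horizontal y) (by fun_prop)
  obtain ⟨ρ, hρ, hball⟩ := Metric.isOpen_iff.1 hpre 0 (by
    simp only [mem_preimage, map_zero, add_zero]
    exact ⟨hy₀, by rw [mem_preimage, hPx]; exact hxU⟩)
  refine ⟨ρ, hρ, ?_, fun y hy => (hball hy).2⟩
  exact (hsm.comp (by fun_prop : ContDiff ℝ ∞ fun y : E2 => y₀ + horizontal y).contDiffOn
    fun y hy => (hball hy).1).sub contDiffOn_const

/-- The derivative of the closest point mapping on the plane is injective and has values in the
tangent plane. -/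
theorem IsDefiningOn.fderiv_relativeClosestPoint (D : IsDefiningOn Ω Γ ν φ U)
    (hP : IsClosestPointMap Γ P) (hxU : x ∈ U) (hn : gradient φ x 2 ≠ 0) {y₀ : E3}
    (h0 : relativeClosestPoint P x y₀ 0 = 0) {ρ : ℝ} (hρ : 0 < ρ)
    (hQ : ContDiffOn ℝ ∞ (relativeClosestPoint P x y₀) (Metric.ball 0 ρ))
    (hU : ∀ y ∈ Metric.ball (0 : E2) ρ, P (y₀ + horizontal y) ∈ U) (e : E2) :
    fderiv ℝ φ x (fderiv ℝ (relativeClosestPoint P x y₀) 0 e) = 0 ∧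
    (fderiv ℝ (relativeClosestPoint P x y₀) 0 e = 0 → e = 0) := by
  set Q := relativeClosestPoint P x y₀ with hQdef
  have hPQ : ∀ y, P (y₀ + horizontal y) = x + Q y := fun y =>
    (add_relativeClosestPoint P x y₀ y).symm
  clear_value Q
  have hQ0 : HasFDerivAt Q (fderiv ℝ Q 0) ((0 : ℝ) • e) := by
    rw [zero_smul]
    exact ((hQ.differentiableOn (by simp)).differentiableAt
      (Metric.ball_mem_nhds 0 hρ)).hasFDerivAt
  have hline : HasDerivAt (fun s : ℝ => s • e) e 0 := by
    simpa using (hasDerivAt_id (0 : ℝ)).smul_const e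
  have hQe : HasDerivAt (fun s : ℝ => Q (s • e)) (fderiv ℝ Q 0 e) 0 :=
    hQ0.comp_hasDerivAt (0 : ℝ) hline
  have hp : HasDerivAt (fun s : ℝ => x + Q (s • e)) (fderiv ℝ Q 0 e) 0 := hQe.const_add x
  have hev : ∀ᶠ s in 𝓝 (0 : ℝ), s • e ∈ Metric.ball (0 : E2) ρ := by
    refine hline.continuousAt.eventually ?_
    change ∀ᶠ y in 𝓝 ((0 : ℝ) • e), y ∈ Metric.ball (0 : E2) ρ
    rw [zero_smul]
    exact Metric.ball_mem_nhds 0 hρ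
  have hx0 : x + Q ((0 : ℝ) • e) = x := by rw [zero_smul, h0, add_zero]
  constructor
  · have h1 : HasDerivAt (fun s : ℝ => φ (x + Q (s • e))) (fderiv ℝ φ x (fderiv ℝ Q 0 e)) 0 := by
      have h2 : HasFDerivAt φ (fderiv ℝ φ x) (x + Q ((0 : ℝ) • e)) := by
        rw [hx0]; exact ((D.contDiffAt hxU).differentiableAt (by simp)).hasFDerivAt
      exact h2.comp_hasDerivAt (0 : ℝ) hp
    have h3 : (fun s : ℝ => φ (x + Q (s • e))) =ᶠ[𝓝 0] fun _ => (0 : ℝ) := by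
      filter_upwards [hev] with s hs
      rw [← hPQ]
      exact (D.mem_iff _ (hU _ hs)).1 (hP _).1
    exact h1.unique ((hasDerivAt_const (0 : ℝ) (0 : ℝ)).congr_of_eventuallyEq h3)
  · intro he
    rw [he] at hp
    have hg : HasFDerivAt (gradient φ) (fderiv ℝ (gradient φ) x) (x + Q ((0 : ℝ) • e)) := by
      rw [hx0]
      exact ((D.contDiffOn_gradient.contDiffAt (D.isOpen.mem_nhds hxU)).differentiableAt
        (by simp)).hasFDerivAt
    have hgp : HasDerivAt (fun s : ℝ => gradient φ (x + Q (s • e))) 0 0 := by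
      have := hg.comp_hasDerivAt (0 : ℝ) hp
      rwa [map_zero] at this
    have hw : HasDerivAt (fun s : ℝ => y₀ + horizontal (s • e) - (x + Q (s • e)))
        (horizontal e) 0 := by
      have h1 : HasDerivAt (fun s : ℝ => y₀ + horizontal (s • e)) (horizontal e) 0 :=
        ((horizontal.hasFDerivAt (x := (0 : ℝ) • e)).comp_hasDerivAt (0 : ℝ) hline).const_add y₀
      simpa using h1.fun_sub hp
    have hne : ‖gradient φ (x + Q ((0 : ℝ) • e))‖ ^ 2 ≠ 0 := by
      rw [hx0]
      exact pow_ne_zero 2 (norm_ne_zero_iff.2 (D.gradient_ne x hxU))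
    -- Differentiate w - P(w) = σ ∇φ(P(w)) along s e. When P is stationary to first order, so is
    -- ∇φ(P), and only σ'(0) ∇φ(x) remains: the horizontal vector of e is then a multiple of the
    -- normal.
    have hσ := ((hw.inner ℝ hgp).div hgp.norm_sq hne).smul hgp
    have h5 := hw.unique (hσ.congr_of_eventuallyEq (by
      filter_upwards [hev] with s hs
      have := D.sub_eq_smul_gradient (hU _ hs) (hP _)
      rw [hPQ] at this
      exact this))
    rw [smul_zero, zero_add, hx0] at h5
    exact horizontal_eq_zero_of_eq_smul hn h5

/-- Polar representation of the closest point mapping on the plane, and of the numerators of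
the double-layer kernel and its conjugate. -/
theorem exists_polar_representation (hΓ : IsSmoothClosedSurface Γ Ω)
    (hν : ∀ p ∈ Γ, IsOutwardUnitNormal Ω p (ν p)) (hP : IsClosestPointMap Γ P) (hx : x ∈ Γ)
    (hn : ν x 2 ≠ 0) {t₀ R : ℝ} (ht : |t₀| < R) (hR : ENNReal.ofReal R < reach Γ) :
    ∃ r > 0, ∃ N : Set E2, IsOpen N ∧ Metric.sphere (0 : E2) 1 ⊆ N ∧
      ∃ (w : ℝ × E2 → E3) (b b' : ℝ × E2 → ℝ), ContDiffOn ℝ ∞ w (Ioo (-r) r ×ˢ N) ∧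
        ContDiffOn ℝ ∞ b (Ioo (-r) r ×ˢ N) ∧ ContDiffOn ℝ ∞ b' (Ioo (-r) r ×ˢ N) ∧
        ∀ p ∈ Ioo (-r) r ×ˢ N, w p ≠ 0 ∧
          relativeClosestPoint P x (x + t₀ • ν x) (p.1 • p.2) = p.1 • w p ∧
          -⟪relativeClosestPoint P x (x + t₀ • ν x) (p.1 • p.2),
            ν (P (x + t₀ • ν x + horizontal (p.1 • p.2)))⟫ = p.1 ^ 2 * b p ∧
          ⟪relativeClosestPoint P x (x + t₀ • ν x) (p.1 • p.2), ν x⟫ = p.1 ^ 2 * b' p := by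
  obtain ⟨φ, U, hxU, D⟩ := hΓ.exists_isDefiningOn hν hx
  obtain ⟨h0, ρ, hρ, hQ, hU⟩ := D.exists_ball hΓ hν hP hxU hx ht hR
  set y₀ := x + t₀ • ν x
  have hνx := D.normal_eq x hxU hx
  have hn' : gradient φ x 2 ≠ 0 := by
    intro h
    rw [hνx, PiLp.smul_apply, h, smul_zero] at hn
    exact hn rfl
  have hder := D.fderiv_relativeClosestPoint hP hxU hn' h0 hρ hQ hU
  have hPQ : ∀ y, P (y₀ + horizontal y) = x + relativeClosestPoint P x y₀ y := fun y =>
    (add_relativeClosestPoint P x y₀ y).symm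
  set Q := relativeClosestPoint P x y₀ with hQdef
  -- Since Q(0) = 0 and Q'(0) is tangential, the inner product of Q with the normal, taken either at
  -- the closest point or at x, vanishes together with its derivative.
  have htan : ∀ e, ⟪fderiv ℝ Q 0 e, ν x⟫ = 0 := by
    intro e
    rw [hνx, real_inner_comm, real_inner_smul_left, inner_gradient_eq_fderiv, (hder e).1, mul_zero]
  have hQd : DifferentiableAt ℝ Q 0 :=
    (hQ.differentiableOn (by simp)).differentiableAt (Metric.ball_mem_nhds 0 hρ)
  obtain ⟨w, hw, hQw, hw0⟩ := exists_polar_factor hρ hQ h0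
  have hgrad : ContDiffOn ℝ ∞ (fun y => gradient φ (x + Q y)) (Metric.ball 0 ρ) :=
    D.contDiffOn_gradient.comp (contDiffOn_const.add hQ) fun y hy => hPQ y ▸ hU y hy
  have hgne : ∀ y ∈ Metric.ball (0 : E2) ρ, gradient φ (x + Q y) ≠ 0 := fun y hy =>
    D.gradient_ne _ (hPQ y ▸ hU y hy)
  have hm : ContDiffOn ℝ ∞ (fun y => ‖gradient φ (x + Q y)‖⁻¹ • gradient φ (x + Q y))
      (Metric.ball 0 ρ) :=
    ((hgrad.norm ℝ hgne).inv fun y hy => norm_ne_zero_iff.2 (hgne y hy)).smul hgrad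
  have hmd : DifferentiableAt ℝ (fun y => ‖gradient φ (x + Q y)‖⁻¹ • gradient φ (x + Q y)) 0 :=
    (hm.differentiableOn (by simp)).differentiableAt (Metric.ball_mem_nhds 0 hρ)
  obtain ⟨b, hb, hQb⟩ := exists_polar_factor_sq hρ (F := fun y =>
    -⟪Q y, ‖gradient φ (x + Q y)‖⁻¹ • gradient φ (x + Q y)⟫) (hQ.inner ℝ hm).neg
    (by rw [h0, inner_zero_left, neg_zero]) (by
      ext e
      rw [fderiv_fun_neg, neg_apply, fderiv_inner_apply ℝ hQd hmd, h0, add_zero, ← hνx, htan,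
        inner_zero_left, add_zero, neg_zero, zero_apply])
  obtain ⟨b', hb', hQb'⟩ := exists_polar_factor_sq hρ (F := fun y => ⟪Q y, ν x⟫)
    (hQ.inner ℝ contDiffOn_const) (by rw [h0, inner_zero_left]) (by
      ext e
      rw [fderiv_inner_apply ℝ hQd (differentiableAt_const _), htan]
      simp)
  have hopen : IsOpen (polarDomain ρ ∩ w ⁻¹' {0}ᶜ) :=
    hw.continuousOn.isOpen_inter_preimage (isOpen_polarDomain ρ) isOpen_compl_singleton
  -- w(0, u) = Q'(0)u is nonzero on the unit circle by injectivity, and by compactness w stays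
  -- nonzero on a box around it.
  obtain ⟨r, hr, N, hN, hsN, hsub⟩ := exists_box_of_isOpen hopen fun u hu =>
    ⟨zero_mem_polarDomain hρ u, fun h => by
      rw [mem_singleton_iff, hw0] at h
      rw [(hder u).2 h] at hu
      simp at hu⟩
  have hsub' : Ioo (-r) r ×ˢ N ⊆ polarDomain ρ := hsub.trans inter_subset_left
  refine ⟨r, hr, N, hN, hsN, w, b, b', hw.mono hsub', hb.mono hsub', hb'.mono hsub',
    fun p hp => ⟨(hsub hp).2, hQw p (hsub' hp), ?_, hQb' p (hsub' hp)⟩⟩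
  have hpb : p.1 • p.2 ∈ Metric.ball (0 : E2) ρ := mem_ball_zero_iff.2 (hsub' hp)
  rw [D.normal_eq _ (hU _ hpb) (hP _).1, hPQ]
  exact hQb p (hsub' hp)

end PolarSurface

/-! ### Taylor expansion of the graph function. -/

section GraphTaylor

theorem eq_smul_single_add (v : E2) :
    v = v 0 • EuclideanSpace.single 0 (1 : ℝ) + v 1 • EuclideanSpace.single 1 1 := by
  ext i
  fin_cases i <;> simp

variable {f : E2 → ℝ}

theorem contDiffAt_fderiv_top {E F : Type*} [NormedAddCommGroup E] [NormedSpace ℝ E]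
    [NormedAddCommGroup F] [NormedSpace ℝ F] {f : E → F} {x : E} (hf : ContDiffAt ℝ ∞ f x) :
    ContDiffAt ℝ ∞ (fderiv ℝ f) x :=
  hf.fderiv_right (m := ∞) (by simp)

theorem iteratedFDeriv_three_apply {E F : Type*} [NormedAddCommGroup E] [NormedSpace ℝ E]
    [NormedAddCommGroup F] [NormedSpace ℝ F] (f : E → F) (x : E) (m : Fin 3 → E) :
    iteratedFDeriv ℝ 3 f x m = fderiv ℝ (fderiv ℝ (fderiv ℝ f)) x (m 0) (m 1) (m 2) := by
  rw [iteratedFDeriv_succ_apply_right, iteratedFDeriv_two_apply]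
  rfl

theorem fderiv_three_swap_left (hf : ContDiffAt ℝ ∞ f 0) (a b c : E2) :
    fderiv ℝ (fderiv ℝ (fderiv ℝ f)) 0 a b c = fderiv ℝ (fderiv ℝ (fderiv ℝ f)) 0 b a c := by
  have h := (contDiffAt_infty.1 (contDiffAt_fderiv_top hf) 2).isSymmSndFDerivAt (by simp)
  exact congrArg (fun L : E2 →L[ℝ] ℝ => L c) (h a b)

/-- Symmetry of the second derivative holds throughout a neighbourhood, so it may be differentiated
once more. Together with the swap of the first two arguments it generates all permutations. -/
theorem fderiv_three_swap_right (hf : ContDiffAt ℝ ∞ f 0) (a b c : E2) :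
    fderiv ℝ (fderiv ℝ (fderiv ℝ f)) 0 a b c = fderiv ℝ (fderiv ℝ (fderiv ℝ f)) 0 a c b := by
  have hd : DifferentiableAt ℝ (fderiv ℝ (fderiv ℝ f)) 0 :=
    (contDiffAt_fderiv_top (contDiffAt_fderiv_top hf)).differentiableAt (by simp)
  have happ : ∀ b c : E2, fderiv ℝ (fun v => fderiv ℝ (fderiv ℝ f) v b c) 0 a =
      fderiv ℝ (fderiv ℝ (fderiv ℝ f)) 0 a b c := by
    intro b c
    have h1 : DifferentiableAt ℝ (fun v => fderiv ℝ (fderiv ℝ f) v b) 0 :=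
      hd.clm_apply (differentiableAt_const _)
    rw [fderiv_clm_apply h1 (differentiableAt_const _),
      fderiv_clm_apply hd (differentiableAt_const _)]
    simp
  rw [← happ, ← happ]
  have hev : (fun v => fderiv ℝ (fderiv ℝ f) v b c) =ᶠ[𝓝 0]
      fun v => fderiv ℝ (fderiv ℝ f) v c b := by
    have h2 : ∀ᶠ v in 𝓝 (0 : E2), ContDiffAt ℝ 2 f v :=
      (contDiffAt_infty.1 hf 2).eventually (by simp)
    filter_upwards [h2] with v hv
    exact hv.isSymmSndFDerivAt (by simp) b c
  rw [hev.fderiv_eq]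

/-- The third order Taylor expansion of the graph function and the second order one of its
gradient, in terms of the cubic form `B` and its gradient `C`. -/
theorem graph_taylor (hf : ContDiffAt ℝ ∞ f 0) (h0 : f 0 = 0) (h1 : fderiv ℝ f 0 = 0)
    {κ : Fin 2 → ℝ} (h2 : ∀ i j, fderiv ℝ (fderiv ℝ f) 0 (EuclideanSpace.single i 1)
      (EuclideanSpace.single j 1) = if i = j then κ i else 0)
    {g : LocalData} (hxxx : g.fxxx = thirdPartial f 0 0 0) (hxxy : g.fxxy = thirdPartial f 0 0 1)
    (hxyy : g.fxyy = thirdPartial f 0 1 1) (hyyy : g.fyyy = thirdPartial f 1 1 1) :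
    (fun v : E2 => f v - (1 / 2 * (κ 0 * v 0 ^ 2 + κ 1 * v 1 ^ 2) + g.B v.ofLp)) =O[𝓝 0]
      (fun v => ‖v‖ ^ 4) ∧
    ∀ j, (fun v : E2 => fderiv ℝ f v (EuclideanSpace.single j 1) -
      (κ j * v j + g.C v.ofLp j)) =O[𝓝 0] fun v => ‖v‖ ^ 3 := by
  set D := fderiv ℝ (fderiv ℝ (fderiv ℝ f)) 0 with hD
  set e₀ : E2 := EuclideanSpace.single 0 1 with he₀
  set e₁ : E2 := EuclideanSpace.single 1 1 with he₁
  have hthird : ∀ i j k, thirdPartial f i j k = D (EuclideanSpace.single i 1)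
      (EuclideanSpace.single j 1) (EuclideanSpace.single k 1) := by
    intro i j k
    rw [thirdPartial, iteratedFDeriv_three_apply]
    rfl
  rw [hthird] at hxxx hxxy hxyy hyyy
  rw [← he₀] at hxxx hxxy hxyy
  rw [← he₁] at hxxy hxyy hyyy
  have s1 : D e₀ e₁ e₀ = g.fxxy := by rw [hxxy]; exact fderiv_three_swap_right hf _ _ _
  have s2 : D e₁ e₀ e₀ = g.fxxy := by rw [← s1]; exact fderiv_three_swap_left hf _ _ _
  have s3 : D e₁ e₀ e₁ = g.fxyy := by rw [hxyy]; exact fderiv_three_swap_left hf _ _ _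
  have s4 : D e₁ e₁ e₀ = g.fxyy := by rw [← s3]; exact fderiv_three_swap_right hf _ _ _
  have q00 : fderiv ℝ (fderiv ℝ f) 0 e₀ e₀ = κ 0 := by simpa using h2 0 0
  have q01 : fderiv ℝ (fderiv ℝ f) 0 e₀ e₁ = 0 := by simpa using h2 0 1
  have q10 : fderiv ℝ (fderiv ℝ f) 0 e₁ e₀ = 0 := by simpa using h2 1 0
  have q11 : fderiv ℝ (fderiv ℝ f) 0 e₁ e₁ = κ 1 := by simpa using h2 1 1
  constructor
  · have h3 := (contDiffAt_infty.1 hf (3 + 1)).sub_taylor_isBigO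
    refine h3.congr_left fun v => ?_
    have hv := eq_smul_single_add v
    rw [← he₀, ← he₁] at hv
    have e1 : fderiv ℝ (fderiv ℝ f) 0 v v = κ 0 * v 0 ^ 2 + κ 1 * v 1 ^ 2 := by
      conv_lhs => rw [hv]
      simp only [map_add, map_smul, add_apply, smul_apply, smul_eq_mul, q00, q01, q10, q11]
      ring
    have e2 : D v v v = 6 * g.B v.ofLp := by
      conv_lhs => rw [hv]
      simp only [map_add, map_smul, add_apply, smul_apply, smul_eq_mul, s1, s2, s3, s4, ← hxxx,
        ← hxxy, ← hxyy, ← hyyy, LocalData.B]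
      ring
    simp only [Finset.sum_range_succ, Finset.range_zero, Finset.sum_empty,
      iteratedFDeriv_zero_apply, iteratedFDeriv_one_apply, iteratedFDeriv_two_apply,
      iteratedFDeriv_three_apply, h0, h1, zero_add, zero_apply, ← hD, e1, e2, smul_eq_mul,
      Nat.factorial]
    push_cast
    ring
  · intro j
    have h3 := (contDiffAt_infty.1 (contDiffAt_fderiv_top hf) (2 + 1)).sub_taylor_isBigO
    have h4 := ((ContinuousLinearMap.apply ℝ ℝ (EuclideanSpace.single j (1 : ℝ) : E2)).isBigO_comp
      (fun y => fderiv ℝ f (0 + y) - ∑ k ∈ Finset.range (2 + 1),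
      (k.factorial : ℝ)⁻¹ • iteratedFDeriv ℝ k (fderiv ℝ f) 0 (fun _ => y)) (𝓝 0)).trans h3
    refine h4.congr_left fun v => ?_
    have hv := eq_smul_single_add v
    rw [← he₀, ← he₁] at hv
    have e1 : fderiv ℝ (fderiv ℝ f) 0 v (EuclideanSpace.single j 1) = κ j * v j := by
      conv_lhs => rw [hv]
      fin_cases j
      · simp [← he₀, q00, q10, mul_comm]
      · simp [← he₁, q01, q11, mul_comm]
    have e2 : D v v (EuclideanSpace.single j 1) = 2 * g.C v.ofLp j := by
      conv_lhs => rw [hv]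
      fin_cases j
      · simp only [Fin.zero_eta, ← he₀, map_add, map_smul, add_apply, smul_apply, smul_eq_mul, s1,
          s2, s4, ← hxxx, LocalData.C, Pi.smul_apply, Matrix.cons_val_zero]
        ring
      · simp only [Fin.mk_one, ← he₁, map_add, map_smul, add_apply, smul_apply, smul_eq_mul, s3,
          ← hxxy, ← hxyy, ← hyyy, LocalData.C, Pi.smul_apply, Matrix.cons_val_one,
          Matrix.cons_val_zero]
        ring
    simp only [Finset.sum_range_succ, Finset.range_zero, Finset.sum_empty,
      iteratedFDeriv_zero_apply, iteratedFDeriv_one_apply, iteratedFDeriv_two_apply,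
      h1, zero_add, ← hD, smul_eq_mul, Nat.factorial, ContinuousLinearMap.apply_apply,
      sub_apply, add_apply, smul_apply, e1, e2, smul_zero]
    push_cast
    ring

end GraphTaylor

/-! ### Comparison of coefficients. -/

section Coefficients

/-- Reads off the constant and linear coefficients from a mere derivative at 0, so no second
derivative of the curve of closest points is needed. -/
theorem eq_zero_of_hasDerivAt_of_isBigO_sq {g : ℝ → ℝ} {g' : ℝ} (hg : HasDerivAt g g' 0)
    (hO : g =O[𝓝[≠] 0] fun t => t ^ 2) : g 0 = 0 ∧ g' = 0 := by
  have h1 : Tendsto (fun t : ℝ => t ^ 2) (𝓝[≠] 0) (𝓝 0) := by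
    have : Tendsto (fun t : ℝ => t ^ 2) (𝓝 0) (𝓝 (0 ^ 2)) :=
      (by fun_prop : Continuous fun t : ℝ => t ^ 2).tendsto 0
    rw [zero_pow two_ne_zero] at this
    exact this.mono_left nhdsWithin_le_nhds
  have h2 : g 0 = 0 := tendsto_nhds_unique (hg.continuousAt.tendsto.mono_left nhdsWithin_le_nhds)
    (hO.trans_tendsto h1)
  refine ⟨h2, tendsto_nhds_unique (hasDerivAt_iff_tendsto_slope.1 hg) ?_⟩
  have h3 : slope g 0 = fun t => g t / t := by
    funext t; simp [slope_def_field, h2]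
  rw [h3]
  have h4 : (fun t : ℝ => t ^ 2) =o[𝓝[≠] 0] fun t => t := by
    simpa using (isLittleO_pow_pow (m := 1) (n := 2) (by norm_num)).mono
      (nhdsWithin_le_nhds (a := (0 : ℝ)) (s := {0}ᶜ))
  exact (hO.trans_isLittleO h4).tendsto_div_nhds_zero

theorem IsBigO.of_pow_mul {g : ℝ → ℝ} {k m : ℕ}
    (h : (fun t => t ^ k * g t) =O[𝓝[≠] 0] fun t : ℝ => t ^ (k + m)) :
    g =O[𝓝[≠] 0] fun t => t ^ m := by
  have h1 := (isBigO_refl (fun t : ℝ => (t ^ k)⁻¹) (𝓝[≠] 0)).mul h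
  refine h1.congr' ?_ ?_
  · filter_upwards [self_mem_nhdsWithin] with t (ht : t ≠ 0)
    field_simp
  · filter_upwards [self_mem_nhdsWithin] with t (ht : t ≠ 0)
    rw [pow_add]
    field_simp

end Coefficients

/-! ### Expansion of the graph function along curves t ↦ t ζ(t). -/

section CurveExpansion

variable {f : E2 → ℝ} {κ : Fin 2 → ℝ} {g : LocalData} {ζ : ℝ → E2} {ζ' : E2}

theorem hasDerivAt_coord (hz : HasDerivAt ζ ζ' 0) (j : Fin 2) :
    HasDerivAt (fun t => ζ t j) (ζ' j) 0 :=
  (EuclideanSpace.proj j : E2 →L[ℝ] ℝ).hasFDerivAt.comp_hasDerivAt (0 : ℝ) hz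

/-- Because of the factor t, only ζ(0) enters: the first variation of ζ affects the cubic term one
order later. -/
theorem hasDerivAt_mul_B (hz : HasDerivAt ζ ζ' 0) :
    HasDerivAt (fun t => t * g.B (ζ t).ofLp) (g.B (ζ 0).ofLp) 0 := by
  have h0 := (hasDerivAt_coord hz 0).differentiableAt
  have h1 := (hasDerivAt_coord hz 1).differentiableAt
  refine hasDerivAt_smul_zero ?_
  unfold LocalData.B
  fun_prop

theorem hasDerivAt_mul_C (hz : HasDerivAt ζ ζ' 0) (j : Fin 2) :
    HasDerivAt (fun t => t * g.C (ζ t).ofLp j) (g.C (ζ 0).ofLp j) 0 := by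
  have h0 := (hasDerivAt_coord hz 0).differentiableAt
  have h1 := (hasDerivAt_coord hz 1).differentiableAt
  refine hasDerivAt_smul_zero ?_
  unfold LocalData.C
  fin_cases j
  · simp only [Fin.zero_eta, Pi.smul_apply, Matrix.cons_val_zero]
    fun_prop
  · simp only [Fin.mk_one, Pi.smul_apply, Matrix.cons_val_one, Matrix.cons_val_zero]
    fun_prop

theorem hasDerivAt_half_quadratic (hz : HasDerivAt ζ ζ' 0) :
    HasDerivAt (fun t => 1 / 2 * (κ 0 * ζ t 0 ^ 2 + κ 1 * ζ t 1 ^ 2))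
      (κ 0 * ζ 0 0 * ζ' 0 + κ 1 * ζ 0 1 * ζ' 1) 0 := by
  have h0 := ((hasDerivAt_coord hz 0).fun_pow 2).const_mul (κ 0)
  have h1 := ((hasDerivAt_coord hz 1).fun_pow 2).const_mul (κ 1)
  refine ((h0.fun_add h1).const_mul (1 / 2)).congr_deriv ?_
  push_cast
  ring

theorem isBigO_one_of_hasDerivAt {h : ℝ → ℝ} {h' : ℝ} (hh : HasDerivAt h h' 0) :
    h =O[𝓝[≠] 0] fun _ => (1 : ℝ) :=
  (hh.continuousAt.tendsto.isBigO_one ℝ).mono nhdsWithin_le_nhds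

theorem isBigO_norm_smul_pow (hz : HasDerivAt ζ ζ' 0) (k : ℕ) :
    (fun t : ℝ => ‖t • ζ t‖ ^ k) =O[𝓝[≠] 0] fun t => t ^ k := by
  have h1 : ζ =O[𝓝[≠] 0] fun _ => (1 : ℝ) :=
    (hz.continuousAt.tendsto.isBigO_one ℝ).mono nhdsWithin_le_nhds
  simpa using ((isBigO_refl (fun s : ℝ => s) (𝓝[≠] 0)).smul h1).norm_left.pow k

theorem tendsto_smul_zero (hz : HasDerivAt ζ ζ' 0) :
    Tendsto (fun t : ℝ => t • ζ t) (𝓝[≠] 0) (𝓝 0) := by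
  have := (hasDerivAt_smul_zero hz.differentiableAt).continuousAt.tendsto
  rw [zero_smul] at this
  exact this.mono_left nhdsWithin_le_nhds

theorem B_smul (t : ℝ) (v : E2) : g.B (t • v).ofLp = t ^ 3 * g.B v.ofLp := by
  simp only [LocalData.B, PiLp.smul_apply, smul_eq_mul]
  ring

theorem C_smul (t : ℝ) (v : E2) (j : Fin 2) : g.C (t • v).ofLp j = t ^ 2 * g.C v.ofLp j := by
  fin_cases j <;>
  · simp [LocalData.C]
    ring

/-- Euler's identity for the cubic form. -/
theorem C_inner (v : Fin 2 → ℝ) : g.C v 0 * v 0 + g.C v 1 * v 1 = 3 * g.B v := by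
  simp only [LocalData.B, LocalData.C, Pi.smul_apply, Matrix.cons_val_zero, Matrix.cons_val_one,
    smul_eq_mul]
  ring

/-- The conclusion of `graph_taylor`. -/
structure HasGraphTaylor (f : E2 → ℝ) (κ : Fin 2 → ℝ) (g : LocalData) : Prop where
  fn : (fun v : E2 => f v - (1 / 2 * (κ 0 * v 0 ^ 2 + κ 1 * v 1 ^ 2) + g.B v.ofLp)) =O[𝓝 0]
      (fun v => ‖v‖ ^ 4)
  grad : ∀ j, (fun v : E2 => fderiv ℝ f v (EuclideanSpace.single j 1) -
      (κ j * v j + g.C v.ofLp j)) =O[𝓝 0] fun v => ‖v‖ ^ 3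

namespace HasGraphTaylor

theorem fn_curve (H : HasGraphTaylor f κ g) (hz : HasDerivAt ζ ζ' 0) :
    (fun t => f (t • ζ t) - t ^ 2 * (1 / 2 * (κ 0 * ζ t 0 ^ 2 + κ 1 * ζ t 1 ^ 2) +
      t * g.B (ζ t).ofLp)) =O[𝓝[≠] 0] fun t : ℝ => t ^ 4 := by
  refine ((H.fn.comp_tendsto (tendsto_smul_zero hz)).trans
    (isBigO_norm_smul_pow hz 4)).congr_left fun t => ?_
  simp only [Function.comp_apply, B_smul, PiLp.smul_apply, smul_eq_mul]
  ring

theorem grad_curve (H : HasGraphTaylor f κ g) (hz : HasDerivAt ζ ζ' 0) (j : Fin 2) :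
    (fun t => fderiv ℝ f (t • ζ t) (EuclideanSpace.single j 1) -
      t * (κ j * ζ t j + t * g.C (ζ t).ofLp j)) =O[𝓝[≠] 0] fun t : ℝ => t ^ 3 := by
  refine (((H.grad j).comp_tendsto (tendsto_smul_zero hz)).trans
    (isBigO_norm_smul_pow hz 3)).congr_left fun t => ?_
  simp only [Function.comp_apply, C_smul, PiLp.smul_apply, smul_eq_mul]
  ring

theorem pow_isBigO_pow {m k : ℕ} (h : m ≤ k) :
    (fun t : ℝ => t ^ k) =O[𝓝[≠] 0] fun t => t ^ m := by
  obtain ⟨l, rfl⟩ := Nat.exists_eq_add_of_le h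
  have h1 : (fun t : ℝ => t ^ l) =O[𝓝[≠] 0] fun _ => (1 : ℝ) :=
    (((continuous_pow l).tendsto (0 : ℝ)).isBigO_one ℝ).mono nhdsWithin_le_nhds
  simpa [pow_add] using (isBigO_refl (fun t : ℝ => t ^ m) (𝓝[≠] 0)).mul h1

theorem fn_isBigO (H : HasGraphTaylor f κ g) (hz : HasDerivAt ζ ζ' 0) :
    (fun t => f (t • ζ t)) =O[𝓝[≠] 0] fun t : ℝ => t ^ 2 := by
  have h1 := (H.fn_curve hz).trans (pow_isBigO_pow (m := 2) (by norm_num))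
  have h2 := (isBigO_refl (fun t : ℝ => t ^ 2) (𝓝[≠] 0)).mul
    (isBigO_one_of_hasDerivAt ((hasDerivAt_half_quadratic (κ := κ) hz).fun_add
      (hasDerivAt_mul_B (g := g) hz)))
  exact (h1.add (h2.congr_right fun t => mul_one _)).congr_left fun t => by ring

theorem hasDerivAt_grad_factor (hz : HasDerivAt ζ ζ' 0) (j : Fin 2) :
    HasDerivAt (fun t => κ j * ζ t j + t * g.C (ζ t).ofLp j)
      (κ j * ζ' j + g.C (ζ 0).ofLp j) 0 :=
  ((hasDerivAt_coord hz j).const_mul (κ j)).fun_add (hasDerivAt_mul_C hz j)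

theorem grad_isBigO (H : HasGraphTaylor f κ g) (hz : HasDerivAt ζ ζ' 0) (j : Fin 2) :
    (fun t => fderiv ℝ f (t • ζ t) (EuclideanSpace.single j 1)) =O[𝓝[≠] 0] fun t : ℝ => t := by
  have h1 := (H.grad_curve hz j).trans (pow_isBigO_pow (m := 1) (by norm_num))
  have h2 := (isBigO_refl (fun t : ℝ => t) (𝓝[≠] 0)).mul
    (isBigO_one_of_hasDerivAt (hasDerivAt_grad_factor (κ := κ) (g := g) hz j))
  simp only [pow_one] at h1
  exact (h1.add (h2.congr_right fun t => mul_one _)).congr_left fun t => by ring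

/-- The first two coefficients of a curve of closest points. -/
theorem curve_coefficients (H : HasGraphTaylor f κ g) (hz : HasDerivAt ζ ζ' 0) {a η δ : ℝ}
    {j : Fin 2} (hfoc : ∀ᶠ t in 𝓝[≠] (0 : ℝ), t * ζ t j - t * a +
      (f (t • ζ t) - (η + t * δ)) * fderiv ℝ f (t • ζ t) (EuclideanSpace.single j 1) = 0) :
    (1 - η * κ j) * ζ 0 j = a ∧
      (1 - η * κ j) * ζ' j = η * g.C (ζ 0).ofLp j + δ * κ j * ζ 0 j := by
  -- The orthogonality equation divided by t, with ∂ⱼf replaced by its expansion and the product f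
  -- ∂ⱼf omitted. That product is O(t³) and the error of ∂ⱼf is O(t³), so E = O(t²) and its value
  -- and derivative at 0 vanish.
  let E : ℝ → ℝ := fun t => (ζ t j - a) - (η + t * δ) * (κ j * ζ t j + t * g.C (ζ t).ofLp j)
  have hlin : HasDerivAt (fun t : ℝ => η + t * δ) δ 0 := by
    simpa using ((hasDerivAt_id' (0 : ℝ)).mul_const δ).const_add η
  have hE := ((hasDerivAt_coord hz j).sub_const a).fun_sub
    (hlin.fun_mul (hasDerivAt_grad_factor (κ := κ) (g := g) hz j))
  have h1 : (fun t => t ^ 1 * E t) =O[𝓝[≠] 0] fun t : ℝ => t ^ (1 + 2) := by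
    have h2 := (H.fn_isBigO hz).mul (H.grad_isBigO hz j)
    have h3 := (isBigO_one_of_hasDerivAt hlin).mul (H.grad_curve hz j)
    have h4 : (fun t : ℝ => t ^ 2 * t) = fun t => t ^ (1 + 2) := by funext t; ring
    have h5 : (fun t : ℝ => 1 * t ^ 3) = fun t => t ^ (1 + 2) := by funext t; ring
    rw [h4] at h2
    rw [h5] at h3
    refine (h3.sub h2).congr' ?_ EventuallyEq.rfl
    filter_upwards [hfoc] with t ht
    simp only [E]
    linear_combination -ht
  obtain ⟨h6, h7⟩ := eq_zero_of_hasDerivAt_of_isBigO_sq hE (IsBigO.of_pow_mul h1)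
  simp only [zero_mul, add_zero] at h6 h7
  exact ⟨by linarith, by linarith⟩

theorem height_coefficients (H : HasGraphTaylor f κ g) (hz : HasDerivAt ζ ζ' 0) {b : ℝ → ℝ}
    {b' : ℝ} (hb : HasDerivAt b b' 0) (hfb : ∀ᶠ t in 𝓝[≠] (0 : ℝ), f (t • ζ t) = t ^ 2 * b t) :
    b 0 = 1 / 2 * (κ 0 * ζ 0 0 ^ 2 + κ 1 * ζ 0 1 ^ 2) ∧
      b' = κ 0 * ζ 0 0 * ζ' 0 + κ 1 * ζ 0 1 * ζ' 1 + g.B (ζ 0).ofLp := by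
  have hE := hb.fun_sub ((hasDerivAt_half_quadratic (κ := κ) hz).fun_add
    (hasDerivAt_mul_B (g := g) hz))
  obtain ⟨h6, h7⟩ := eq_zero_of_hasDerivAt_of_isBigO_sq hE (IsBigO.of_pow_mul (k := 2)
    ((H.fn_curve hz).congr' (by filter_upwards [hfb] with t ht; rw [ht]; ring) EventuallyEq.rfl))
  simp only [zero_mul, add_zero] at h6 h7
  exact ⟨by linarith, by linarith⟩

theorem normal_coefficients (H : HasGraphTaylor f κ g) (hz : HasDerivAt ζ ζ' 0) {b c : ℝ → ℝ}
    {b' : ℝ} (hb : HasDerivAt b b' 0)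
    (hc : ∀ᶠ t in 𝓝[≠] (0 : ℝ), 0 < c t ∧ c t ^ 2 *
      (1 + fderiv ℝ f (t • ζ t) (EuclideanSpace.single 0 1) ^ 2 +
        fderiv ℝ f (t • ζ t) (EuclideanSpace.single 1 1) ^ 2) = 1)
    (hfb : ∀ᶠ t in 𝓝[≠] (0 : ℝ), c t *
      (t * ζ t 0 * fderiv ℝ f (t • ζ t) (EuclideanSpace.single 0 1) +
        t * ζ t 1 * fderiv ℝ f (t • ζ t) (EuclideanSpace.single 1 1) - f (t • ζ t)) =
      t ^ 2 * b t) :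
    b 0 = 1 / 2 * (κ 0 * ζ 0 0 ^ 2 + κ 1 * ζ 0 1 ^ 2) ∧
      b' = κ 0 * ζ 0 0 * ζ' 0 + κ 1 * ζ 0 1 * ζ' 1 + 2 * g.B (ζ 0).ofLp := by
  set F : Fin 2 → ℝ → ℝ := fun j t => fderiv ℝ f (t • ζ t) (EuclideanSpace.single j 1) with hF
  -- The third component of the unit normal is (1 + |∇f|²)^(-1/2) = 1 + O(t²). It multiplies a
  -- quantity of order t², hence does not affect the first two coefficients.
  have hc1 : (fun t => c t - 1) =O[𝓝[≠] 0] fun t : ℝ => t ^ 2 := by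
    have h1 : (fun t => c t - 1) =O[𝓝[≠] 0] fun t => F 0 t ^ 2 + F 1 t ^ 2 := by
      refine IsBigO.of_bound 1 ?_
      filter_upwards [hc] with t ht
      obtain ⟨h0, h1⟩ := ht
      have hs : 0 ≤ F 0 t ^ 2 + F 1 t ^ 2 := by positivity
      have h2 : c t ^ 2 + c t ^ 2 * (F 0 t ^ 2 + F 1 t ^ 2) = 1 := by
        rw [← h1]; ring
      have h3 : c t ^ 2 ≤ 1 := by nlinarith [mul_nonneg (sq_nonneg (c t)) hs]
      have h4 : c t ≤ 1 := by nlinarith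
      rw [one_mul, Real.norm_of_nonneg hs, Real.norm_of_nonpos (by linarith)]
      nlinarith
    refine h1.trans ?_
    exact ((H.grad_isBigO hz 0).pow 2).add ((H.grad_isBigO hz 1).pow 2)
  -- For v = tζ, v·∇f - f has quadratic part κv² - ½κv² = ½κv² and cubic part 3B - B = 2B by Euler's
  -- identity. This is where the double-layer coefficient departs from that of its conjugate.
  let K : ℝ → ℝ := fun t => 1 / 2 * (κ 0 * ζ t 0 ^ 2 + κ 1 * ζ t 1 ^ 2) +
    2 * (t * g.B (ζ t).ofLp)
  let X : ℝ → ℝ := fun t => t * ζ t 0 * F 0 t + t * ζ t 1 * F 1 t - f (t • ζ t)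
  have hK : HasDerivAt K (κ 0 * ζ 0 0 * ζ' 0 + κ 1 * ζ 0 1 * ζ' 1 + 2 * g.B (ζ 0).ofLp) 0 :=
    (hasDerivAt_half_quadratic hz).fun_add ((hasDerivAt_mul_B hz).const_mul 2)
  have hX : (fun t => X t - t ^ 2 * K t) =O[𝓝[≠] 0] fun t : ℝ => t ^ 4 := by
    have h1 : ∀ j, (fun t => t * ζ t j * (F j t - t * (κ j * ζ t j + t * g.C (ζ t).ofLp j)))
        =O[𝓝[≠] 0] fun t : ℝ => t ^ 4 := by
      intro j
      have := ((isBigO_refl (fun t : ℝ => t) (𝓝[≠] 0)).mul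
        (isBigO_one_of_hasDerivAt (hasDerivAt_coord hz j))).mul (H.grad_curve hz j)
      refine this.congr_right fun t => by ring
    refine (((h1 0).add (h1 1)).sub (H.fn_curve hz)).congr_left fun t => ?_
    have := C_inner (g := g) (ζ t).ofLp
    simp only [X, K]
    linear_combination -t ^ 3 * this
  have hX2 : X =O[𝓝[≠] 0] fun t : ℝ => t ^ 2 := by
    have h1 := (isBigO_refl (fun t : ℝ => t ^ 2) (𝓝[≠] 0)).mul (isBigO_one_of_hasDerivAt hK)
    exact ((hX.trans (pow_isBigO_pow (m := 2) (by norm_num))).add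
      (h1.congr_right fun t => mul_one _)).congr_left fun t => by ring
  have hO : (fun t => t ^ 2 * (b t - K t)) =O[𝓝[≠] 0] fun t : ℝ => t ^ (2 + 2) := by
    have h1 := (hc1.mul hX2).congr_right (g₂ := fun t : ℝ => t ^ 4) fun t => by ring
    refine (h1.add hX).congr' ?_ EventuallyEq.rfl
    filter_upwards [hfb] with t ht
    simp only [X]
    linear_combination ht
  obtain ⟨h6, h7⟩ := eq_zero_of_hasDerivAt_of_isBigO_sq (hb.fun_sub hK) (IsBigO.of_pow_mul hO)
  simp only [K, zero_mul, mul_zero, add_zero] at h6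
  exact ⟨by linarith, by linarith⟩

end HasGraphTaylor

end CurveExpansion

/-! ### The principal frame and the surface as a graph. -/

section Frame

variable {Ω Γ : Set E3} {ν P : E3 → E3} {φ : E3 → ℝ} {U : Set E3} {x n : E3} {τ : Fin 2 → E3}
  {κ : Fin 2 → ℝ} {f : E2 → ℝ}

theorem frame_inner (h : Orthonormal ℝ ![τ 0, τ 1, n]) :
    ⟪n, n⟫ = 1 ∧ (∀ j, ⟪n, τ j⟫ = 0) ∧ (∀ j, ⟪τ j, n⟫ = 0) ∧
      ∀ i j, ⟪τ i, τ j⟫ = if i = j then 1 else 0 := by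
  have h' := orthonormal_iff_ite.1 h
  refine ⟨by simpa using h' 2 2, fun j => ?_, fun j => ?_, fun i j => ?_⟩
  · fin_cases j
    · simpa using h' 2 0
    · simpa using h' 2 1
  · fin_cases j
    · simpa using h' 0 2
    · simpa using h' 1 2
  · fin_cases i <;> fin_cases j
    · simpa using h' 0 0
    · simpa using h' 0 1
    · simpa using h' 1 0
    · simpa using h' 1 1

theorem exists_frame_basis (h : Orthonormal ℝ ![τ 0, τ 1, n]) :
    ∃ b : OrthonormalBasis (Fin 3) ℝ E3, b 0 = τ 0 ∧ b 1 = τ 1 ∧ b 2 = n := by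
  obtain ⟨b, hb⟩ := Orthonormal.exists_orthonormalBasis_extension_of_card_eq (ι := Fin 3)
    (by simp) (s := univ) (v := ![τ 0, τ 1, n])
    (h.comp _ Subtype.val_injective)
  exact ⟨b, by simpa using hb 0 (mem_univ _), by simpa using hb 1 (mem_univ _),
    by simpa using hb 2 (mem_univ _)⟩

theorem frame_inner_eq (h : Orthonormal ℝ ![τ 0, τ 1, n]) (p q : E3) :
    ⟪p, q⟫ = ⟪τ 0, p⟫ * ⟪τ 0, q⟫ + ⟪τ 1, p⟫ * ⟪τ 1, q⟫ + ⟪n, p⟫ * ⟪n, q⟫ := by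
  obtain ⟨b, h0, h1, h2⟩ := exists_frame_basis h
  rw [← b.sum_inner_mul_inner p q, Fin.sum_univ_three, h0, h1, h2, real_inner_comm (τ 0) p,
    real_inner_comm (τ 1) p, real_inner_comm n p]

theorem frame_eq (h : Orthonormal ℝ ![τ 0, τ 1, n]) (p : E3) :
    p = ⟪τ 0, p⟫ • τ 0 + ⟪τ 1, p⟫ • τ 1 + ⟪n, p⟫ • n := by
  obtain ⟨b, h0, h1, h2⟩ := exists_frame_basis h
  conv_lhs => rw [← b.sum_repr' p]
  rw [Fin.sum_univ_three, h0, h1, h2]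

/-- The point over `v` on the graph of `f` in a frame. -/
def graphPoint (x : E3) (τ : Fin 2 → E3) (n : E3) (f : E2 → ℝ) (v : E2) : E3 :=
  x + (v 0 • τ 0 + v 1 • τ 1 + f v • n)

theorem hasFDerivAt_graphPoint {v : E2} (hf : DifferentiableAt ℝ f v) :
    HasFDerivAt (graphPoint x τ n f)
      ((EuclideanSpace.proj 0 : E2 →L[ℝ] ℝ).smulRight (τ 0) +
        (EuclideanSpace.proj 1 : E2 →L[ℝ] ℝ).smulRight (τ 1) +
        (fderiv ℝ f v).smulRight n) v := by
  have h0 := ((EuclideanSpace.proj 0 : E2 →L[ℝ] ℝ).hasFDerivAt (x := v)).smul_const (τ 0)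
  have h1 := ((EuclideanSpace.proj 1 : E2 →L[ℝ] ℝ).hasFDerivAt (x := v)).smul_const (τ 1)
  exact ((h0.add h1).add (hf.hasFDerivAt.smul_const n)).const_add x

theorem IsLocalGraph.contDiffAt (h : IsLocalGraph Γ x τ n f) :
    ∀ᶠ v in 𝓝 (0 : E2), ContDiffAt ℝ ∞ f v := by
  obtain ⟨⟨L, hL, hf⟩, -⟩ := h
  filter_upwards [Metric.ball_mem_nhds (0 : E2) hL] with v hv
  exact hf.contDiffAt (Metric.isOpen_ball.mem_nhds hv)

theorem IsLocalGraph.apply_zero (h : IsLocalGraph Γ x τ n f) (hx : x ∈ Γ) : f 0 = 0 := by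
  have h1 := h.2.self_of_nhds.1 hx
  simp only [sub_self, inner_zero_right] at h1
  have h2 : (!₂[0, 0] : E2) = 0 := by ext i; fin_cases i <;> rfl
  rw [h2] at h1
  exact h1.symm

theorem IsLocalGraph.tendsto_graphPoint (h : IsLocalGraph Γ x τ n f) (hx : x ∈ Γ) :
    Tendsto (graphPoint x τ n f) (𝓝 0) (𝓝 x) := by
  have h1 := (hasFDerivAt_graphPoint (x := x) (τ := τ) (n := n)
    (h.contDiffAt.self_of_nhds.differentiableAt (by simp))).continuousAt.tendsto
  simpa [graphPoint, h.apply_zero hx] using h1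

theorem IsLocalGraph.graphPoint_mem (h : IsLocalGraph Γ x τ n f) (hx : x ∈ Γ)
    (ho : Orthonormal ℝ ![τ 0, τ 1, n]) : ∀ᶠ v in 𝓝 (0 : E2), graphPoint x τ n f v ∈ Γ := by
  obtain ⟨h1, h2, h3, h4⟩ := frame_inner ho
  filter_upwards [(h.tendsto_graphPoint hx).eventually h.2] with v hv
  refine hv.2 ?_
  have e0 : ⟪τ 0, graphPoint x τ n f v - x⟫ = v 0 := by
    simp only [graphPoint, add_sub_cancel_left, inner_add_right, inner_smul_right, h3, h4]
    simp
  have e1 : ⟪τ 1, graphPoint x τ n f v - x⟫ = v 1 := by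
    simp only [graphPoint, add_sub_cancel_left, inner_add_right, inner_smul_right, h3, h4]
    simp
  have e2 : ⟪n, graphPoint x τ n f v - x⟫ = f v := by
    simp only [graphPoint, add_sub_cancel_left, inner_add_right, inner_smul_right, h1, h2]
    simp
  rw [e0, e1, e2]
  congr 1
  ext i; fin_cases i <;> rfl

/-- The unit normal of the graph. -/
theorem IsDefiningOn.normal_graphPoint (D : IsDefiningOn Ω Γ ν φ U) (hxU : x ∈ U) (hx : x ∈ Γ)
    (h : IsLocalGraph Γ x τ (ν x) f) (ho : Orthonormal ℝ ![τ 0, τ 1, ν x]) :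
    ∀ᶠ v in 𝓝 (0 : E2), 0 < ⟪ν x, ν (graphPoint x τ (ν x) f v)⟫ ∧
      (∀ j, ⟪τ j, ν (graphPoint x τ (ν x) f v)⟫ =
        -(fderiv ℝ f v (EuclideanSpace.single j 1)) * ⟪ν x, ν (graphPoint x τ (ν x) f v)⟫) ∧
      ⟪ν x, ν (graphPoint x τ (ν x) f v)⟫ ^ 2 *
        (1 + fderiv ℝ f v (EuclideanSpace.single 0 1) ^ 2 +
          fderiv ℝ f v (EuclideanSpace.single 1 1) ^ 2) = 1 := by
  obtain ⟨h1, h2, h3, h4⟩ := frame_inner ho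
  set G := graphPoint x τ (ν x) f with hG
  have hGt : Tendsto G (𝓝 0) (𝓝 x) := h.tendsto_graphPoint hx
  have hmem := h.graphPoint_mem hx ho
  rw [← hG] at hmem
  have hUev := hGt.eventually (D.isOpen.mem_nhds hxU)
  have hgc : ContinuousAt (gradient φ) x :=
    (D.contDiffOn_gradient.contDiffAt (D.isOpen.mem_nhds hxU)).continuousAt
  have hg1 : Tendsto (fun v => gradient φ (G v)) (𝓝 0) (𝓝 (gradient φ x)) := hgc.tendsto.comp hGt
  have hlim : Tendsto (fun v => ⟪ν x, ‖gradient φ (G v)‖⁻¹ • gradient φ (G v)⟫) (𝓝 0)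
      (𝓝 ⟪ν x, ‖gradient φ x‖⁻¹ • gradient φ x⟫) :=
    tendsto_const_nhds.inner
      ((hg1.norm.inv₀ (norm_ne_zero_iff.2 (D.gradient_ne x hxU))).smul hg1)
  rw [← D.normal_eq x hxU hx, h1] at hlim
  filter_upwards [hmem.eventually_nhds, hUev.eventually_nhds, h.contDiffAt,
    hlim.eventually_const_lt one_pos] with v hv1 hv2 hv3 hv4
  have hvU := hv2.self_of_nhds
  have hvΓ := hv1.self_of_nhds
  rw [← D.normal_eq _ hvU hvΓ] at hv4
  have hder := hasFDerivAt_graphPoint (x := x) (τ := τ) (n := ν x)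
    (hv3.differentiableAt (by simp))
  have hφG := ((D.contDiffAt hvU).differentiableAt (by simp)).hasFDerivAt.comp v hder
  have hzero : φ ∘ G =ᶠ[𝓝 v] fun _ => (0 : ℝ) := by
    filter_upwards [hv1, hv2] with v' h5 h6
    exact (D.mem_iff _ h6).1 h5
  -- φ vanishes along the graph, so its differential annihilates the tangent vectors τⱼ + ∂ⱼf n.
  -- This fixes the direction of the normal, while its orientation comes from continuity at x.
  have hL := hφG.unique ((hasFDerivAt_const (0 : ℝ) v).congr_of_eventuallyEq hzero)
  have htan : ∀ j, ⟪τ j, ν (G v)⟫ =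
      -(fderiv ℝ f v (EuclideanSpace.single j 1)) * ⟪ν x, ν (G v)⟫ := by
    intro j
    have h5 := congrArg (fun L : E2 →L[ℝ] ℝ => L (EuclideanSpace.single j 1)) hL
    have h6 : fderiv ℝ φ (G v) (τ j + fderiv ℝ f v (EuclideanSpace.single j 1) • ν x) = 0 := by
      fin_cases j
      · simpa using h5
      · simpa using h5
    have h7 : ⟪τ j + fderiv ℝ f v (EuclideanSpace.single j 1) • ν x, ν (G v)⟫ = 0 := by
      rw [D.normal_eq _ hvU hvΓ, inner_smul_right, real_inner_comm, inner_gradient_eq_fderiv, h6,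
        mul_zero]
    rw [inner_add_left, real_inner_smul_left] at h7
    linarith
  refine ⟨hv4, htan, ?_⟩
  have h8 := frame_inner_eq ho (ν (G v)) (ν (G v))
  rw [real_inner_self_eq_norm_sq, D.norm_normal hvU hvΓ, htan 0, htan 1] at h8
  linarith

/-- The first derivatives of the graph function vanish, and the second derivatives are the
principal curvatures. -/
theorem IsDefiningOn.fderiv_graph (D : IsDefiningOn Ω Γ ν φ U) (hxU : x ∈ U) (hx : x ∈ Γ)
    (h : IsLocalGraph Γ x τ (ν x) f) (hfr : IsPrincipalFrame Γ ν x τ κ) :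
    fderiv ℝ f 0 = 0 ∧ ∀ i j, fderiv ℝ (fderiv ℝ f) 0 (EuclideanSpace.single i 1)
      (EuclideanSpace.single j 1) = if i = j then κ i else 0 := by
  obtain ⟨ho, S, hS, hSτ⟩ := hfr
  obtain ⟨h1, h2, h3, h4⟩ := frame_inner ho
  have hnormal := D.normal_graphPoint hxU hx h ho
  have hmem := h.graphPoint_mem hx ho
  have hG0 : graphPoint x τ (ν x) f 0 = x := by simp [graphPoint, h.apply_zero hx]
  have hf0 := h.contDiffAt.self_of_nhds
  have hj : ∀ j, fderiv ℝ f 0 (EuclideanSpace.single j 1) = 0 := by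
    intro j
    have := hnormal.self_of_nhds.2.1 j
    rw [hG0, h1, h3] at this
    linarith
  have hfd : fderiv ℝ f 0 = 0 := by
    ext v
    conv_lhs => rw [eq_smul_single_add v]
    rw [map_add, map_smul, map_smul, hj, hj]
    simp
  refine ⟨hfd, fun i j => ?_⟩
  set G := graphPoint x τ (ν x) f with hG
  set e : E2 := EuclideanSpace.single i 1 with he
  have hline : HasDerivAt (fun s : ℝ => s • e) e 0 := by
    simpa using (hasDerivAt_id (0 : ℝ)).smul_const e
  have hlim : Tendsto (fun s : ℝ => s • e) (𝓝 0) (𝓝 0) := by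
    simpa using hline.continuousAt.tendsto
  have hGd : HasDerivAt (fun s : ℝ => G (s • e)) (τ i) 0 := by
    have h5 := hasFDerivAt_graphPoint (x := x) (τ := τ) (n := ν x)
      (hf0.differentiableAt (by simp))
    rw [← zero_smul ℝ e, ← hG] at h5
    refine (h5.comp_hasDerivAt (0 : ℝ) hline).congr_deriv ?_
    rw [zero_smul, hfd]
    fin_cases i <;> simp [he]
  have hνd : HasDerivAt (fun s : ℝ => ν (G (s • e))) (-κ i • τ i) 0 := by
    rw [← hSτ i]
    refine HasFDerivWithinAt.comp_hasDerivAt (l := ν) (t := Γ) (0 : ℝ) ?_ hGd (hlim.eventually hmem)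
    rw [zero_smul, hG0]
    exact hS
  have hfj : HasDerivAt (fun s : ℝ => fderiv ℝ f (s • e) (EuclideanSpace.single j 1))
      (fderiv ℝ (fderiv ℝ f) 0 e (EuclideanSpace.single j 1)) 0 := by
    have h5 : HasFDerivAt (fderiv ℝ f) (fderiv ℝ (fderiv ℝ f) 0) ((0 : ℝ) • e) := by
      rw [zero_smul]
      exact ((contDiffAt_fderiv_top hf0).differentiableAt (by simp)).hasFDerivAt
    have h6 : HasDerivAt (fun s : ℝ => fderiv ℝ f (s • e)) (fderiv ℝ (fderiv ℝ f) 0 e) 0 :=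
      h5.comp_hasDerivAt (0 : ℝ) hline
    exact (ContinuousLinearMap.apply ℝ ℝ
      (EuclideanSpace.single j (1 : ℝ) : E2)).hasFDerivAt.comp_hasDerivAt (0 : ℝ) h6
  -- Differentiate ⟨τⱼ, ν⟩ = -∂ⱼf ⟨n, ν⟩ along the i-th coordinate line. The left side gives -κᵢ
  -- times the Kronecker delta; the right side gives -∂ᵢ∂ⱼf, since ∂ⱼf(0) = 0.
  have hleft := (hasDerivAt_const (0 : ℝ) (τ j)).inner ℝ hνd
  have hright := hfj.fun_neg.fun_mul ((hasDerivAt_const (0 : ℝ) (ν x)).inner ℝ hνd)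
  have hev : (fun s : ℝ => ⟪τ j, ν (G (s • e))⟫) =ᶠ[𝓝 0] fun s =>
      -(fderiv ℝ f (s • e) (EuclideanSpace.single j 1)) * ⟪ν x, ν (G (s • e))⟫ := by
    filter_upwards [hlim.eventually hnormal] with s hs
    exact hs.2.1 j
  have heq := hleft.unique (hright.congr_of_eventuallyEq hev)
  simp only [zero_smul, hG0, h1, hj, inner_zero_left, add_zero, inner_smul_right, h2, h4] at heq
  have h7 : fderiv ℝ (fderiv ℝ f) 0 e (EuclideanSpace.single j 1) =
      κ i * if j = i then 1 else 0 := by linarith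
  rw [h7]
  by_cases hij : i = j
  · simp [hij]
  · simp [hij, Ne.symm hij]

/-- The first two coefficients of the closest points along a ray, and of the numerators of the
double-layer kernel and its conjugate. -/
theorem IsDefiningOn.ray_coefficients (D : IsDefiningOn Ω Γ ν φ U) (hP : IsClosestPointMap Γ P)
    (hxU : x ∈ U) (hx : x ∈ Γ) (h : IsLocalGraph Γ x τ (ν x) f)
    (ho : Orthonormal ℝ ![τ 0, τ 1, ν x]) {g : LocalData} (H : HasGraphTaylor f κ g) {η : ℝ}
    {u : E2} {w : ℝ → E3} {w' : E3} {b b₁ : ℝ → ℝ} {b' b₁' : ℝ} (hw : HasDerivAt w w' 0)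
    (hb : HasDerivAt b b' 0) (hb₁ : HasDerivAt b₁ b₁' 0)
    (hq : ∀ᶠ t in 𝓝 (0 : ℝ), P (x + η • ν x + horizontal (t • u)) = x + t • w t)
    (hqb : ∀ᶠ t in 𝓝 (0 : ℝ), -⟪t • w t, ν (x + t • w t)⟫ = t ^ 2 * b t)
    (hqb₁ : ∀ᶠ t in 𝓝 (0 : ℝ), ⟪t • w t, ν x⟫ = t ^ 2 * b₁ t)
    {v v' : E2} (hv : v = !₂[⟪τ 0, w 0⟫, ⟪τ 1, w 0⟫]) (hv' : v' = !₂[⟪τ 0, w'⟫, ⟪τ 1, w'⟫]) :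
    (∀ j, (1 - η * κ j) * v j = ⟪τ j, horizontal u⟫) ∧
    (∀ j, (1 - η * κ j) * v' j = η * g.C v.ofLp j + ⟪ν x, horizontal u⟫ * κ j * v j) ∧
    ⟪ν x, w 0⟫ = 0 ∧
    b 0 = 1 / 2 * (κ 0 * v 0 ^ 2 + κ 1 * v 1 ^ 2) ∧
    b' = κ 0 * v 0 * v' 0 + κ 1 * v 1 * v' 1 + 2 * g.B v.ofLp ∧
    b₁ 0 = 1 / 2 * (κ 0 * v 0 ^ 2 + κ 1 * v 1 ^ 2) ∧
    b₁' = κ 0 * v 0 * v' 0 + κ 1 * v 1 * v' 1 + g.B v.ofLp := by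
  obtain ⟨h1, h2, h3, h4⟩ := frame_inner ho
  let T : E3 →L[ℝ] E2 := LinearMap.toContinuousLinearMap
    { toFun := fun p => !₂[⟪τ 0, p⟫, ⟪τ 1, p⟫]
      map_add' := fun p q => by ext i; fin_cases i <;> simp [inner_add_right]
      map_smul' := fun c p => by ext i; fin_cases i <;> simp [inner_smul_right] }
  let ζ : ℝ → E2 := fun t => T (w t)
  have hζj : ∀ t j, ζ t j = ⟪τ j, w t⟫ := by
    intro t j; fin_cases j <;> rfl
  have hζ : HasDerivAt ζ v' 0 := by
    rw [hv']
    exact T.hasFDerivAt.comp_hasDerivAt (0 : ℝ) hw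
  have hζ0 : ζ 0 = v := hv.symm
  have hcurve : Tendsto (fun t : ℝ => x + t • w t) (𝓝 0) (𝓝 x) := by
    simpa using ((hasDerivAt_smul_zero hw.differentiableAt).const_add x).continuousAt.tendsto
  have hχ : Tendsto (fun t : ℝ => t • ζ t) (𝓝 0) (𝓝 0) := by
    simpa using (hasDerivAt_smul_zero hζ.differentiableAt).continuousAt.tendsto
  have hheight : ∀ᶠ t in 𝓝 (0 : ℝ), t * ⟪ν x, w t⟫ = f (t • ζ t) := by
    filter_upwards [hcurve.eventually h.2, hq] with t h5 h6
    have h7 := h5.1 (h6 ▸ (hP _).1)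
    rw [add_sub_cancel_left, inner_smul_right, inner_smul_right, inner_smul_right] at h7
    rw [h7]
    congr 1
    ext i; fin_cases i <;> simp [hζj]
  have hgraph : ∀ᶠ t in 𝓝 (0 : ℝ), x + t • w t = graphPoint x τ (ν x) f (t • ζ t) := by
    filter_upwards [hheight] with t h5
    rw [graphPoint, ← h5]
    congr 1
    nth_rewrite 1 [frame_eq ho (w t)]
    simp only [PiLp.smul_apply, smul_eq_mul, hζj]
    module
  have hnormal := hχ.eventually (D.normal_graphPoint hxU hx h ho)
  -- The vector from the closest point back to the plane point equals s ν for some s. Its components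
  -- along τⱼ and n, combined so as to eliminate s, give the scalar equation used by
  -- `curve_coefficients`.
  have hfoc : ∀ j, ∀ᶠ t in 𝓝[≠] (0 : ℝ), t * ζ t j - t * ⟪τ j, horizontal u⟫ +
      (f (t • ζ t) - (η + t * ⟪ν x, horizontal u⟫)) *
        fderiv ℝ f (t • ζ t) (EuclideanSpace.single j 1) = 0 := by
    intro j
    refine nhdsWithin_le_nhds ?_
    filter_upwards [hq, hheight, hgraph, hnormal, hcurve.eventually (D.isOpen.mem_nhds hxU)] with
      t h5 h6 h7 h8 h9
    have hcl := hP (x + η • ν x + horizontal (t • u))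
    rw [h5] at hcl
    obtain ⟨s, -, hs⟩ := D.eq_add_smul_normal h9 hcl
    have h10 : s • ν (x + t • w t) = η • ν x + t • horizontal u - t • w t := by
      rw [map_smul] at hs
      rw [← sub_eq_zero] at hs ⊢
      rw [← neg_eq_zero, ← hs]
      abel
    have e1 := congrArg (fun p => ⟪τ j, p⟫) h10
    have e2 := congrArg (fun p => ⟪ν x, p⟫) h10
    simp only [inner_sub_right, inner_add_right, inner_smul_right, h1, h3] at e1 e2
    rw [h7, h8.2.1 j] at e1
    rw [h7] at e2
    rw [hζj, ← h6]
    linear_combination e1 + fderiv ℝ f (t • ζ t) (EuclideanSpace.single j 1) * e2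
  have hc : ∀ᶠ t in 𝓝[≠] (0 : ℝ), 0 < ⟪ν x, ν (x + t • w t)⟫ ∧ ⟪ν x, ν (x + t • w t)⟫ ^ 2 *
      (1 + fderiv ℝ f (t • ζ t) (EuclideanSpace.single 0 1) ^ 2 +
        fderiv ℝ f (t • ζ t) (EuclideanSpace.single 1 1) ^ 2) = 1 := by
    refine nhdsWithin_le_nhds ?_
    filter_upwards [hgraph, hnormal] with t h5 h6
    rw [h5]
    exact ⟨h6.1, h6.2.2⟩
  have hbev : ∀ᶠ t in 𝓝[≠] (0 : ℝ), ⟪ν x, ν (x + t • w t)⟫ *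
      (t * ζ t 0 * fderiv ℝ f (t • ζ t) (EuclideanSpace.single 0 1) +
        t * ζ t 1 * fderiv ℝ f (t • ζ t) (EuclideanSpace.single 1 1) - f (t • ζ t)) =
      t ^ 2 * b t := by
    refine nhdsWithin_le_nhds ?_
    filter_upwards [hgraph, hnormal, hqb, hheight] with t h5 h6 h7 h8
    rw [← h7, frame_inner_eq ho (t • w t), h5, h6.2.1 0, h6.2.1 1, inner_smul_right,
      inner_smul_right, inner_smul_right, h8, hζj, hζj]
    ring
  have hbev₁ : ∀ᶠ t in 𝓝[≠] (0 : ℝ), f (t • ζ t) = t ^ 2 * b₁ t := by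
    refine nhdsWithin_le_nhds ?_
    filter_upwards [hqb₁, hheight] with t h5 h6
    rw [← h5, ← h6, real_inner_smul_left, real_inner_comm]
  obtain ⟨r1, r2⟩ := H.normal_coefficients hζ hb hc hbev
  obtain ⟨r3, r4⟩ := H.height_coefficients hζ hb₁ hbev₁
  -- For t ≠ 0 the height relation reads ⟨n, w(t)⟩ = t b₁(t), and continuity extends it to t = 0.
  have hn0 : ⟪ν x, w 0⟫ = 0 := by
    have hE := ((hasDerivAt_const (0 : ℝ) (ν x)).inner ℝ hw).fun_sub
      ((hasDerivAt_id' (0 : ℝ)).fun_mul hb₁)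
    have h5 := (eq_zero_of_hasDerivAt_of_isBigO_sq hE (IsBigO.of_bound 1 (by
      filter_upwards [hbev₁, nhdsWithin_le_nhds hheight, self_mem_nhdsWithin] with
        t h5 h6 (h7 : t ≠ 0)
      rw [h5] at h6
      have h8 : ⟪ν x, w t⟫ - t * b₁ t = 0 := by
        have : t * (⟪ν x, w t⟫ - t * b₁ t) = 0 := by rw [mul_sub, h6]; ring
        exact (mul_eq_zero.1 this).resolve_left h7
      rw [h8, norm_zero]
      positivity))).1
    simpa using h5
  rw [hζ0] at r1 r2 r3 r4
  have hcc := fun j => H.curve_coefficients hζ (hfoc j)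
  rw [hζ0] at hcc
  exact ⟨fun j => (hcc j).1, fun j => (hcc j).2, hn0, r1, r2, r3, r4⟩

end Frame

/-! ### Reduction of the matrix formulas to the principal coordinates. -/

section LocalDataFormulas

variable {g : LocalData} {κ : Fin 2 → ℝ}

theorem LocalData.D₀_eq (hM : g.M = Matrix.diagonal κ) (hl : ∀ j, 1 - g.η * κ j ≠ 0) :
    g.D₀ = Matrix.diagonal fun j => (1 - g.η * κ j)⁻¹ := by
  rw [LocalData.D₀]
  refine Matrix.inv_eq_right_inv ?_
  have h1 : (1 : Matrix (Fin 2) (Fin 2) ℝ) - g.η • g.M =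
      Matrix.diagonal fun j => 1 - g.η * κ j := by
    rw [hM, ← Matrix.diagonal_one, ← Matrix.diagonal_smul, Matrix.diagonal_sub]
    rfl
  rw [h1, Matrix.diagonal_mul_diagonal, ← Matrix.diagonal_one]
  congr 1
  funext j
  exact mul_inv_cancel₀ (hl j)

theorem LocalData.det_ne_zero (hM : g.M = Matrix.diagonal κ) (hl : ∀ j, 1 - g.η * κ j ≠ 0) :
    (1 - g.η • g.M).det ≠ 0 := by
  have h1 : (1 : Matrix (Fin 2) (Fin 2) ℝ) - g.η • g.M =
      Matrix.diagonal fun j => 1 - g.η * κ j := by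
    rw [hM, ← Matrix.diagonal_one, ← Matrix.diagonal_smul, Matrix.diagonal_sub]
    rfl
  rw [h1, Matrix.det_diagonal]
  exact Finset.prod_ne_zero_iff.2 fun j _ => hl j

theorem LocalData.χ₀_apply (hM : g.M = Matrix.diagonal κ) (hl : ∀ j, 1 - g.η * κ j ≠ 0)
    (y : Fin 2 → ℝ) (j : Fin 2) : g.χ₀ y j = (1 - g.η * κ j)⁻¹ * (g.A *ᵥ y) j := by
  rw [LocalData.χ₀, g.D₀_eq hM hl, ← Matrix.mulVec_mulVec, Matrix.mulVec_diagonal]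

theorem LocalData.χ₁_apply (hM : g.M = Matrix.diagonal κ) (hl : ∀ j, 1 - g.η * κ j ≠ 0)
    (y : Fin 2 → ℝ) (j : Fin 2) : g.χ₁ y j = (1 - g.η * κ j)⁻¹ *
      (g.η * g.C (g.χ₀ y) j + (g.d ⬝ᵥ y) * κ j * g.χ₀ y j) := by
  rw [LocalData.χ₁, Pi.add_apply, Pi.smul_apply, Pi.smul_apply, g.D₀_eq hM hl, hM,
    ← Matrix.mulVec_mulVec, ← Matrix.mulVec_mulVec, ← Matrix.mulVec_mulVec,
    Matrix.mulVec_diagonal, Matrix.mulVec_diagonal, Matrix.mulVec_diagonal,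
    Matrix.mulVec_diagonal, g.χ₀_apply hM hl, smul_eq_mul, smul_eq_mul]
  ring

theorem LocalData.ξ₀_eq (hM : g.M = Matrix.diagonal κ) (hl : ∀ j, 1 - g.η * κ j ≠ 0)
    (y : Fin 2 → ℝ) :
    g.ξ₀ y = 1 / 2 * (κ 0 * g.χ₀ y 0 ^ 2 + κ 1 * g.χ₀ y 1 ^ 2) := by
  rw [LocalData.ξ₀, g.D₀_eq hM hl, g.χ₀_apply hM hl, g.χ₀_apply hM hl, hM]
  simp only [← Matrix.mulVec_mulVec, Matrix.dotProduct_mulVec y, Matrix.vecMul_transpose,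
    Matrix.diagonal_transpose]
  simp only [dotProduct, Fin.sum_univ_two, Matrix.mulVec_diagonal]
  ring

/-- Since `M` and `D₀` are diagonal, the terms with η and d combine into ⟨χ₀, M χ₁⟩, the first
variation of the quadratic form ½⟨χ₀, M χ₀⟩. -/
theorem LocalData.ξ₁_eq (hM : g.M = Matrix.diagonal κ) (hl : ∀ j, 1 - g.η * κ j ≠ 0)
    (y : Fin 2 → ℝ) : g.ξ₁ y = κ 0 * g.χ₀ y 0 * g.χ₁ y 0 + κ 1 * g.χ₀ y 1 * g.χ₁ y 1 +
      g.B (g.χ₀ y) := by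
  rw [LocalData.ξ₁, g.χ₁_apply hM hl, g.χ₁_apply hM hl, g.D₀_eq hM hl, hM]
  simp only [← Matrix.mulVec_mulVec, Matrix.dotProduct_mulVec y, Matrix.vecMul_transpose,
    Matrix.diagonal_transpose]
  simp only [dotProduct, Fin.sum_univ_two, Matrix.mulVec_diagonal, g.χ₀_apply hM hl]
  ring

/-- For diagonal matrices the difference in brackets vanishes. The identity part of I + ηMD₀
contributes χ₀·C = 3B by Euler's identity, which together with -B gives 2B. -/
theorem LocalData.ξt₁_eq (hM : g.M = Matrix.diagonal κ) (hl : ∀ j, 1 - g.η * κ j ≠ 0)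
    (y : Fin 2 → ℝ) : g.ξt₁ y = κ 0 * g.χ₀ y 0 * g.χ₁ y 0 + κ 1 * g.χ₀ y 1 * g.χ₁ y 1 +
      2 * g.B (g.χ₀ y) := by
  have hC := C_inner (g := g) (g.χ₀ y)
  rw [LocalData.ξt₁, g.χ₁_apply hM hl, g.χ₁_apply hM hl, g.D₀_eq hM hl, hM]
  simp only [← Matrix.mulVec_mulVec, Matrix.dotProduct_mulVec y, Matrix.vecMul_transpose,
    Matrix.diagonal_transpose, Matrix.add_mulVec, Matrix.one_mulVec, Matrix.smul_mulVec]
  rw [g.χ₀_apply hM hl y 0, g.χ₀_apply hM hl y 1] at hC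
  simp only [dotProduct, Fin.sum_univ_two, Matrix.mulVec_diagonal, g.χ₀_apply hM hl,
    Pi.add_apply, Pi.smul_apply, smul_eq_mul]
  linear_combination hC

end LocalDataFormulas

/-! ### The kernels in polar form. -/

section Final

/-- The layer kernels multiplied by the radius, in polar coordinates: `w` is the relative closest
point divided by the radius and `b`, `b'` are the numerators of the double-layer kernel and its
conjugate, divided by the squared radius. -/
noncomputable def polarKernel (w : ℝ × E2 → E3) (b b' : ℝ × E2 → ℝ) (X : LayerKernel) (p : ℝ × E2) : ℝ :=
  match X with
  | .SL => 1 / (4 * Real.pi) * (1 / ‖w p‖)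
  | .DL => 1 / (4 * Real.pi) * (b p / ‖w p‖ ^ 3)
  | .DLC => 1 / (4 * Real.pi) * (b' p / ‖w p‖ ^ 3)

theorem contDiffOn_polarKernel {w : ℝ × E2 → E3} {b b' : ℝ × E2 → ℝ} {S : Set (ℝ × E2)}
    (hw : ContDiffOn ℝ ∞ w S) (hb : ContDiffOn ℝ ∞ b S) (hb' : ContDiffOn ℝ ∞ b' S)
    (h0 : ∀ p ∈ S, w p ≠ 0) (X : LayerKernel) : ContDiffOn ℝ ∞ (polarKernel w b b' X) S := by
  have hn : ContDiffOn ℝ ∞ (fun p => ‖w p‖) S := hw.norm ℝ h0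
  have hne : ∀ p ∈ S, ‖w p‖ ≠ 0 := fun p hp => norm_ne_zero_iff.2 (h0 p hp)
  cases X
  · exact contDiffOn_const.mul (contDiffOn_const.div hn hne)
  · exact contDiffOn_const.mul (hb.div (hn.pow 3) fun p hp => pow_ne_zero 3 (hne p hp))
  · exact contDiffOn_const.mul (hb'.div (hn.pow 3) fun p hp => pow_ne_zero 3 (hne p hp))

theorem hasDerivAt_norm_of_ne_zero {w : ℝ → E3} {w' : E3} (hw : HasDerivAt w w' 0)
    (h0 : w 0 ≠ 0) : HasDerivAt (fun t => ‖w t‖) (⟪w 0, w'⟫ / ‖w 0‖) 0 := by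
  have h1 := hw.norm_sq.sqrt (pow_ne_zero 2 (norm_ne_zero_iff.2 h0))
  simp only [Real.sqrt_sq (norm_nonneg _)] at h1
  refine h1.congr_deriv ?_
  rw [mul_div_mul_left _ _ two_ne_zero]

/-- The value and the derivative at the origin of the layer kernels along a ray. -/
theorem polarKernel_ray {w : ℝ × E2 → E3} {b b' : ℝ × E2 → ℝ} {u : E2} {w₁ : E3} {b₁ b₁' : ℝ}
    (hw : HasDerivAt (fun t => w (t, u)) w₁ 0) (hb : HasDerivAt (fun t => b (t, u)) b₁ 0)
    (hb' : HasDerivAt (fun t => b' (t, u)) b₁' 0) (h0 : w (0, u) ≠ 0) (X : LayerKernel) :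
    deriv (fun t => polarKernel w b b' X (t, u)) 0 = match X with
      | .SL => 1 / (4 * Real.pi) * (-(⟪w (0, u), w₁⟫ / ‖w (0, u)‖ / ‖w (0, u)‖ ^ 2))
      | .DL => 1 / (4 * Real.pi) * (-3 * (b (0, u) * (⟪w (0, u), w₁⟫ / ‖w (0, u)‖) /
          ‖w (0, u)‖ ^ 4) + b₁ / ‖w (0, u)‖ ^ 3)
      | .DLC => 1 / (4 * Real.pi) * (-3 * (b' (0, u) * (⟪w (0, u), w₁⟫ / ‖w (0, u)‖) /
          ‖w (0, u)‖ ^ 4) + b₁' / ‖w (0, u)‖ ^ 3) := by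
  have hn := hasDerivAt_norm_of_ne_zero hw h0
  have hne : ‖w (0, u)‖ ≠ 0 := norm_ne_zero_iff.2 h0
  cases X
  · have h1 := ((hasDerivAt_const (0 : ℝ) (1 : ℝ)).fun_div hn hne).const_mul (1 / (4 * Real.pi))
    refine h1.deriv.trans ?_
    simp only [zero_mul, zero_sub, one_mul, neg_div]
  · have h1 := (hb.fun_div (hn.fun_pow 3) (pow_ne_zero 3 hne)).const_mul (1 / (4 * Real.pi))
    refine h1.deriv.trans ?_
    congr 1
    field_simp
    push_cast
    ring
  · have h1 := (hb'.fun_div (hn.fun_pow 3) (pow_ne_zero 3 hne)).const_mul (1 / (4 * Real.pi))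
    refine h1.deriv.trans ?_
    congr 1
    field_simp
    push_cast
    ring

theorem smul_unitDir (y : E2) (hy : y ≠ 0) : ‖y‖ • (unitDir y hy : E2) = y := by
  simp [unitDir, smul_smul, norm_ne_zero_iff.2 hy]

/-- Counting powers: the single layer has one factor |y| in the denominator, and for the other two
kernels the numerator |y|² over |y|³ leaves the same factor 1/|y|. -/
theorem singularFunction_eq_polarKernel {ν P : E3 → E3} {x : E3} {z : ℝ} (hn : ν x 2 ≠ 0)
    {w : ℝ × E2 → E3} {b b' : ℝ × E2 → ℝ} {y : E2} (hy : y ≠ 0)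
    (hw : relativeClosestPoint P x (normalLinePoint x (ν x) z) y =
      ‖y‖ • w (‖y‖, unitDir y hy))
    (hb : -⟪relativeClosestPoint P x (normalLinePoint x (ν x) z) y,
      ν (P (normalLinePoint x (ν x) z + horizontal y))⟫ = ‖y‖ ^ 2 * b (‖y‖, unitDir y hy))
    (hb' : ⟪relativeClosestPoint P x (normalLinePoint x (ν x) z) y, ν x⟫ =
      ‖y‖ ^ 2 * b' (‖y‖, unitDir y hy)) (X : LayerKernel) :
    singularFunction X ν P x z y = 1 / ‖y‖ * polarKernel w b b' X (‖y‖, unitDir y hy) := by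
  have hy0 : ‖y‖ ≠ 0 := norm_ne_zero_iff.2 hy
  rw [singularFunction, planePoint_add_normalLinePlanar _ _ hn]
  set q := P (normalLinePoint x (ν x) z + horizontal y) with hq
  have hxq : x - q = -relativeClosestPoint P x (normalLinePoint x (ν x) z) y := by
    rw [relativeClosestPoint, neg_sub]
  have hnorm : ‖x - q‖ = ‖y‖ * ‖w (‖y‖, unitDir y hy)‖ := by
    rw [hxq, norm_neg, hw, norm_smul, norm_norm]
  cases X
  · simp only [layerKernel, polarKernel, hnorm]
    field_simp
  · simp only [layerKernel, polarKernel, hnorm]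
    rw [hxq, inner_neg_left, hb]
    field_simp
  · simp only [layerKernel, polarKernel, hnorm]
    rw [hxq, inner_neg_left, hb']
    field_simp

theorem expansionTerm_zero (ℓ : ℝ → Metric.sphere (0 : E2) 1 → ℝ) (y : E2) (hy : y ≠ 0) :
    expansionTerm ℓ 0 y hy = ‖y‖⁻¹ * ℓ 0 (unitDir y hy) := by
  simp [expansionTerm]

theorem expansionTerm_one (ℓ : ℝ → Metric.sphere (0 : E2) 1 → ℝ) (y : E2) (hy : y ≠ 0) :
    expansionTerm ℓ 1 y hy = deriv (fun t => ℓ t (unitDir y hy)) 0 := by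
  simp [expansionTerm, iteratedDeriv_one]

theorem inner_horizontal (p : E3) (y : E2) : ⟪p, horizontal y⟫ = p 0 * y 0 + p 1 * y 1 := by
  simp [PiLp.inner_apply, Fin.sum_univ_three, mul_comm]

end Final

/-! ### Auxiliary facts on the reach, the local data and the frame. -/

section Assembly

variable {Ω Γ : Set E3} {ν P : E3 → E3} {x : E3} {τ : Fin 2 → E3} {κ : Fin 2 → ℝ} {f : E2 → ℝ}

/-- Leaves room beyond ε, so that a point at distance exactly ε is interior to the tube where `P` is
smooth. The reach is extended-valued, so a finite radius has to be selected. -/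
theorem exists_real_lt_reach {ε : ℝ} (h : ENNReal.ofReal ε < reach Γ) :
    ∃ R : ℝ, ε < R ∧ ENNReal.ofReal R < reach Γ := by
  obtain ⟨c, h1, h2⟩ := exists_between h
  have hc : c ≠ ⊤ := (h2.trans_le le_top).ne
  refine ⟨c.toReal, ?_, by rwa [ENNReal.ofReal_toReal hc]⟩
  by_contra hle
  exact absurd (h1.trans_le (ENNReal.le_ofReal_iff_toReal_le hc (by
    by_contra h0
    rw [ENNReal.ofReal_of_nonpos (not_le.1 h0).le] at h1
    linarith [ENNReal.toReal_nonneg (a := c), not_lt.1 hle, not_le.1 h0]) |>.2 (not_lt.1 hle)))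
    (lt_irrefl _)

theorem localData_A_mulVec (τ : Fin 2 → E3) (n : E3) (κ : Fin 2 → ℝ) (η : ℝ) (f : E2 → ℝ) (y : E2)
    (j : Fin 2) : ((localData τ n κ η f).A *ᵥ y.ofLp) j = ⟪τ j, horizontal y⟫ := by
  rw [inner_horizontal]
  fin_cases j <;> simp [localData, Matrix.mulVec, dotProduct, Fin.sum_univ_two]

theorem localData_d_dotProduct (τ : Fin 2 → E3) (n : E3) (κ : Fin 2 → ℝ) (η : ℝ) (f : E2 → ℝ)
    (y : E2) : (localData τ n κ η f).d ⬝ᵥ y.ofLp = ⟪n, horizontal y⟫ := by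
  rw [inner_horizontal]
  simp [localData, dotProduct, Fin.sum_univ_two]

/-- A tangent direction is not vertical if the normal is not horizontal. -/
theorem exists_inner_horizontal_ne_zero {n : E3} (ho : Orthonormal ℝ ![τ 0, τ 1, n])
    (hn : n 2 ≠ 0) (j : Fin 2) :
    ∃ u ∈ Metric.sphere (0 : E2) 1, ⟪τ j, horizontal u⟫ ≠ 0 := by
  obtain ⟨-, h2, -, h4⟩ := frame_inner ho
  by_contra! hcon
  have c0 := hcon (EuclideanSpace.single 0 1) (by simp)
  have c1 := hcon (EuclideanSpace.single 1 1) (by simp)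
  rw [inner_horizontal] at c0 c1
  simp only [PiLp.single_apply] at c0 c1
  norm_num at c0 c1
  have h5 := h2 j
  have h6 : ⟪n, τ j⟫ = n 2 * τ j 2 := by
    simp [PiLp.inner_apply, Fin.sum_univ_three, c0, c1, mul_comm]
  rw [h6] at h5
  have h7 : τ j 2 = 0 := (mul_eq_zero.1 h5).resolve_left hn
  have h8 := h4 j j
  have h9 : τ j = 0 := by
    ext i
    fin_cases i
    exacts [c0, c1, h7]
  rw [h9, inner_zero_left, if_pos rfl] at h8
  exact zero_ne_one h8

theorem exists_inner_ne_zero {n : E3} (ho : Orthonormal ℝ ![τ 0, τ 1, n]) (hn : n 2 ≠ 0) {y : E2}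
    (hy : y ≠ 0) : ∃ j, ⟪τ j, horizontal y⟫ ≠ 0 := by
  by_contra! hcon
  have h1 := frame_eq ho (horizontal y)
  rw [hcon 0, hcon 1, zero_smul, zero_smul, zero_add, zero_add] at h1
  exact hy (horizontal_eq_zero_of_eq_smul hn h1)

end Assembly

/-! ### The main theorem. -/

theorem theorem2 (Γ Ω : Set E3) (hΓ : IsSmoothClosedSurface Γ Ω)
    (ν : E3 → E3) (hν : ∀ p ∈ Γ, IsOutwardUnitNormal Ω p (ν p))
    (P : E3 → E3) (hP : IsClosestPointMap Γ P)
    (ε : ℝ) (hε : 0 < ε) (hreach : ENNReal.ofReal ε < reach Γ)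
    (x : E3) (hx : x ∈ Γ) (hn : ⟪ν x, EuclideanSpace.single 2 1⟫ ≠ 0)
    (z : ℝ) (hz : dist (normalLinePoint x (ν x) z) x ≤ ε) :
    ∃ r : ℝ, 0 < r ∧ ∃ ℓ : LayerKernel → ℝ → Metric.sphere (0 : E2) 1 → ℝ,
      (∀ X, ContMDiffOn (𝓘(ℝ, ℝ).prod (𝓡 1)) 𝓘(ℝ, ℝ) ∞
        (fun p : ℝ × Metric.sphere (0 : E2) 1 => ℓ X p.1 p.2) (Ioo (-r) r ×ˢ univ)) ∧
      (∀ X (y : E2) (hy : y ≠ 0), ‖y‖ < r →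
        singularFunction X ν P x z y = 1 / ‖y‖ * ℓ X ‖y‖ (unitDir y hy)) ∧
      ∀ (τ : Fin 2 → E3) (κ : Fin 2 → ℝ) (f : E2 → ℝ),
        IsPrincipalFrame Γ ν x τ κ → IsLocalGraph Γ x τ (ν x) f →
        ∀ g : LocalData,
          g = localData τ (ν x) κ (surfaceSignedDist Γ Ω (normalLinePoint x (ν x) z)) f →
          (1 - g.η • g.M).det ≠ 0 ∧
          (∀ y : E2, y ≠ 0 → g.ψ₀ (WithLp.ofLp y) ≠ 0) ∧
          ∀ X,
            (∀ (y : E2) (hy : y ≠ 0),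
              expansionTerm (ℓ X) 0 y hy = g.s₀ X y ∧
              expansionTerm (ℓ X) 1 y hy = g.s₁ X y) ∧
            (fun y : E2 => singularFunction X ν P x z y - (g.s₀ X y + g.s₁ X y))
              =O[𝓝[≠] 0] (fun y : E2 => ‖y‖) := by
  have hn2 : ν x 2 ≠ 0 := by simpa [PiLp.inner_apply, Fin.sum_univ_three] using hn
  obtain ⟨R, hεR, hR⟩ := exists_real_lt_reach hreach
  obtain ⟨φ, U, hxU, D⟩ := hΓ.exists_isDefiningOn hν hx
  set t₀ := (z - x 2) / ν x 2 with ht₀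
  have hy₀ : normalLinePoint x (ν x) z = x + t₀ • ν x := rfl
  have ht₀R : |t₀| < R := by
    rw [hy₀, dist_eq_norm, add_sub_cancel_left, norm_smul, D.norm_normal hxU hx, mul_one,
      Real.norm_eq_abs] at hz
    linarith
  have hη := D.surfaceSignedDist_add_smul_normal hΓ hP hxU hx ht₀R.le hR
  obtain ⟨r, hr, N, hN, hsN, w, b, b', hw, hb, hb', hrep⟩ :=
    exists_polar_representation hΓ hν hP hx hn2 ht₀R hR
  have hbox : IsOpen (Ioo (-r) r ×ˢ N) := isOpen_Ioo.prod hN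
  have hL := contDiffOn_polarKernel hw hb hb' fun p hp => (hrep p hp).1
  have hsing : ∀ X (y : E2) (hy : y ≠ 0), ‖y‖ < r → singularFunction X ν P x z y =
      1 / ‖y‖ * polarKernel w b b' X (‖y‖, unitDir y hy) := by
    intro X y hy hyr
    have hmem : (‖y‖, (unitDir y hy : E2)) ∈ Ioo (-r) r ×ˢ N :=
      ⟨⟨by linarith [norm_nonneg y], hyr⟩, hsN (unitDir y hy).2⟩
    obtain ⟨-, h1, h2, h3⟩ := hrep _ hmem
    simp only [smul_unitDir] at h1 h2 h3
    exact singularFunction_eq_polarKernel hn2 hy h1 h2 h3 X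
  refine ⟨r, hr, fun X t u => polarKernel w b b' X (t, u),
    fun X => contMDiffOn_sphere_of_contDiffOn hsN (hL X), hsing, ?_⟩
  intro τ κ f hfr hgr g hg
  rw [hy₀, hη] at hg
  have hM : g.M = Matrix.diagonal κ := by rw [hg]; rfl
  have hgη : g.η = t₀ := by rw [hg]; rfl
  have hA : ∀ (y : E2) j, (g.A *ᵥ y.ofLp) j = ⟪τ j, horizontal y⟫ := fun y j => by
    rw [hg]; exact localData_A_mulVec _ _ _ _ _ _ _
  have hd : ∀ y : E2, g.d ⬝ᵥ y.ofLp = ⟪ν x, horizontal y⟫ := fun y => by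
    rw [hg]; exact localData_d_dotProduct _ _ _ _ _ _
  have ho := hfr.1
  obtain ⟨hf1, hf2⟩ := D.fderiv_graph hxU hx hgr hfr
  have H : HasGraphTaylor f κ g := by
    obtain ⟨h1, h2⟩ := graph_taylor (g := g) hgr.contDiffAt.self_of_nhds (hgr.apply_zero hx) hf1 hf2
      (by rw [hg]; rfl) (by rw [hg]; rfl) (by rw [hg]; rfl) (by rw [hg]; rfl)
    exact ⟨h1, h2⟩
  have hzero : ∀ u ∈ Metric.sphere (0 : E2) 1, ((0 : ℝ), u) ∈ Ioo (-r) r ×ˢ N := fun u hu =>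
    ⟨⟨by linarith, hr⟩, hsN hu⟩
  have hdw : ∀ u ∈ Metric.sphere (0 : E2) 1, HasDerivAt (fun t => w (t, u))
      (deriv (fun t => w (t, u)) 0) 0 := fun u hu =>
    (differentiableAt_slice hbox hw (hzero u hu)).hasDerivAt
  have hdb : ∀ u ∈ Metric.sphere (0 : E2) 1, HasDerivAt (fun t => b (t, u))
      (deriv (fun t => b (t, u)) 0) 0 := fun u hu =>
    (differentiableAt_slice hbox hb (hzero u hu)).hasDerivAt
  have hdb' : ∀ u ∈ Metric.sphere (0 : E2) 1, HasDerivAt (fun t => b' (t, u))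
      (deriv (fun t => b' (t, u)) 0) 0 := fun u hu =>
    (differentiableAt_slice hbox hb' (hzero u hu)).hasDerivAt
  -- The statement is left to unification with the conclusion of `ray_coefficients`, for the ray in
  -- direction u.
  have hray : ∀ u (hu : u ∈ Metric.sphere (0 : E2) 1), _ := fun u hu => by
    have hev : ∀ᶠ t in 𝓝 (0 : ℝ), (t, u) ∈ Ioo (-r) r ×ˢ N :=
      (by fun_prop : Continuous fun t : ℝ => (t, u)).continuousAt.eventually
        (hbox.mem_nhds (hzero u hu))
    have hq : ∀ᶠ t in 𝓝 (0 : ℝ), P (x + t₀ • ν x + horizontal (t • u)) = x + t • w (t, u) := by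
      filter_upwards [hev] with t ht
      rw [← (hrep _ ht).2.1, add_relativeClosestPoint]
    exact D.ray_coefficients hP hxU hx hgr ho H (hdw u hu) (hdb u hu) (hdb' u hu) hq
      (by
        filter_upwards [hev, hq] with t ht h1
        rw [← h1, ← (hrep _ ht).2.1]
        exact (hrep _ ht).2.2.1)
      (by
        filter_upwards [hev] with t ht
        rw [← (hrep _ ht).2.1]
        exact (hrep _ ht).2.2.2) rfl rfl
  -- Invertibility comes from the existence of the expansion itself: (1 - ηκⱼ)vⱼ = ⟨τⱼ, (u, 0)⟩ for
  -- every direction u, and the right side is nonzero for some u because n₃ ≠ 0.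
  have hl : ∀ j, 1 - g.η * κ j ≠ 0 := by
    intro j h0
    obtain ⟨u, hu, hne⟩ := exists_inner_horizontal_ne_zero ho hn2 j
    have := (hray u hu).1 j
    rw [← hgη, h0, zero_mul] at this
    exact hne this.symm
  have hψ : ∀ y : E2, y ≠ 0 → g.ψ₀ (WithLp.ofLp y) ≠ 0 := by
    intro y hy h0
    rw [LocalData.ψ₀, norm_eq_zero] at h0
    obtain ⟨j, hj⟩ := exists_inner_ne_zero ho hn2 hy
    have h1 : g.χ₀ y.ofLp j = 0 := congrArg (fun v : E2 => v j) h0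
    rw [g.χ₀_apply hM hl, hA] at h1
    exact mul_ne_zero (inv_ne_zero (hl j)) hj h1
  -- the coefficients on the unit circle, in terms of the local data
  have hcoef : ∀ u ∈ Metric.sphere (0 : E2) 1,
      ‖w (0, u)‖ = g.ψ₀ u.ofLp ∧
      ⟪w (0, u), deriv (fun t => w (t, u)) 0⟫ / ‖w (0, u)‖ = g.ψ₁ u.ofLp ∧
      b (0, u) = g.ξ₀ u.ofLp ∧ deriv (fun t => b (t, u)) 0 = g.ξt₁ u.ofLp ∧
      b' (0, u) = g.ξ₀ u.ofLp ∧ deriv (fun t => b' (t, u)) 0 = g.ξ₁ u.ofLp := by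
    intro u hu
    obtain ⟨h1, h2, h3, h4, h5, h6, h7⟩ := hray u hu
    set w₁ := deriv (fun t => w (t, u)) 0 with hw₁
    set v : E2 := !₂[⟪τ 0, w (0, u)⟫, ⟪τ 1, w (0, u)⟫] with hv
    set v' : E2 := !₂[⟪τ 0, w₁⟫, ⟪τ 1, w₁⟫] with hv'
    have e0 : v.ofLp = g.χ₀ u.ofLp := by
      funext j
      rw [g.χ₀_apply hM hl, hA, ← h1 j, hgη, inv_mul_cancel_left₀ (hgη ▸ hl j)]
    have e1 : v'.ofLp = g.χ₁ u.ofLp := by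
      funext j
      rw [g.χ₁_apply hM hl, hd, ← e0, hgη, ← h2 j, inv_mul_cancel_left₀ (hgη ▸ hl j)]
    have hψ0 : g.ψ₀ u.ofLp = ‖v‖ := by rw [LocalData.ψ₀, ← e0]
    have hnorm : ‖w (0, u)‖ = g.ψ₀ u.ofLp := by
      -- w(0, u) has no normal component, so its norm is that of its tangential coordinates χ₀.
      rw [hψ0, ← sq_eq_sq₀ (norm_nonneg _) (norm_nonneg _), ← real_inner_self_eq_norm_sq,
        frame_inner_eq ho, h3, EuclideanSpace.real_norm_sq_eq, Fin.sum_univ_two]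
      simp [hv]
      ring
    refine ⟨hnorm, ?_, ?_, ?_, ?_, ?_⟩
    · rw [LocalData.ψ₁, hnorm, frame_inner_eq ho, h3, ← e0, ← e1, dotProduct, Fin.sum_univ_two]
      simp [hv, hv']
    · rw [h4, g.ξ₀_eq hM hl, ← e0]
    · rw [h5, g.ξt₁_eq hM hl, ← e0, ← e1]
    · rw [h6, g.ξ₀_eq hM hl, ← e0]
    · rw [h7, g.ξ₁_eq hM hl, ← e0, ← e1]
  have hterm : ∀ X (y : E2) (hy : y ≠ 0),
      expansionTerm (fun t u => polarKernel w b b' X (t, u)) 0 y hy = g.s₀ X y ∧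
      expansionTerm (fun t u => polarKernel w b b' X (t, u)) 1 y hy = g.s₁ X y := by
    intro X y hy
    have hu := (unitDir y hy).2
    obtain ⟨c1, c2, c3, c4, c5, c6⟩ := hcoef _ hu
    have hray' := polarKernel_ray (hdw _ hu) (hdb _ hu) (hdb' _ hu) (hrep _ (hzero _ hu)).1 X
    have hofLp : (unitDir y hy : E2) = ‖y‖⁻¹ • y := rfl
    rw [expansionTerm_zero, expansionTerm_one, hray', c2]
    rw [c1, c3, c4, c5, c6, hofLp]
    refine ⟨?_, ?_⟩
    · cases X
      · simp only [polarKernel, LocalData.s₀]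
        rw [← hofLp, c1]
        ring
      · simp only [polarKernel, LocalData.s₀]
        rw [← hofLp, c1, c3]
        ring
      · simp only [polarKernel, LocalData.s₀]
        rw [← hofLp, c1, c5]
        ring
    · cases X <;> rfl
  refine ⟨g.det_ne_zero hM hl, hψ, fun X => ⟨hterm X, ?_⟩⟩
  -- The remainder of |y| s(y) is at most C|y|², uniformly in the direction, and division by |y|
  -- gives the claimed order.
  obtain ⟨C, hC⟩ := exists_radial_remainder_bound hr hN hsN (hL X)
  refine IsBigO.of_bound C ?_
  have hsmall : ∀ᶠ y in 𝓝[≠] (0 : E2), ‖y‖ < r / 2 := by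
    refine nhdsWithin_le_nhds ?_
    filter_upwards [Metric.ball_mem_nhds (0 : E2) (half_pos hr)] with y hy
    exact mem_ball_zero_iff.1 hy
  filter_upwards [hsmall, self_mem_nhdsWithin] with y hyr (hy : y ≠ 0)
  have hy0 : 0 < ‖y‖ := norm_pos_iff.2 hy
  have h1 := hC ‖y‖ ⟨norm_nonneg y, hyr.le⟩ _ (unitDir y hy).2
  rw [hsing X y hy (by linarith), ← (hterm X y hy).1, ← (hterm X y hy).2, expansionTerm_zero,
    expansionTerm_one, norm_norm]
  have h2 : 1 / ‖y‖ * polarKernel w b b' X (‖y‖, unitDir y hy) -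
      (‖y‖⁻¹ * polarKernel w b b' X (0, unitDir y hy) +
        deriv (fun t => polarKernel w b b' X (t, unitDir y hy)) 0) =
      ‖y‖⁻¹ * (polarKernel w b b' X (‖y‖, unitDir y hy) -
        (polarKernel w b b' X (0, unitDir y hy) +
          ‖y‖ * deriv (fun t => polarKernel w b b' X (t, unitDir y hy)) 0)) := by
    field_simp
  rw [h2, norm_mul, Real.norm_eq_abs, Real.norm_eq_abs, abs_of_pos (inv_pos.2 hy0)]
  calc _ ≤ ‖y‖⁻¹ * (C * ‖y‖ ^ 2) := by gcongr
    _ = C * ‖y‖ := by field_simp
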